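/- Let $0<k_1<k_2$ and let $R>0$ be a constant; put $\alpha=\arctan(R)/\pi\in(0,1/2)$. A function $u:\mathbb R\to\mathbb R$ is called a symmetric primitive potential with constant dressing $R$ on $[k_1,k_2]$ if there are real functions $f(q,x)$, $g(q,x)$ on $[k_1,k_2]\times\mathbb R$ such that, for every $x\in\mathbb R$, $f(\cdot,x)$ and $g(\cdot,x)$ belong to $L^2(k_1,k_2)$ and, for almost every $p\in[k_1,k_2]$, the principal values below exist and $$f(p,x)+\frac{R}{\pi}e^{-2px}\left[\int_{k_1}^{k_2}\frac{f(q,x)}{p+q}\,dq+\mathrm{p.v.}\!\int_{k_1}^{k_2}\frac{g(q,x)}{p-q}\,dq\right]=R\,e^{-2px},$$ $$g(p,x)+\frac{R}{\pi}e^{2px}\left[\mathrm{p.v.}\!\int_{k_1}^{k_2}\frac{f(q,x)}{p-q}\,dq+\int_{k_1}^{k_2}\frac{g(q,x)}{p+q}\,dq\right]=-R\,e^{2px},$$ and such that for every $x\in\mathbb R$ the following derivative exists and $$u(x)=\frac{2}{\pi}\frac{d}{dx}\int_{k_1}^{k_2}\bigl[f(q,x)+g(q,x)\bigr]\,dq .$$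 Then there is exactly one symmetric primitive potential $u$ with constant dressing $R$ on $[k_1,k_2]$; it is real-analytic in a neighbourhood of $x=0$, and its Taylor expansion there is $$u(x)=-4\alpha(k_2^2-k_1^2)+4\alpha(k_2^2-k_1^2)\bigl(4\alpha(k_2^2-k_1^2)-(k_2^2+k_1^2)\bigr)x^2+O(x^4)\qquad(x\to0).$$ -/

import Mathlib

open Filter Topology MeasureTheory

/-- `HasPVIntegral a b φ p I`: the principal value integral over `[a, b]` of a function `φ` with a
singularity at `p` exists and is equal to `I`, i.e. the integral of `φ` over
`{q ∈ [a, b] : |q - p| ≥ ε}` tends to `I` as `ε → 0+`. -/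
def HasPVIntegral (a b : ℝ) (φ : ℝ → ℝ) (p I : ℝ) : Prop :=
  Tendsto (fun ε : ℝ => ∫ q in Set.Icc a b \ Metric.ball p ε, φ q) (𝓝[>] 0) (𝓝 I)

/-- The pair of spectral densities `(f, g)`, square-integrable on `[k₁, k₂]`, solves at the point
`x` (and at time `t = 0`) the system of singular integral equations with dressing functions `R₁`
and `R₂`:
`f(p) + R₁(p)/π e^{-2px} [∫ f(q)/(p+q) dq + p.v.∫ g(q)/(p-q) dq] = R₁(p) e^{-2px}`,
`g(p) + R₂(p)/π e^{2px} [p.v.∫ f(q)/(p-q) dq + ∫ g(q)/(p+q) dq] = -R₂(p) e^{2px}`,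
for almost every `p ∈ [k₁, k₂]`; the existence of the principal values is part of the condition. -/
structure IsDressingSolution (k₁ k₂ : ℝ) (R₁ R₂ : ℝ → ℝ) (x : ℝ) (f g : ℝ → ℝ) : Prop where
  memLp_f : MemLp f 2 (volume.restrict (Set.Icc k₁ k₂))
  memLp_g : MemLp g 2 (volume.restrict (Set.Icc k₁ k₂))
  eq_f : ∀ᵐ p ∂(volume.restrict (Set.Icc k₁ k₂)),
    ∃ I : ℝ, HasPVIntegral k₁ k₂ (fun q => g q / (p - q)) p I ∧
      f p + R₁ p / Real.pi * Real.exp (-2 * p * x) * ((∫ q in k₁..k₂, f q / (p + q)) + I)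
        = R₁ p * Real.exp (-2 * p * x)
  eq_g : ∀ᵐ p ∂(volume.restrict (Set.Icc k₁ k₂)),
    ∃ I : ℝ, HasPVIntegral k₁ k₂ (fun q => f q / (p - q)) p I ∧
      g p + R₂ p / Real.pi * Real.exp (2 * p * x) * (I + ∫ q in k₁..k₂, g q / (p + q))
        = -(R₂ p * Real.exp (2 * p * x))

/-- `u` is a primitive potential with dressing functions `R₁`, `R₂` on `[k₁, k₂]`:
`u(x) = (2/π) d/dx ∫ [f(q, x) + g(q, x)] dq`, where for every real `x` the pair
`(f(·, x), g(·, x))` solves the dressing equations. -/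
def IsPrimitivePotential (k₁ k₂ : ℝ) (R₁ R₂ : ℝ → ℝ) (u : ℝ → ℝ) : Prop :=
  ∃ f g : ℝ → ℝ → ℝ,
    (∀ x, IsDressingSolution k₁ k₂ R₁ R₂ x (fun q => f q x) (fun q => g q x)) ∧
    ∀ x, HasDerivAt (fun y => 2 / Real.pi * ∫ q in k₁..k₂, (f q y + g q y)) (u x) x

/-- `u` is a symmetric primitive potential: the two dressing functions are equal. -/
def IsSymmetricPrimitivePotential (k₁ k₂ : ℝ) (R : ℝ → ℝ) (u : ℝ → ℝ) : Prop :=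
  IsPrimitivePotential k₁ k₂ R R u

/-!
A pair `(f, g)` of densities is a single function `v` on the bands `[-k₂, -k₁] ∪ [k₁, k₂]`, equal to
`g(p)` at `p` and to `f(p)` at `-p`. The dressing equations become `M(x) v = -b` with
`M(x) = R⁻¹ exp(xQ) + T`, where `b` is the sign function of the bands, `Q` is the multiplication by
`-2p` and `T` is, up to the sign function, the Hilbert transform followed by `p ↦ -p`. The Carleman
kernel `1 / (p + q)`, the square of the Laplace transform, makes `T` positive semidefinite, so
`M(x)` is coercive; hence the solution is unique, it depends analytically on `x`, and
`∫ (f + g) = -B(b, M(x)⁻¹ b)` for the indefinite form `B(u, v) = ∫ sgn(p) u(p) v(p) dp`.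

The commutator of the Hilbert transform with the multiplication by `p` has rank one, so `QT + TQ` is
a multiple of `B(b, ·) b`. This closes the derivatives of the moments `B(Qᵐ b, M(x)⁻¹ Qⁿ b)`, and
since the reflection makes `B(b, M(x)⁻¹ b)` odd in `x`, the first two nonzero Taylor coefficients of
`u` depend only on the moments of `M(0)⁻¹ b` against `p` and `p³`.

At `x = 0` the equation is solved by the Jacobi weight `((p² - k₁²) / (k₂² - p²)) ^ α` with the sign
of `p`: its Cauchy transform satisfies a first-order linear differential equation in the upper
half plane, which has an elementary solution with the same limit at infinity.
-/

open scoped FourierTransform ENNReal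

section MultiplicationOperator

variable {α 𝕜 : Type*} [RCLike 𝕜] [MeasurableSpace α] {μ : Measure α} {m m' : α → 𝕜}

/-- Multiplication by an essentially bounded function, as a bounded operator on `L²(μ)`. -/
noncomputable def mulOperator (hm : MemLp m ∞ μ) : Lp 𝕜 2 μ →L[𝕜] Lp 𝕜 2 μ :=
  (ContinuousLinearMap.mul 𝕜 𝕜).holderL μ ∞ 2 2 (hm.toLp m)

theorem mulOperator_ae_eq (hm : MemLp m ∞ μ) (f : Lp 𝕜 2 μ) :
    mulOperator hm f =ᵐ[μ] fun a => m a * f a := by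
  filter_upwards [(ContinuousLinearMap.mul 𝕜 𝕜).coeFn_holder (r := 2) (hm.toLp m) f,
    hm.coeFn_toLp] with a h hma
  rw [← hma]
  exact h

theorem mulOperator_toLp (hm : MemLp m ∞ μ) {f : α → 𝕜} (hf : MemLp f 2 μ) :
    mulOperator hm (hf.toLp f) =ᵐ[μ] fun a => m a * f a := by
  filter_upwards [mulOperator_ae_eq hm (hf.toLp f), hf.coeFn_toLp] with a h hfa
  rw [h, hfa]

theorem mulOperator_neg (hm : MemLp m ∞ μ) : mulOperator hm.neg = -mulOperator hm := by
  rw [mulOperator, mulOperator, MemLp.toLp_neg, map_neg]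

theorem inner_mulOperator (hm : MemLp m ∞ μ) (hm' : MemLp m' ∞ μ)
    (hconj : ∀ a, m' a = starRingEnd 𝕜 (m a)) (f g : Lp 𝕜 2 μ) :
    inner 𝕜 (mulOperator hm f) g = inner 𝕜 f (mulOperator hm' g) := by
  rw [L2.inner_def, L2.inner_def]
  refine integral_congr_ae ?_
  filter_upwards [mulOperator_ae_eq hm f, mulOperator_ae_eq hm' g] with a hf hg
  rw [hf, hg, hconj, RCLike.inner_apply, RCLike.inner_apply, map_mul]
  ring

end MultiplicationOperator

theorem toLp_fourier_ae_eq {E F : Type*} [NormedAddCommGroup E] [InnerProductSpace ℝ E]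
    [FiniteDimensional ℝ E] [MeasurableSpace E] [BorelSpace E] [NormedAddCommGroup F]
    [InnerProductSpace ℂ F] [CompleteSpace F] {f : E → F} (hf : Integrable f)
    (hf2 : MemLp f 2) : (𝓕 (hf2.toLp f) : Lp F 2 (volume : Measure E)) =ᵐ[volume] 𝓕 f := by
  have hcont : Continuous (𝓕 f) :=
    VectorFourier.fourierIntegral_continuous Real.continuous_fourierChar continuous_inner hf
  refine ae_eq_of_integral_contDiff_smul_eq ((Lp.memLp _).locallyIntegrable one_le_two)
    hcont.locallyIntegrable fun g hg hg_supp => ?_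
  let φ : SchwartzMap E ℂ := (hg_supp.comp_left Complex.ofReal_zero).toSchwartzMap
    (Complex.ofRealCLM.contDiff.comp hg)
  have hφ (v : F) (x : E) : g x • v = φ x • v := (Complex.coe_smul (g x) v).symm
  calc ∫ x, g x • (𝓕 (hf2.toLp f) : Lp F 2 (volume : Measure E)) x
      = ∫ x, (𝓕 φ) x • hf2.toLp f x := by
        simp_rw [hφ]
        rw [← Lp.toTemperedDistribution_apply, ← Lp.fourier_toTemperedDistribution_eq,
          TemperedDistribution.fourier_apply, Lp.toTemperedDistribution_apply]
    _ = ∫ x, (𝓕 φ) x • f x :=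
        integral_congr_ae (hf2.coeFn_toLp.mono fun x hx => by simp only [hx])
    _ = ∫ x, g x • 𝓕 f x := by
        simp_rw [hφ]
        simpa using! VectorFourier.integral_fourierIntegral_smul_eq_flip (L := innerₗ E)
          Real.continuous_fourierChar continuous_inner φ.integrable hf

/-- The Poisson kernel of the upper half-plane, without the customary factor `1 / π`. -/
noncomputable def poissonKer (y t : ℝ) : ℝ := y / (t ^ 2 + y ^ 2)

/-- The conjugate Poisson kernel of the upper half-plane, without the customary factor `1 / π`.
It regularizes the Hilbert kernel `1 / t`, the limit as `y → 0`. -/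
noncomputable def conjPoissonKer (y t : ℝ) : ℝ := t / (t ^ 2 + y ^ 2)

section PoissonKernel

variable {y : ℝ}

theorem poissonKer_nonneg (hy : 0 < y) (t : ℝ) : 0 ≤ poissonKer y t := by
  unfold poissonKer; positivity

theorem conjPoissonKer_neg (y t : ℝ) : conjPoissonKer y (-t) = -conjPoissonKer y t := by
  simp [conjPoissonKer, neg_div]

theorem poissonKer_neg_left (y t : ℝ) : poissonKer (-y) t = -poissonKer y t := by
  simp [poissonKer, neg_div]

theorem conjPoissonKer_neg_left (y t : ℝ) : conjPoissonKer (-y) t = conjPoissonKer y t := by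
  simp [conjPoissonKer]

theorem sq_conjPoissonKer_add_sq_poissonKer (hy : 0 < y) (t : ℝ) :
    conjPoissonKer y t ^ 2 + poissonKer y t ^ 2 = poissonKer y t / y := by
  unfold poissonKer conjPoissonKer
  have : t ^ 2 + y ^ 2 ≠ 0 := by positivity
  field_simp

theorem continuous_poissonKer (hy : 0 < y) : Continuous (poissonKer y) := by
  unfold poissonKer
  exact continuous_const.div (by fun_prop) fun t => by positivity

theorem continuous_conjPoissonKer (hy : 0 < y) : Continuous (conjPoissonKer y) := by
  unfold conjPoissonKer
  exact continuous_id.div (by fun_prop) fun t => by positivity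

theorem poissonKer_eq_inv_one_add_sq (hy : 0 < y) :
    poissonKer y = fun t => y⁻¹ * (1 + (t / y) ^ 2)⁻¹ := by
  funext t
  unfold poissonKer
  field_simp
  ring

theorem integrable_poissonKer (hy : 0 < y) : Integrable (poissonKer y) := by
  rw [poissonKer_eq_inv_one_add_sq hy]
  exact (integrable_inv_one_add_sq.comp_div hy.ne').const_mul _

theorem integral_poissonKer (hy : 0 < y) : ∫ t, poissonKer y t = Real.pi := by
  rw [poissonKer_eq_inv_one_add_sq hy, integral_const_mul,
    Measure.integral_comp_div (fun t : ℝ => (1 + t ^ 2)⁻¹) y, integral_univ_inv_one_add_sq,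
    abs_of_pos hy, smul_eq_mul, ← mul_assoc, inv_mul_cancel₀ hy.ne', one_mul]

theorem memLp_two_of_sq_le_poissonKer (hy : 0 < y) {k : ℝ → ℝ} (hk : Continuous k)
    (hle : ∀ t, k t ^ 2 ≤ poissonKer y t / y) : MemLp k 2 := by
  rw [memLp_two_iff_integrable_sq hk.aestronglyMeasurable]
  refine ((integrable_poissonKer hy).div_const y).mono' (hk.pow 2).aestronglyMeasurable
    (Eventually.of_forall fun t => ?_)
  rw [Real.norm_of_nonneg (sq_nonneg _)]
  exact hle t

theorem memLp_poissonKer (hy : 0 < y) : MemLp (poissonKer y) 2 :=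
  memLp_two_of_sq_le_poissonKer hy (continuous_poissonKer hy) fun t => by
    linarith [sq_conjPoissonKer_add_sq_poissonKer hy t, sq_nonneg (conjPoissonKer y t)]

theorem memLp_conjPoissonKer (hy : 0 < y) : MemLp (conjPoissonKer y) 2 :=
  memLp_two_of_sq_le_poissonKer hy (continuous_conjPoissonKer hy) fun t => by
    linarith [sq_conjPoissonKer_add_sq_poissonKer hy t, sq_nonneg (poissonKer y t)]

end PoissonKernel

theorem memLp_comp_sub_left {k : ℝ → ℝ} (hk : MemLp k 2) (p : ℝ) :
    MemLp (fun q => k (p - q)) 2 :=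
  hk.comp_measurePreserving (Measure.measurePreserving_sub_left volume p)

section FourierOfKernels

open Complex

theorem inv_add_mul_I (t y : ℝ) :
    ((t : ℂ) + y * I)⁻¹ = conjPoissonKer y t - poissonKer y t * I := by
  apply Complex.ext <;>
    simp [conjPoissonKer, poissonKer, normSq_apply, ← sq, neg_div, -ofReal_div, -ofReal_mul]

/-- The integrand `e^{-2πy|v|} e^{2πipv}` of the Fourier representation of the Poisson kernel
centred at `p`. -/
noncomputable def poissonWave (y p v : ℝ) : ℂ :=
  cexp (-(2 * Real.pi * y * |v| : ℝ) + (2 * Real.pi * p * v : ℝ) * I)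

theorem continuous_poissonWave (y p : ℝ) : Continuous (poissonWave y p) := by
  unfold poissonWave
  fun_prop

theorem exp_mul_poissonWave (y p q v : ℝ) :
    cexp ((-2 * Real.pi * v * q : ℝ) * I) * poissonWave y p v =
      cexp (-(2 * Real.pi) * (y * (|v| : ℝ) + (q - p) * v * I)) := by
  rw [poissonWave, ← Complex.exp_add]
  congr 1
  push_cast
  ring

variable {y : ℝ}

theorem norm_poissonWave (y p v : ℝ) :
    ‖poissonWave y p v‖ = Real.exp (-(2 * Real.pi * y) * |v|) := by
  rw [poissonWave, Complex.norm_exp]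
  simp

theorem integrable_exp_neg_mul_abs {c : ℝ} (hc : 0 < c) :
    Integrable fun v : ℝ => Real.exp (-c * |v|) := by
  rw [← integrableOn_univ, ← Set.Iic_union_Ioi (a := (0 : ℝ)), integrableOn_union]
  refine ⟨(integrableOn_exp_mul_Iic hc 0).congr_fun (fun v hv => ?_) measurableSet_Iic,
    (integrableOn_exp_mul_Ioi (neg_lt_zero.2 hc) 0).congr_fun (fun v hv => ?_) measurableSet_Ioi⟩
  · rw [abs_of_nonpos hv, neg_mul_neg]
  · rw [abs_of_pos hv]

theorem integrable_poissonWave (hy : 0 < y) (p : ℝ) : Integrable (poissonWave y p) := by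
  rw [← integrable_norm_iff (continuous_poissonWave y p).aestronglyMeasurable]
  simp_rw [norm_poissonWave]
  exact integrable_exp_neg_mul_abs (by positivity)

theorem memLp_poissonWave (hy : 0 < y) (p : ℝ) : MemLp (poissonWave y p) 2 := by
  rw [memLp_two_iff_integrable_sq_norm (continuous_poissonWave y p).aestronglyMeasurable]
  have h := (integrable_poissonWave (y := 2 * y) (by positivity) p).norm
  simp_rw [norm_poissonWave] at h ⊢
  refine h.congr (Eventually.of_forall fun v => ?_)
  simp only [← Real.exp_nat_mul]
  congr 1
  push_cast
  ring

theorem integral_ite_mul_cexp {a b : ℂ} (ha : a.re < 0) (hb : 0 < b.re) (A B : ℂ) :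
    ∫ v : ℝ, (if 0 < v then A * cexp (a * v) else B * cexp (b * v)) = B * b⁻¹ - A * a⁻¹ := by
  have hpos : Set.EqOn (fun v : ℝ => if 0 < v then A * cexp (a * v) else B * cexp (b * v))
      (fun v => A * cexp (a * v)) (Set.Ioi 0) := fun v hv => if_pos hv
  have hneg : Set.EqOn (fun v : ℝ => if 0 < v then A * cexp (a * v) else B * cexp (b * v))
      (fun v => B * cexp (b * v)) (Set.Iic 0) := fun v hv => if_neg (not_lt.2 hv)
  rw [← intervalIntegral.integral_Iic_add_Ioi
    (IntegrableOn.congr_fun ((integrableOn_exp_mul_complex_Iic hb 0).const_mul B) hneg.symm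
      measurableSet_Iic)
    (IntegrableOn.congr_fun ((integrableOn_exp_mul_complex_Ioi ha 0).const_mul A) hpos.symm
      measurableSet_Ioi),
    setIntegral_congr_fun measurableSet_Iic hneg, setIntegral_congr_fun measurableSet_Ioi hpos,
    integral_const_mul, integral_const_mul, integral_exp_mul_complex_Iic hb,
    integral_exp_mul_complex_Ioi ha]
  simp only [ofReal_zero, mul_zero, Complex.exp_zero]
  ring

theorem fourier_ite_mul_poissonWave (hy : 0 < y) (p q : ℝ) (A B : ℂ) :
    𝓕 (fun v => (if 0 < v then A else B) * poissonWave y p v) q =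
      ((A + B) * poissonKer y (p - q) + (A - B) * I * conjPoissonKer y (p - q)) /
        (2 * Real.pi) := by
  set a : ℂ := 2 * Real.pi * I * ((p - q : ℝ) + y * I) with ha
  set b : ℂ := 2 * Real.pi * I * ((p - q : ℝ) + (-y : ℝ) * I) with hb
  have hpos : 0 < 2 * Real.pi * y := by positivity
  have ha_re : a.re < 0 := by simpa [ha] using hpos
  have hb_re : 0 < b.re := by simpa [hb] using hpos
  have hwave (v : ℝ) : cexp ((-2 * Real.pi * v * q : ℝ) * I) •
      ((if 0 < v then A else B) * poissonWave y p v) =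
        if 0 < v then A * cexp (a * v) else B * cexp (b * v) := by
    rw [smul_eq_mul, mul_left_comm, exp_mul_poissonWave, ite_mul]
    split_ifs with hv
    · rw [abs_of_pos hv, ha]
      congr 2
      push_cast
      linear_combination (2 * Real.pi * y * v : ℂ) * -I_sq
    · rw [abs_of_nonpos (not_lt.1 hv), hb]
      congr 2
      push_cast
      linear_combination (2 * Real.pi * y * v : ℂ) * I_sq
  simp only [Real.fourier_real_eq_integral_exp_smul, hwave]
  rw [integral_ite_mul_cexp ha_re hb_re, ha, hb, mul_inv _ (_ + _ : ℂ), mul_inv _ (_ + _ : ℂ),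
    inv_add_mul_I, inv_add_mul_I, mul_inv _ I, inv_I, poissonKer_neg_left, conjPoissonKer_neg_left]
  push_cast
  linear_combination (-(A + B) * poissonKer y (p - q) / (2 * Real.pi) : ℂ) * I_sq

theorem fourier_poissonWave (hy : 0 < y) (p q : ℝ) :
    𝓕 (poissonWave y p) q = (Real.pi : ℂ)⁻¹ * poissonKer y (p - q) := by
  have h := fourier_ite_mul_poissonWave hy p q 1 1
  simp only [ite_self, one_mul, sub_self, zero_mul, add_zero] at h
  rw [show 𝓕 (poissonWave y p) q = _ from h]
  field_simp
  ring

end FourierOfKernels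

section HilbertTransform

open Complex

theorem inner_reCLM_compLp {α : Type*} [MeasurableSpace α] {μ : Measure α} (F : Lp ℂ 2 μ)
    (g : Lp ℝ 2 μ) :
    inner ℝ (reCLM.compLpL 2 μ F) g = (inner ℂ F (ofRealCLM.compLpL 2 μ g)).re := by
  rw [L2.inner_def, L2.inner_def, ← RCLike.re_eq_complex_re,
    ← integral_re (L2.integrable_inner _ _)]
  refine integral_congr_ae ?_
  filter_upwards [reCLM.coeFn_compLpL F, ofRealCLM.coeFn_compLpL g] with a hF hg
  rw [hF, hg]
  simp

theorem memLp_top_ite_pi_mul_I :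
    MemLp (fun v : ℝ => if 0 < v then Real.pi * I else -(Real.pi * I)) ∞ volume := by
  refine memLp_top_of_bound (C := Real.pi) ?_ (Eventually.of_forall fun v => ?_)
  · exact (Measurable.ite measurableSet_Ioi measurable_const measurable_const).aestronglyMeasurable
  · split_ifs <;> simp [abs_of_pos Real.pi_pos]

/-- The Hilbert transform on complex `L²(ℝ)` as a Fourier multiplier, normalized as the
principal value convolution with `1 / t`. -/
noncomputable def complexHilbertTransform :
    Lp ℂ 2 (volume : Measure ℝ) →L[ℂ] Lp ℂ 2 (volume : Measure ℝ) :=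
  (Lp.fourierTransformₗᵢ ℝ ℂ).toContinuousLinearEquiv.toContinuousLinearMap ∘L
    mulOperator memLp_top_ite_pi_mul_I ∘L
    (Lp.fourierTransformₗᵢ ℝ ℂ).symm.toContinuousLinearEquiv.toContinuousLinearMap

theorem inner_complexHilbertTransform (f g : Lp ℂ 2 (volume : Measure ℝ)) :
    inner ℂ (complexHilbertTransform f) g = -inner ℂ f (complexHilbertTransform g) := by
  have hconj (v : ℝ) : -(if 0 < v then Real.pi * I else -(Real.pi * I)) =
      starRingEnd ℂ (if 0 < v then Real.pi * I else -(Real.pi * I)) := by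
    split_ifs <;> simp
  set F := Lp.fourierTransformₗᵢ ℝ ℂ
  calc inner ℂ (F (mulOperator memLp_top_ite_pi_mul_I (F.symm f))) g
      = inner ℂ (mulOperator memLp_top_ite_pi_mul_I (F.symm f)) (F.symm g) := by
        conv_lhs => rw [← F.apply_symm_apply g, F.inner_map_map]
    _ = inner ℂ (F.symm f) (-mulOperator memLp_top_ite_pi_mul_I (F.symm g)) := by
        rw [inner_mulOperator _ memLp_top_ite_pi_mul_I.neg hconj, mulOperator_neg]; rfl
    _ = -inner ℂ f (F (mulOperator memLp_top_ite_pi_mul_I (F.symm g))) := by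
        rw [inner_neg_right, ← F.inner_map_map, F.apply_symm_apply]

/-- The Hilbert transform on real `L²(ℝ)`, normalized as the principal value convolution with
`1 / t`. -/
noncomputable def hilbertTransform :
    Lp ℝ 2 (volume : Measure ℝ) →L[ℝ] Lp ℝ 2 (volume : Measure ℝ) :=
  reCLM.compLpL 2 volume ∘L complexHilbertTransform.restrictScalars ℝ ∘L ofRealCLM.compLpL 2 volume

theorem inner_hilbertTransform (f g : Lp ℝ 2 (volume : Measure ℝ)) :
    inner ℝ (hilbertTransform f) g = -inner ℝ f (hilbertTransform g) := by
  have h (f g : Lp ℝ 2 (volume : Measure ℝ)) : inner ℝ (hilbertTransform f) g =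
      (inner ℂ (complexHilbertTransform (ofRealCLM.compLpL 2 volume f))
        (ofRealCLM.compLpL 2 volume g)).re := inner_reCLM_compLp _ g
  rw [h, real_inner_comm, h, inner_complexHilbertTransform, neg_re, ← inner_conj_symm, conj_re]

theorem complexHilbertTransform_poissonKer {y : ℝ} (hy : 0 < y) (p : ℝ) {F : Lp ℂ 2 volume}
    (hF : F =ᵐ[volume] fun q => (poissonKer y (p - q) : ℂ)) :
    complexHilbertTransform F =ᵐ[volume] fun q => -(Real.pi * conjPoissonKer y (p - q) : ℂ) := by
  set wave := (memLp_poissonWave hy p).toLp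
  have hwave : Lp.fourierTransformₗᵢ ℝ ℂ wave =ᵐ[volume] 𝓕 (poissonWave y p) :=
    toLp_fourier_ae_eq (integrable_poissonWave hy p) (memLp_poissonWave hy p)
  have hF' : F = (Real.pi : ℂ) • Lp.fourierTransformₗᵢ ℝ ℂ wave := by
    refine Lp.ext ?_
    filter_upwards [hF, hwave, Lp.coeFn_smul (Real.pi : ℂ) (Lp.fourierTransformₗᵢ ℝ ℂ wave)]
      with q hFq hwaveq hsmul
    rw [hFq, hsmul, Pi.smul_apply, smul_eq_mul, hwaveq, fourier_poissonWave hy,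
      mul_inv_cancel_left₀ (ofReal_ne_zero.2 Real.pi_ne_zero)]
  have hmul : MemLp (fun v => (if 0 < v then Real.pi * I else -(Real.pi * I)) * poissonWave y p v)
      2 := (memLp_poissonWave hy p).mul memLp_top_ite_pi_mul_I
  have hmul1 : Integrable fun v =>
      (if 0 < v then Real.pi * I else -(Real.pi * I)) * poissonWave y p v :=
    (integrable_poissonWave hy p).mul_of_top_right memLp_top_ite_pi_mul_I
  have hH : complexHilbertTransform F = (Real.pi : ℂ) • 𝓕 (hmul.toLp _) := by
    rw [hF', map_smul]
    congr 1
    change Lp.fourierTransformₗᵢ ℝ ℂ (mulOperator _ ((Lp.fourierTransformₗᵢ ℝ ℂ).symm _)) =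
      Lp.fourierTransformₗᵢ ℝ ℂ _
    rw [LinearIsometryEquiv.symm_apply_apply]
    congr 1
    exact Lp.ext ((mulOperator_toLp _ _).trans hmul.coeFn_toLp.symm)
  rw [hH]
  filter_upwards [Lp.coeFn_smul (Real.pi : ℂ) (𝓕 (hmul.toLp _)), toLp_fourier_ae_eq hmul1 hmul]
    with q hsmul hfourier
  rw [hsmul, Pi.smul_apply, hfourier, fourier_ite_mul_poissonWave hy, smul_eq_mul]
  field_simp
  linear_combination (2 * conjPoissonKer y (p - q) : ℂ) * I_sq

theorem hilbertTransform_poissonKer {y : ℝ} (hy : 0 < y) (p : ℝ) :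
    hilbertTransform ((memLp_comp_sub_left (memLp_poissonKer hy) p).toLp _) =ᵐ[volume]
      fun q => -(Real.pi * conjPoissonKer y (p - q)) := by
  have hP := memLp_comp_sub_left (memLp_poissonKer hy) p
  have hF : ofRealCLM.compLpL 2 volume (hP.toLp _) =ᵐ[volume]
      fun q => (poissonKer y (p - q) : ℂ) := by
    filter_upwards [ofRealCLM.coeFn_compLpL (hP.toLp _), hP.coeFn_toLp] with q h hq
    rw [h, hq, ofRealCLM_apply]
  filter_upwards [reCLM.coeFn_compLpL
    (complexHilbertTransform (ofRealCLM.compLpL 2 volume (hP.toLp _))),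
    complexHilbertTransform_poissonKer hy p hF] with q h hq
  refine h.trans ?_
  rw [hq, reCLM_apply, ← ofReal_mul, ← ofReal_neg, ofReal_re]

end HilbertTransform

theorem integral_mul_conjPoissonKer_eq {y : ℝ} (hy : 0 < y) (p : ℝ)
    (f : Lp ℝ 2 (volume : Measure ℝ)) :
    ∫ q, f q * conjPoissonKer y (p - q) =
      Real.pi⁻¹ * ∫ q, hilbertTransform f q * poissonKer y (p - q) := by
  have hP := memLp_comp_sub_left (memLp_poissonKer hy) p
  have h := inner_hilbertTransform (hP.toLp _) f
  rw [real_inner_comm, L2.inner_def, L2.inner_def] at h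
  have hleft : ∫ q, inner ℝ (f q) (hilbertTransform (hP.toLp _) q) =
      -Real.pi * ∫ q, f q * conjPoissonKer y (p - q) := by
    rw [← integral_const_mul]
    refine integral_congr_ae ((hilbertTransform_poissonKer hy p).mono fun q hq => ?_)
    simp only [hq, RCLike.inner_apply, conj_trivial]
    ring
  have hright : ∫ q, inner ℝ (hP.toLp _ q) (hilbertTransform f q) =
      ∫ q, hilbertTransform f q * poissonKer y (p - q) := by
    refine integral_congr_ae (hP.coeFn_toLp.mono fun q hq => ?_)
    simp only [hq, RCLike.inner_apply, conj_trivial]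
  rw [hleft, hright, neg_mul, neg_inj] at h
  rw [← h, inv_mul_cancel_left₀ Real.pi_ne_zero]

section LebesguePoints

open ENNReal (ofReal)

variable {y : ℝ}

theorem ofReal_poissonKer_eq_lintegral (hy : 0 < y) (t : ℝ) :
    ofReal (poissonKer y t) =
      ∫⁻ r in Set.Ioi |t|, ofReal (2 * r * y / (r ^ 2 + y ^ 2) ^ 2) := by
  have hderiv : ∀ r ∈ Set.Ici |t|, HasDerivAt (fun r => -poissonKer y r)
      (2 * r * y / (r ^ 2 + y ^ 2) ^ 2) r := by
    intro r _
    have hden : HasDerivAt (fun r : ℝ => r ^ 2 + y ^ 2) (2 * r) r := by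
      simpa using (hasDerivAt_pow 2 r).add_const (y ^ 2)
    refine ((hasDerivAt_const r y).div hden (by positivity)).neg.congr_deriv ?_
    field_simp
    ring
  have hpos : ∀ r ∈ Set.Ioi |t|, 0 ≤ 2 * r * y / (r ^ 2 + y ^ 2) ^ 2 := by
    intro r hr
    have : 0 < r := (abs_nonneg t).trans_lt hr
    positivity
  have hlim : Tendsto (fun r => -poissonKer y r) atTop (𝓝 0) := by
    unfold poissonKer
    simpa using (tendsto_const_nhds (x := y).div_atTop
      (tendsto_atTop_add_const_right _ (y ^ 2) (tendsto_pow_atTop two_ne_zero))).neg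
  rw [← ofReal_integral_eq_lintegral_ofReal (integrableOn_Ioi_deriv_of_nonneg' hderiv hpos hlim)
    ((ae_restrict_iff' measurableSet_Ioi).2 (Eventually.of_forall hpos)),
    integral_Ioi_of_hasDerivAt_of_nonneg' hderiv hpos hlim]
  simp [poissonKer]

theorem lintegral_mul_poissonKer_eq_lintegral_ball {u : ℝ → ℝ≥0∞} (hu : AEMeasurable u)
    (hy : 0 < y) (p : ℝ) :
    ∫⁻ s, u s * ofReal (poissonKer y (p - s)) =
      ∫⁻ r in Set.Ioi 0, (∫⁻ s in Metric.ball p r, u s) *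
        ofReal (2 * r * y / (r ^ 2 + y ^ 2) ^ 2) := by
  set K : ℝ → ℝ≥0∞ := fun r => ofReal (2 * r * y / (r ^ 2 + y ^ 2) ^ 2)
  have hK : Measurable K := by fun_prop
  let A : Set (ℝ × ℝ) := {z | |p - z.1| < z.2}
  have hA : MeasurableSet A :=
    measurableSet_lt (continuous_const.sub continuous_fst).abs.measurable measurable_snd
  have hAK : Measurable (A.indicator fun z => K z.2) := (hK.comp measurable_snd).indicator hA
  calc ∫⁻ s, u s * ofReal (poissonKer y (p - s))
      = ∫⁻ s, ∫⁻ r in Set.Ioi 0, u s * A.indicator (fun z => K z.2) (s, r) := by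
        refine lintegral_congr fun s => ?_
        have hsection : (fun r => A.indicator (fun z => K z.2) (s, r)) =
            (Set.Ioi |p - s|).indicator K := by
          funext r
          simp [A, Set.indicator]
        rw [lintegral_const_mul (u s) (show Measurable fun r => A.indicator (fun z => K z.2) (s, r)
            from hAK.comp measurable_prodMk_left), ofReal_poissonKer_eq_lintegral hy, hsection,
          setLIntegral_indicator measurableSet_Ioi,
          Set.inter_eq_left.2 (Set.Ioi_subset_Ioi (abs_nonneg _))]
    _ = ∫⁻ r in Set.Ioi 0, ∫⁻ s, u s * A.indicator (fun z => K z.2) (s, r) :=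
        lintegral_lintegral_swap (hu.comp_fst.mul hAK.aemeasurable)
    _ = ∫⁻ r in Set.Ioi 0, (∫⁻ s in Metric.ball p r, u s) * K r := by
        refine lintegral_congr fun r => ?_
        rw [← lintegral_mul_const'' _ hu.restrict,
          ← lintegral_indicator Metric.isOpen_ball.measurableSet]
        refine lintegral_congr fun s => ?_
        have hmem : (s, r) ∈ A ↔ s ∈ Metric.ball p r := by
          rw [Metric.mem_ball, dist_comm, Real.dist_eq]; rfl
        by_cases hs : s ∈ Metric.ball p r
        · rw [Set.indicator_of_mem (hmem.2 hs), Set.indicator_of_mem hs]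
        · rw [Set.indicator_of_notMem (mt hmem.1 hs), Set.indicator_of_notMem hs, mul_zero]

theorem lintegral_mul_poissonKer_le {u : ℝ → ℝ≥0∞} (hu : AEMeasurable u) {p η : ℝ} (hη : 0 ≤ η)
    (hball : ∀ r, 0 < r → ∫⁻ s in Metric.ball p r, u s ≤ ofReal (η * r)) (hy : 0 < y) :
    ∫⁻ s, u s * ofReal (poissonKer y (p - s)) ≤ ofReal (2 * η * Real.pi) := by
  rw [lintegral_mul_poissonKer_eq_lintegral_ball hu hy]
  calc _ ≤ ∫⁻ r in Set.Ioi 0, ofReal (2 * η * poissonKer y r) := by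
        refine setLIntegral_mono' measurableSet_Ioi fun r (hr : 0 < r) => ?_
        refine (mul_le_mul_left (hball r hr) _).trans ?_
        rw [← ENNReal.ofReal_mul (by positivity)]
        refine ENNReal.ofReal_le_ofReal ?_
        rw [poissonKer, mul_div_assoc', mul_div_assoc', div_le_div_iff₀ (by positivity)
          (by positivity)]
        have : r ^ 2 ≤ r ^ 2 + y ^ 2 := le_add_of_nonneg_right (sq_nonneg y)
        calc η * r * (2 * r * y) * (r ^ 2 + y ^ 2)
            = 2 * η * y * (r ^ 2 + y ^ 2) * r ^ 2 := by ring
          _ ≤ 2 * η * y * (r ^ 2 + y ^ 2) * (r ^ 2 + y ^ 2) := by gcongr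
          _ = 2 * η * y * (r ^ 2 + y ^ 2) ^ 2 := by ring
    _ ≤ ∫⁻ r, ofReal (2 * η * poissonKer y r) := setLIntegral_le_lintegral _ _
    _ = ofReal (2 * η * Real.pi) := by
        rw [← ofReal_integral_eq_lintegral_ofReal ((integrable_poissonKer hy).const_mul _)
          (Eventually.of_forall fun r => mul_nonneg (by positivity) (poissonKer_nonneg hy r)),
          integral_const_mul, integral_poissonKer hy]

theorem poissonKer_le_of_le_abs {δ t : ℝ} (hδ : 0 < δ) (hy : 0 < y) (ht : δ ≤ |t|) :
    poissonKer y t ≤ y * ((1 + δ ^ 2) / δ ^ 2) * poissonKer 1 t := by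
  have hsq : δ ^ 2 ≤ t ^ 2 := by rw [← sq_abs t]; gcongr
  unfold poissonKer
  rw [mul_assoc, div_mul_div_comm, ← mul_div_assoc, div_le_div_iff₀ (by positivity) (by positivity),
    mul_assoc]
  refine mul_le_mul_of_nonneg_left ?_ hy.le
  nlinarith [mul_nonneg (sq_nonneg δ) (sq_nonneg y), sq_nonneg y]

theorem lintegral_enorm_sub_mul_poissonKer_lt_top {h : ℝ → ℝ} (hh : MemLp h 2) (c p : ℝ)
    (hy : 0 < y) : ∫⁻ s, ‖h s - c‖ₑ * ofReal (poissonKer y (p - s)) < ⊤ := by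
  have hint : Integrable fun s => (h s - c) * poissonKer y (p - s) := by
    simp only [sub_mul]
    exact (hh.integrable_mul (memLp_comp_sub_left (memLp_poissonKer hy) p)).sub
      (((integrable_poissonKer hy).comp_sub_left p).const_mul c)
  refine lt_of_eq_of_lt (lintegral_congr fun s => ?_) hint.2
  rw [enorm_mul, Real.enorm_of_nonneg (poissonKer_nonneg hy _)]

theorem lintegral_compl_ball_mul_poissonKer_le {u : ℝ → ℝ≥0∞} {δ p : ℝ}
    (hδ : 0 < δ) (hy : 0 < y) :
    ∫⁻ s in (Metric.ball p δ)ᶜ, u s * ofReal (poissonKer y (p - s)) ≤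
      ofReal (y * ((1 + δ ^ 2) / δ ^ 2)) * ∫⁻ s, u s * ofReal (poissonKer 1 (p - s)) := by
  rw [← lintegral_const_mul' _ _ ENNReal.ofReal_ne_top]
  refine (setLIntegral_mono' Metric.isOpen_ball.measurableSet.compl fun s hs => ?_).trans
    (setLIntegral_le_lintegral _ _)
  rw [Set.mem_compl_iff, Metric.mem_ball, dist_comm, Real.dist_eq, not_lt] at hs
  rw [mul_left_comm, ← ENNReal.ofReal_mul (by positivity)]
  exact mul_le_mul_right (ENNReal.ofReal_le_ofReal (poissonKer_le_of_le_abs hδ hy hs)) _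

theorem tendsto_lintegral_mul_poissonKer {u : ℝ → ℝ≥0∞} (hu : AEMeasurable u) {p : ℝ}
    (hfin : ∫⁻ s, u s * ofReal (poissonKer 1 (p - s)) ≠ ⊤)
    (hball : ∀ η > 0, ∃ δ > 0, ∀ r, 0 < r → r ≤ δ →
      ∫⁻ s in Metric.ball p r, u s ≤ ofReal (η * r)) :
    Tendsto (fun y => ∫⁻ s, u s * ofReal (poissonKer y (p - s))) (𝓝[>] 0) (𝓝 0) := by
  rw [ENNReal.tendsto_nhds_zero]
  intro ε hε
  obtain ⟨n, hn0, hn⟩ := ENNReal.lt_iff_exists_nnreal_btwn.1 (ENNReal.half_pos hε.ne')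
  have hη : 0 < n / (2 * Real.pi) := div_pos (by exact_mod_cast hn0) (by positivity)
  obtain ⟨δ, hδ, hδr⟩ := hball _ hη
  have hfar : Tendsto (fun y : ℝ => ofReal (y * ((1 + δ ^ 2) / δ ^ 2)) *
      ∫⁻ s, u s * ofReal (poissonKer 1 (p - s))) (𝓝[>] 0) (𝓝 0) := by
    have hy : Tendsto (fun y : ℝ => y * ((1 + δ ^ 2) / δ ^ 2)) (𝓝[>] 0) (𝓝 0) :=
      ((continuous_mul_const _).tendsto' 0 0 (zero_mul _)).mono_left nhdsWithin_le_nhds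
    simpa using ENNReal.Tendsto.mul_const (ENNReal.tendsto_ofReal hy) (Or.inr hfin)
  have hballmeas : MeasurableSet (Metric.ball p δ) := Metric.isOpen_ball.measurableSet
  filter_upwards [self_mem_nhdsWithin,
    ENNReal.tendsto_nhds_zero.1 hfar (ε / 2) (ENNReal.half_pos hε.ne')] with y hy hyfar
  rw [← lintegral_add_compl _ hballmeas, ← ENNReal.add_halves ε]
  refine add_le_add ?_ ((lintegral_compl_ball_mul_poissonKer_le hδ hy).trans hyfar)
  have hnear :=
    lintegral_mul_poissonKer_le (hu.indicator hballmeas) hη.le (p := p) (fun r hr => ?_) hy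
  · rw [← lintegral_indicator hballmeas]
    simp_rw [Set.indicator_mul_left]
    rw [mul_div_assoc', mul_div_mul_comm, div_self two_ne_zero, one_mul,
      div_mul_cancel₀ _ Real.pi_ne_zero, ENNReal.ofReal_coe_nnreal] at hnear
    exact hnear.trans hn.le
  · have hinter : Metric.ball p δ ∩ Metric.ball p r = Metric.ball p (min δ r) := by
      ext s
      simp
    rw [setLIntegral_indicator hballmeas, hinter]
    refine (hδr _ (lt_min hδ hr) (min_le_left _ _)).trans (ENNReal.ofReal_le_ofReal ?_)
    gcongr
    exact min_le_right _ _

theorem ae_tendsto_lintegral_enorm_sub_mul_poissonKer {h : ℝ → ℝ} (hh : MemLp h 2) :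
    ∀ᵐ p, Tendsto (fun y => ∫⁻ s, ‖h s - h p‖ₑ * ofReal (poissonKer y (p - s)))
      (𝓝[>] 0) (𝓝 0) := by
  filter_upwards [(Besicovitch.vitaliFamily volume).ae_tendsto_lintegral_enorm_sub_div
    (hh.locallyIntegrable one_le_two)] with p hp
  refine tendsto_lintegral_mul_poissonKer (hh.1.sub aestronglyMeasurable_const).enorm
    (lintegral_enorm_sub_mul_poissonKer_lt_top hh _ _ one_pos).ne fun η hη => ?_
  have hη2 : 0 < ofReal (η / 2) := ENNReal.ofReal_pos.2 (half_pos hη)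
  obtain ⟨δ, hδ, hδsub⟩ := mem_nhdsGT_iff_exists_Ioc_subset.1
    ((ENNReal.tendsto_nhds_zero.1 (hp.comp (Besicovitch.tendsto_filterAt volume p))) _ hη2)
  refine ⟨δ, hδ, fun r hr hrδ => (lintegral_mono_set Metric.ball_subset_closedBall).trans ?_⟩
  have hmean := hδsub ⟨hr, hrδ⟩
  simp only [Set.mem_ofPred_eq, Function.comp_apply, Real.volume_closedBall] at hmean
  rwa [ENNReal.div_le_iff (by simp [hr]) ENNReal.ofReal_ne_top,
    ← ENNReal.ofReal_mul (half_pos hη).le, div_mul_eq_mul_div, mul_left_comm,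
    mul_div_cancel_left₀ _ two_ne_zero] at hmean

theorem tendsto_integral_mul_of_abs_le_poissonKer {h : ℝ → ℝ} (hh : MemLp h 2) {p : ℝ}
    (hp : Tendsto (fun y => ∫⁻ s, ‖h s - h p‖ₑ * ofReal (poissonKer y (p - s)))
      (𝓝[>] 0) (𝓝 0)) {D : ℝ → ℝ → ℝ} {m : ℝ} (hmeas : ∀ y, Measurable (D y))
    (hD : ∀ y t, 0 < y → |D y t| ≤ poissonKer y t) (hm : ∀ y, 0 < y → ∫ t, D y t = m) :
    Tendsto (fun y => ∫ s, h s * D y (p - s)) (𝓝[>] 0) (𝓝 (m * h p)) := by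
  rw [← tendsto_sub_nhds_zero_iff]
  refine squeeze_zero_norm' ?_ ((ENNReal.tendsto_toReal ENNReal.zero_ne_top).comp hp)
  filter_upwards [self_mem_nhdsWithin] with y hy
  have hDint : Integrable (D y) := (integrable_poissonKer hy).mono' (hmeas y).aestronglyMeasurable
    (Eventually.of_forall fun t => hD y t hy)
  have hDL2 : MemLp (D y) 2 := (memLp_poissonKer hy).mono (hmeas y).aestronglyMeasurable
    (Eventually.of_forall fun t => (hD y t hy).trans (le_abs_self _))
  have hmul : Integrable fun s => h s * D y (p - s) :=
    hh.integrable_mul (memLp_comp_sub_left hDL2 p)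
  have hsub : (∫ s, h s * D y (p - s)) - m * h p = ∫ s, (h s - h p) * D y (p - s) := by
    simp_rw [sub_mul]
    rw [integral_sub hmul ((hDint.comp_sub_left p).const_mul _), integral_const_mul,
      integral_sub_left_eq_self, hm y hy, mul_comm m]
  rw [hsub]
  refine (norm_integral_le_lintegral_norm _).trans (ENNReal.toReal_mono
    (lintegral_enorm_sub_mul_poissonKer_lt_top hh _ _ hy).ne (lintegral_mono fun s => ?_))
  rw [ofReal_norm, enorm_mul, Real.enorm_eq_ofReal_abs (D y (p - s))]
  exact mul_le_mul_right (ENNReal.ofReal_le_ofReal (hD y _ hy)) _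

end LebesguePoints

/-- The truncation `1_{|t| ≥ ε} / t` of the Hilbert kernel. -/
noncomputable def truncKer (ε t : ℝ) : ℝ := if ε ≤ |t| then t⁻¹ else 0

section PrincipalValue

variable {ε : ℝ}

theorem measurable_truncKer (ε : ℝ) : Measurable (truncKer ε) :=
  Measurable.ite (measurableSet_le measurable_const measurable_id.abs) measurable_inv
    measurable_const

theorem truncKer_neg (ε t : ℝ) : truncKer ε (-t) = -truncKer ε t := by
  unfold truncKer
  rw [abs_neg]
  split_ifs <;> simp [inv_neg]

theorem abs_truncKer_sub_conjPoissonKer_le (hε : 0 < ε) (t : ℝ) :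
    |truncKer ε t - conjPoissonKer ε t| ≤ poissonKer ε t := by
  have hden : 0 < t ^ 2 + ε ^ 2 := by positivity
  unfold truncKer conjPoissonKer poissonKer
  split_ifs with h
  · have htabs : 0 < |t| := hε.trans_le h
    have ht : t ≠ 0 := abs_pos.1 htabs
    have hdiff : t⁻¹ - t / (t ^ 2 + ε ^ 2) = ε ^ 2 / (t * (t ^ 2 + ε ^ 2)) := by
      field_simp
      ring
    rw [hdiff, abs_div, abs_mul, abs_of_pos hden, abs_of_nonneg (sq_nonneg ε),
      div_le_div_iff₀ (by positivity) hden]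
    nlinarith [mul_le_mul_of_nonneg_left h (mul_nonneg hε.le hden.le)]
  · rw [zero_sub, abs_neg, abs_div, abs_of_pos hden]
    exact div_le_div_of_nonneg_right (not_le.1 h).le hden.le

theorem integral_truncKer_sub_conjPoissonKer (ε : ℝ) :
    ∫ t, (truncKer ε t - conjPoissonKer ε t) = 0 := by
  have h := integral_neg_eq_self (fun t => truncKer ε t - conjPoissonKer ε t) volume
  simp_rw [truncKer_neg, conjPoissonKer_neg, ← neg_sub', integral_neg] at h
  linarith

theorem memLp_truncKer (hε : 0 < ε) : MemLp (truncKer ε) 2 := by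
  have hmeas : Measurable fun t => truncKer ε t - conjPoissonKer ε t :=
    (measurable_truncKer ε).sub (continuous_conjPoissonKer hε).measurable
  have hdiff := (memLp_poissonKer hε).mono hmeas.aestronglyMeasurable (Eventually.of_forall
    fun t => (abs_truncKer_sub_conjPoissonKer_le hε t).trans (le_abs_self _))
  refine (hdiff.add (memLp_conjPoissonKer hε)).ae_eq (Eventually.of_forall fun t => ?_)
  simp

theorem ae_tendsto_integral_mul_conjPoissonKer (f : Lp ℝ 2 (volume : Measure ℝ)) :
    ∀ᵐ p, Tendsto (fun y => ∫ q, f q * conjPoissonKer y (p - q)) (𝓝[>] 0)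
      (𝓝 (hilbertTransform f p)) := by
  filter_upwards [ae_tendsto_lintegral_enorm_sub_mul_poissonKer (Lp.memLp (hilbertTransform f))]
    with p hp
  have h := tendsto_integral_mul_of_abs_le_poissonKer (Lp.memLp (hilbertTransform f)) hp
    (fun y => by unfold poissonKer; fun_prop)
    (fun y t hy => (abs_of_nonneg (poissonKer_nonneg hy t)).le) fun y hy => integral_poissonKer hy
  have h' := h.const_mul Real.pi⁻¹
  rw [inv_mul_cancel_left₀ Real.pi_ne_zero] at h'
  refine h'.congr' ?_
  filter_upwards [self_mem_nhdsWithin] with y hy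
  exact (integral_mul_conjPoissonKer_eq hy p f).symm

theorem ae_tendsto_integral_mul_truncKer (f : Lp ℝ 2 (volume : Measure ℝ)) :
    ∀ᵐ p, Tendsto (fun ε => ∫ q, f q * truncKer ε (p - q)) (𝓝[>] 0)
      (𝓝 (hilbertTransform f p)) := by
  have hf := Lp.memLp f
  filter_upwards [ae_tendsto_integral_mul_conjPoissonKer f,
    ae_tendsto_lintegral_enorm_sub_mul_poissonKer hf] with p hconj hp
  have hdiff := tendsto_integral_mul_of_abs_le_poissonKer hf hp
    (D := fun ε t => truncKer ε t - conjPoissonKer ε t)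
    (fun ε => (measurable_truncKer ε).sub (by unfold conjPoissonKer; fun_prop))
    (fun ε t hε => abs_truncKer_sub_conjPoissonKer_le hε t)
    fun ε _ => integral_truncKer_sub_conjPoissonKer ε
  have hsum := hconj.add hdiff
  rw [zero_mul, add_zero] at hsum
  refine hsum.congr' ?_
  filter_upwards [self_mem_nhdsWithin] with ε hε
  have hQ := hf.integrable_mul (memLp_comp_sub_left (memLp_conjPoissonKer hε) p)
  have hK := hf.integrable_mul (memLp_comp_sub_left (memLp_truncKer hε) p)
  simp_rw [mul_sub]
  exact (congrArg _ (integral_sub hK hQ)).trans (add_sub_cancel _ _)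

end PrincipalValue

section HilbertTransformProperties

/-- The reflection `f ↦ f(-·)` on `L²(ℝ)`. -/
noncomputable def reflection : Lp ℝ 2 (volume : Measure ℝ) →L[ℝ] Lp ℝ 2 (volume : Measure ℝ) :=
  (Lp.compMeasurePreservingₗᵢ ℝ Neg.neg
    (Measure.measurePreserving_neg volume)).toContinuousLinearMap

theorem reflection_ae_eq (f : Lp ℝ 2 (volume : Measure ℝ)) :
    reflection f =ᵐ[volume] fun p => f (-p) :=
  Lp.coeFn_compMeasurePreserving f (Measure.measurePreserving_neg volume)

theorem ae_comp_neg {P : ℝ → Prop} (h : ∀ᵐ p, P p) : ∀ᵐ p, P (-p) :=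
  (Measure.measurePreserving_neg (volume : Measure ℝ)).quasiMeasurePreserving.ae h

theorem reflection_reflection (f : Lp ℝ 2 (volume : Measure ℝ)) :
    reflection (reflection f) = f := by
  refine Lp.ext ?_
  filter_upwards [reflection_ae_eq (reflection f), ae_comp_neg (reflection_ae_eq f)] with p h hneg
  rw [h, hneg, neg_neg]

theorem inner_reflection (f g : Lp ℝ 2 (volume : Measure ℝ)) :
    inner ℝ (reflection f) g = inner ℝ f (reflection g) := by
  conv_lhs => rw [← reflection_reflection g]
  exact LinearIsometry.inner_map_map _ _ _

theorem hilbertTransform_reflection (f : Lp ℝ 2 (volume : Measure ℝ)) :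
    hilbertTransform (reflection f) = -reflection (hilbertTransform f) := by
  refine Lp.ext ?_
  filter_upwards [ae_tendsto_integral_mul_conjPoissonKer (reflection f),
    ae_comp_neg (ae_tendsto_integral_mul_conjPoissonKer f),
    Lp.coeFn_neg (reflection (hilbertTransform f)), reflection_ae_eq (hilbertTransform f)]
    with p hrefl hneg hcoe href
  rw [hcoe, Pi.neg_apply, href]
  refine tendsto_nhds_unique hrefl (hneg.neg.congr fun y => ?_)
  rw [← integral_neg_eq_self fun q => f q * conjPoissonKer y (-p - q), ← integral_neg]
  refine integral_congr_ae ((reflection_ae_eq f).mono fun q hq => ?_)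
  simp only [hq, sub_neg_eq_add, ← mul_neg, ← conjPoissonKer_neg]
  ring_nf

theorem tendsto_integral_sub_mul_conjPoissonKer {f : ℝ → ℝ} (hf : Integrable f) (p : ℝ) :
    Tendsto (fun y => ∫ q, f q * ((p - q) * conjPoissonKer y (p - q))) (𝓝[>] 0)
      (𝓝 (∫ q, f q)) := by
  refine tendsto_integral_filter_of_dominated_convergence (fun q => ‖f q‖) ?_ ?_ hf.norm ?_
  · filter_upwards [self_mem_nhdsWithin] with y hy
    have hcont := (continuous_conjPoissonKer hy).comp (continuous_sub_left p)
    exact hf.1.mul ((continuous_sub_left p).mul hcont).aestronglyMeasurable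
  · filter_upwards [self_mem_nhdsWithin] with y (hy : 0 < y)
    refine Eventually.of_forall fun q => ?_
    rw [norm_mul]
    refine mul_le_of_le_one_right (norm_nonneg _) ?_
    rw [conjPoissonKer, mul_div_assoc', ← sq, Real.norm_of_nonneg (by positivity),
      div_le_one (by positivity)]
    exact le_add_of_nonneg_right (sq_nonneg y)
  · filter_upwards [compl_mem_ae_iff.2 (measure_singleton p)] with q hq
    have hpq : p - q ≠ 0 := sub_ne_zero.2 (Ne.symm hq)
    have hcont : ContinuousAt (fun y => f q * ((p - q) * conjPoissonKer y (p - q))) 0 := by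
      unfold conjPoissonKer
      fun_prop (disch := positivity)
    have hval : (p - q) * conjPoissonKer 0 (p - q) = 1 := by
      unfold conjPoissonKer
      field_simp
      simp
    simpa only [hval, mul_one] using hcont.tendsto.mono_left nhdsWithin_le_nhds

theorem mul_hilbertTransform_sub {f g : Lp ℝ 2 (volume : Measure ℝ)} (hf : Integrable f)
    (hg : g =ᵐ[volume] fun q => q * f q) :
    ∀ᵐ p, p * hilbertTransform f p - hilbertTransform g p = ∫ q, f q := by
  filter_upwards [ae_tendsto_integral_mul_conjPoissonKer f,
    ae_tendsto_integral_mul_conjPoissonKer g] with p hfp hgp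
  refine tendsto_nhds_unique ((hfp.const_mul p).sub hgp)
    ((tendsto_integral_sub_mul_conjPoissonKer hf p).congr' ?_)
  filter_upwards [self_mem_nhdsWithin] with y hy
  have hint (h : Lp ℝ 2 (volume : Measure ℝ)) :
      Integrable fun q => h q * conjPoissonKer y (p - q) :=
    (Lp.memLp h).integrable_mul (memLp_comp_sub_left (memLp_conjPoissonKer hy) p)
  rw [← integral_const_mul, ← integral_sub ((hint f).const_mul p) (hint g)]
  refine integral_congr_ae (hg.mono fun q hq => ?_)
  simp only [hq]
  ring

theorem ae_hilbertTransform_eq_integral_of_ae_eq_zero (f : Lp ℝ 2 (volume : Measure ℝ)) :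
    ∀ᵐ p, ∀ δ > 0, (∀ᵐ q, |p - q| < δ → f q = 0) →
      hilbertTransform f p = ∫ q, f q / (p - q) := by
  filter_upwards [ae_tendsto_integral_mul_truncKer f] with p hp δ hδ hzero
  refine tendsto_nhds_unique hp (tendsto_nhds_of_eventually_eq ?_)
  filter_upwards [Ioo_mem_nhdsGT hδ] with ε hε
  refine integral_congr_ae (hzero.mono fun q hq => ?_)
  by_cases h : ε ≤ |p - q|
  · simp only [truncKer, if_pos h, div_eq_mul_inv]
  · simp only [hq ((not_le.1 h).trans hε.2), zero_mul, zero_div]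

end HilbertTransformProperties

section CarlemanForm

theorem integral_exp_neg_mul_mul_exp_neg_mul {p q : ℝ} (h : 0 < p + q) :
    ∫ t in Set.Ioi (0 : ℝ), Real.exp (-p * t) * Real.exp (-q * t) = (p + q)⁻¹ := by
  have hexp (t : ℝ) : Real.exp (-p * t) * Real.exp (-q * t) = Real.exp (-(p + q) * t) := by
    rw [← Real.exp_add]
    congr 1
    ring
  simp_rw [hexp]
  rw [integral_exp_mul_Ioi (neg_lt_zero.2 h), mul_zero, Real.exp_zero, neg_div_neg_eq, one_div]

variable {μ : Measure ℝ} {f : ℝ → ℝ} {a : ℝ}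

theorem norm_mul_exp_neg_mul_le {p t x : ℝ} (hx : p < a → x = 0) (ht : 0 ≤ t) :
    ‖x * Real.exp (-p * t)‖ ≤ ‖x‖ * Real.exp (-a * t) := by
  rcases lt_or_ge p a with hp | hp
  · simp [hx hp]
  · rw [norm_mul, Real.norm_of_nonneg (Real.exp_nonneg _)]
    gcongr

theorem integrable_prod_mul_exp_neg_mul (ha : 0 < a) (hf : Integrable f μ)
    (hsupp : ∀ᵐ p ∂μ, p < a → f p = 0) :
    Integrable (fun z : (ℝ × ℝ) × ℝ => (f z.1.1 * Real.exp (-z.1.1 * z.2)) *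
      (f z.1.2 * Real.exp (-z.1.2 * z.2))) ((μ.prod μ).prod (volume.restrict (Set.Ioi 0))) := by
  have hexp : IntegrableOn (fun t : ℝ => Real.exp (-(2 * a) * t)) (Set.Ioi 0) :=
    integrableOn_exp_mul_Ioi (by linarith) 0
  refine ((hf.norm.mul_prod hf.norm).mul_prod hexp).mono'
    ((hf.1.comp_fst.comp_fst.mul (by fun_prop)).mul
      ((hf.1.comp_snd (μ := μ)).comp_fst.mul (by fun_prop))) ?_
  filter_upwards [
    Measure.quasiMeasurePreserving_fst.ae (Measure.quasiMeasurePreserving_fst.ae hsupp),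
    Measure.quasiMeasurePreserving_fst.ae (Measure.quasiMeasurePreserving_snd.ae hsupp),
    Measure.quasiMeasurePreserving_snd.ae (ae_restrict_mem measurableSet_Ioi)] with z h₁ h₂ ht
  have ht : 0 ≤ z.2 := (Set.mem_Ioi.1 ht).le
  calc ‖f z.1.1 * Real.exp (-z.1.1 * z.2) * (f z.1.2 * Real.exp (-z.1.2 * z.2))‖
      ≤ (‖f z.1.1‖ * Real.exp (-a * z.2)) * (‖f z.1.2‖ * Real.exp (-a * z.2)) := by
        rw [norm_mul]
        exact mul_le_mul (norm_mul_exp_neg_mul_le h₁ ht) (norm_mul_exp_neg_mul_le h₂ ht)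
          (norm_nonneg _) (by positivity)
    _ = ‖f z.1.1‖ * ‖f z.1.2‖ * Real.exp (-(2 * a) * z.2) := by
        rw [mul_mul_mul_comm, ← Real.exp_add]
        ring_nf

theorem integral_integral_div_add_mul_eq [SFinite μ] (ha : 0 < a) (hf : Integrable f μ)
    (hsupp : ∀ᵐ p ∂μ, p < a → f p = 0) :
    ∫ p, (∫ q, f q / (p + q) ∂μ) * f p ∂μ =
      ∫ t in Set.Ioi 0, (∫ p, f p * Real.exp (-p * t) ∂μ) ^ 2 := by
  have hint := integrable_prod_mul_exp_neg_mul ha hf hsupp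
  have hkernel : (fun z : ℝ × ℝ => ∫ t in Set.Ioi 0, (f z.1 * Real.exp (-z.1 * t)) *
      (f z.2 * Real.exp (-z.2 * t))) =ᵐ[μ.prod μ] fun z => f z.2 / (z.1 + z.2) * f z.1 := by
    filter_upwards [Measure.quasiMeasurePreserving_fst.ae hsupp,
      Measure.quasiMeasurePreserving_snd.ae hsupp] with z h₁ h₂
    rcases lt_or_ge z.1 a with hz₁ | hz₁
    · simp [h₁ hz₁]
    rcases lt_or_ge z.2 a with hz₂ | hz₂
    · simp [h₂ hz₂]
    simp_rw [mul_mul_mul_comm]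
    rw [integral_const_mul, integral_exp_neg_mul_mul_exp_neg_mul (by linarith), div_eq_mul_inv]
    ring
  calc ∫ p, (∫ q, f q / (p + q) ∂μ) * f p ∂μ
      = ∫ z, f z.2 / (z.1 + z.2) * f z.1 ∂μ.prod μ := by
        rw [integral_prod _ (hint.integral_prod_left.congr hkernel)]
        simp_rw [integral_mul_const]
    _ = ∫ z, (∫ t in Set.Ioi 0, (f z.1 * Real.exp (-z.1 * t)) * (f z.2 * Real.exp (-z.2 * t)))
          ∂μ.prod μ := (integral_congr_ae hkernel).symm
    _ = ∫ t in Set.Ioi 0, (∫ z, (f z.1 * Real.exp (-z.1 * t)) * (f z.2 * Real.exp (-z.2 * t))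
          ∂μ.prod μ) := integral_integral_swap hint
    _ = ∫ t in Set.Ioi 0, (∫ p, f p * Real.exp (-p * t) ∂μ) ^ 2 := by
        refine integral_congr_ae (Eventually.of_forall fun t => ?_)
        exact (integral_prod_mul (fun p => f p * Real.exp (-p * t))
          fun q => f q * Real.exp (-q * t)).trans (sq _).symm

theorem inner_reflection_hilbertTransform_nonpos (ha : 0 < a) {f : Lp ℝ 2 (volume : Measure ℝ)}
    (hf : Integrable f) (hsupp : ∀ᵐ p, p < a → f p = 0) :
    inner ℝ (reflection (hilbertTransform f)) f ≤ 0 := by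
  have hvalue : inner ℝ (reflection (hilbertTransform f)) f =
      -∫ p, (∫ q, f q / (p + q)) * f p := by
    rw [L2.inner_def, ← integral_neg]
    refine integral_congr_ae ?_
    filter_upwards [reflection_ae_eq (hilbertTransform f), hsupp,
      ae_comp_neg (ae_hilbertTransform_eq_integral_of_ae_eq_zero f)] with p hrefl hp hH
    rcases lt_or_ge p a with hpa | hpa
    · simp [hp hpa]
    have hvanish : ∀ᵐ q, |-p - q| < a → f q = 0 := hsupp.mono fun q hq hpq =>
      hq (by linarith [(abs_lt.1 hpq).1])
    rw [hrefl, hH a ha hvanish, RCLike.inner_apply, conj_trivial, ← neg_mul, mul_comm,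
      ← integral_neg]
    simp_rw [← neg_add', div_neg]
  rw [hvalue, neg_nonpos, integral_integral_div_add_mul_eq ha hf hsupp]
  exact integral_nonneg fun t => sq_nonneg _

end CarlemanForm

section ExponentialOfMultiplication

open scoped Nat

variable {α : Type*} [MeasurableSpace α] {μ : Measure α} {m : α → ℝ}

theorem mulOperator_const_smul (hm : MemLp m ∞ μ) (x : ℝ) :
    mulOperator (hm.const_smul x) = x • mulOperator hm := by
  rw [mulOperator, mulOperator, MemLp.toLp_const_smul, map_smul]

theorem mulOperator_pow_ae_eq (hm : MemLp m ∞ μ) (n : ℕ) (f : Lp ℝ 2 μ) :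
    (mulOperator hm ^ n) f =ᵐ[μ] fun p => m p ^ n * f p := by
  induction n with
  | zero => simp
  | succ n ih =>
    rw [pow_succ']
    filter_upwards [ih, mulOperator_ae_eq hm ((mulOperator hm ^ n) f)] with p hp hmul
    exact hmul.trans (by rw [hp, pow_succ', mul_assoc])

theorem sum_mulOperator_pow_ae_eq (hm : MemLp m ∞ μ) (f : Lp ℝ 2 μ) (N : ℕ) :
    ⇑(∑ n ∈ Finset.range N, (n ! : ℝ)⁻¹ • (mulOperator hm ^ n) f) =ᵐ[μ]
      fun p => (∑ n ∈ Finset.range N, m p ^ n / n !) * f p := by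
  have hterm : ∀ᵐ p ∂μ, ∀ n, ((n ! : ℝ)⁻¹ • (mulOperator hm ^ n) f : Lp ℝ 2 μ) p =
      m p ^ n / n ! * f p := ae_all_iff.2 fun n => by
    filter_upwards [Lp.coeFn_smul (n ! : ℝ)⁻¹ ((mulOperator hm ^ n) f),
      mulOperator_pow_ae_eq hm n f] with p hsmul hpow
    rw [hsmul, Pi.smul_apply, hpow, smul_eq_mul]
    ring
  filter_upwards [Lp.coeFn_finsetSum (Finset.range N)
    fun n => (n ! : ℝ)⁻¹ • (mulOperator hm ^ n) f, hterm] with p hsum hp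
  rw [hsum, Finset.sum_apply, Finset.sum_mul]
  exact Finset.sum_congr rfl fun n _ => hp n

theorem exp_mulOperator_ae_eq (hm : MemLp m ∞ μ) (f : Lp ℝ 2 μ) :
    NormedSpace.exp (mulOperator hm) f =ᵐ[μ] fun p => Real.exp (m p) * f p := by
  have hexp := (ContinuousLinearMap.apply ℝ (Lp ℝ 2 μ) f).hasSum
    (NormedSpace.exp_series_hasSum_exp' (𝕂 := ℝ) (mulOperator hm))
  -- `L²`-convergence only gives convergence a.e. along a subsequence, which suffices here.
  obtain ⟨ns, hns, hlim⟩ :=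
    (tendstoInMeasure_of_tendsto_Lp hexp.tendsto_sum_nat).exists_seq_tendsto_ae
  filter_upwards [hlim, ae_all_iff.2 (sum_mulOperator_pow_ae_eq hm f)] with p hp hsum
  have hreal : HasSum (fun n : ℕ => m p ^ n / n !) (Real.exp (m p)) := by
    rw [Real.exp_eq_exp_ℝ]
    exact NormedSpace.expSeries_div_hasSum_exp (m p)
  refine tendsto_nhds_unique hp
    (((hreal.tendsto_sum_nat.comp hns.tendsto_atTop).mul_const (f p)).congr fun n => ?_)
  exact (hsum (ns n)).symm

theorem le_inner_exp_mulOperator (hm : MemLp m ∞ μ) {c : ℝ} (hc : ∀ p, c ≤ Real.exp (m p))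
    (f : Lp ℝ 2 μ) : c * ‖f‖ ^ 2 ≤ inner ℝ (NormedSpace.exp (mulOperator hm) f) f := by
  rw [← real_inner_self_eq_norm_sq, ← real_inner_smul_left, L2.inner_def, L2.inner_def]
  refine integral_mono_ae (L2.integrable_inner _ _) (L2.integrable_inner _ _) ?_
  filter_upwards [exp_mulOperator_ae_eq hm f, Lp.coeFn_smul c f] with p hexp hsmul
  simp only [hexp, hsmul, Pi.smul_apply, smul_eq_mul, RCLike.inner_apply, conj_trivial]
  nlinarith [mul_le_mul_of_nonneg_right (hc p) (mul_self_nonneg (f p))]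

end ExponentialOfMultiplication

theorem isUnit_of_coercive {V : Type*} [NormedAddCommGroup V] [InnerProductSpace ℝ V]
    [CompleteSpace V] {M : V →L[ℝ] V} {C : ℝ} (hC : 0 < C)
    (h : ∀ v, C * ‖v‖ ^ 2 ≤ inner ℝ (M v) v) : IsUnit M := by
  have hco : IsCoercive ((innerSL ℝ).comp M) :=
    ⟨C, hC, fun v => by simpa [mul_assoc, ← sq] using h v⟩
  have hM : M = hco.continuousLinearEquivOfBilin := by
    ext v
    refine ext_inner_right ℝ fun w => ?_
    simp
  rw [hM]
  exact (ContinuousLinearEquiv.toUnit hco.continuousLinearEquivOfBilin).isUnit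

section DressingPencil

variable {E : Type*} [NormedAddCommGroup E] [NormedSpace ℝ E]

/-- A family `M` of invertible operators that evolves like `M(x) = r exp(xQ) + T`, where `Q` and `T`
are symmetric for the bilinear form `B` and `QT + TQ = c B(b, ·) b`. The last two fields express
the derivative `r Q exp(xQ)` and the commutator `[Q², T]` without mentioning `r` and `T`. -/
structure IsDressingPencil (B : E →L[ℝ] E →L[ℝ] ℝ) (Q : E →L[ℝ] E) (b : E) (c : ℝ)
    (M : ℝ → E →L[ℝ] E) : Prop where
  form_symm : ∀ u v, B u v = B v u
  form_left : ∀ u v, B (Q u) v = B u (Q v)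
  form_pencil : ∀ x u v, B (M x u) v = B u (M x v)
  isUnit : ∀ x, IsUnit (M x)
  analyticAt : ∀ x, AnalyticAt ℝ M x
  hasDerivAt : ∀ x, HasDerivAt M
    ((2⁻¹ : ℝ) • (Q * M x + M x * Q) - (c / 2) • (B b).smulRight b) x
  commutator : ∀ x, Q ^ 2 * M x - M x * Q ^ 2 =
    c • ((B b).smulRight (Q b) - (B (Q b)).smulRight b)

/-- The moment `B(Qᵐ b, M(x)⁻¹ Qⁿ b)` of a pencil of operators. -/
noncomputable def pencilMoment (B : E →L[ℝ] E →L[ℝ] ℝ) (Q : E →L[ℝ] E) (b : E)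
    (M : ℝ → E →L[ℝ] E) (m n : ℕ) (x : ℝ) : ℝ :=
  B ((Q ^ m) b) (Ring.inverse (M x) ((Q ^ n) b))

section Exponential

variable {B : E →L[ℝ] E →L[ℝ] ℝ} {Q T : E →L[ℝ] E} {b : E} {c : ℝ}

theorem form_pow_apply (hQ : ∀ u v, B (Q u) v = B u (Q v)) (n : ℕ) (u v : E) :
    B ((Q ^ n) u) v = B u ((Q ^ n) v) := by
  induction n generalizing u v with
  | zero => simp
  | succ n ih =>
    rw [pow_succ, mul_apply_eq_comp, ih, hQ, ← mul_apply_eq_comp, ← pow_succ', ← pow_succ]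

theorem form_exp_apply [CompleteSpace E] (hQ : ∀ u v, B (Q u) v = B u (Q v)) (u v : E) :
    B (NormedSpace.exp Q u) v = B u (NormedSpace.exp Q v) := by
  have hexp := NormedSpace.exp_series_hasSum_exp' (𝕂 := ℝ) Q
  have hleft := ((B.flip v).comp (ContinuousLinearMap.apply ℝ E u)).hasSum hexp
  have hright := ((B u).comp (ContinuousLinearMap.apply ℝ E v)).hasSum hexp
  refine hleft.unique (hright.congr_fun fun n => ?_)
  simp only [ContinuousLinearMap.comp_apply, ContinuousLinearMap.apply_apply, map_smul,
    ContinuousLinearMap.flip_apply, form_pow_apply hQ]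

theorem isDressingPencil_exp_add [CompleteSpace E] (r : ℝ) (hB : ∀ u v, B u v = B v u)
    (hQ : ∀ u v, B (Q u) v = B u (Q v)) (hT : ∀ u v, B (T u) v = B u (T v))
    (hQT : Q * T + T * Q = c • (B b).smulRight b)
    (hunit : ∀ x : ℝ, IsUnit (r • NormedSpace.exp (x • Q) + T)) :
    IsDressingPencil B Q b c fun x => r • NormedSpace.exp (x • Q) + T where
  form_symm := hB
  form_left := hQ
  form_pencil x u v := by
    have hexp := form_exp_apply (B := B) (Q := x • Q) (fun u v => by simp [hQ]) u v
    simp [hexp, hT]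
  isUnit := hunit
  analyticAt x := by
    have hexp : AnalyticAt ℝ (NormedSpace.exp : (E →L[ℝ] E) → E →L[ℝ] E) (x • Q) :=
      NormedSpace.exp_analytic _
    have hpencil := hexp.fun_comp (f := fun x : ℝ => x • Q) (analyticAt_id.smul analyticAt_const)
    exact (hpencil.const_smul (c := r)).add analyticAt_const
  hasDerivAt x := by
    have hcomm : Q * NormedSpace.exp (x • Q) = NormedSpace.exp (x • Q) * Q :=
      ((Commute.refl Q).smul_right x).exp_right
    refine (((hasDerivAt_exp_smul_const' Q x).const_smul r).add_const T).congr_deriv ?_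
    have hhalf : (c / 2) • (B b).smulRight b = (2⁻¹ : ℝ) • (Q * T + T * Q) := by
      rw [hQT, smul_smul, div_eq_inv_mul]
    rw [hhalf, mul_add, add_mul, mul_smul_comm, smul_mul_assoc, ← hcomm]
    module
  commutator x := by
    have hcomm : Commute (Q ^ 2) (NormedSpace.exp (x • Q)) :=
      (((Commute.refl Q).pow_left 2).smul_right x).exp_right
    calc Q ^ 2 * (r • NormedSpace.exp (x • Q) + T) - (r • NormedSpace.exp (x • Q) + T) * Q ^ 2
        = Q * (Q * T + T * Q) - (Q * T + T * Q) * Q := by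
          rw [mul_add, add_mul, mul_smul_comm, smul_mul_assoc, hcomm.eq]
          noncomm_ring
      _ = c • ((B b).smulRight (Q b) - (B (Q b)).smulRight b) := by
          rw [hQT]
          ext v
          simp [hQ, smul_sub]

end Exponential

namespace IsDressingPencil

variable {B : E →L[ℝ] E →L[ℝ] ℝ} {Q : E →L[ℝ] E} {b : E} {c : ℝ} {M : ℝ → E →L[ℝ] E}

theorem apply_inverse (h : IsDressingPencil B Q b c M) (x : ℝ) (v : E) :
    M x (Ring.inverse (M x) v) = v := by
  rw [← mul_apply_eq_comp, Ring.mul_inverse_cancel _ (h.isUnit x), one_apply_eq_self]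

theorem inverse_apply (h : IsDressingPencil B Q b c M) (x : ℝ) (v : E) :
    Ring.inverse (M x) (M x v) = v := by
  rw [← mul_apply_eq_comp, Ring.inverse_mul_cancel _ (h.isUnit x), one_apply_eq_self]

theorem form_inverse (h : IsDressingPencil B Q b c M) (x : ℝ) (u v : E) :
    B (Ring.inverse (M x) u) v = B u (Ring.inverse (M x) v) := by
  conv_lhs => rw [← h.apply_inverse x v]
  rw [← h.form_pencil, h.apply_inverse]

theorem pencilMoment_symm (h : IsDressingPencil B Q b c M) (m n : ℕ) (x : ℝ) :
    pencilMoment B Q b M m n x = pencilMoment B Q b M n m x := by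
  rw [pencilMoment, h.form_symm, h.form_inverse, pencilMoment]

theorem hasDerivAt_inverse [CompleteSpace E] (h : IsDressingPencil B Q b c M) (x : ℝ) (v : E) :
    HasDerivAt (fun x => Ring.inverse (M x) v)
      (-(2⁻¹ : ℝ) • (Q (Ring.inverse (M x) v) + Ring.inverse (M x) (Q v)) +
        (c / 2 * B b (Ring.inverse (M x) v)) • Ring.inverse (M x) b) x := by
  obtain ⟨U, hU⟩ := h.isUnit x
  have hinv := hasFDerivAt_ringInverse (𝕜 := ℝ) U
  rw [hU, ← Ring.inverse_unit, hU] at hinv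
  refine ((hinv.comp_hasDerivAt x (h.hasDerivAt x)).clm_apply
    (hasDerivAt_const x v)).congr_deriv ?_
  simp only [map_zero, add_zero, neg_apply, ContinuousLinearMap.mulLeftRight_apply,
    mul_apply_eq_comp, sub_apply, smul_apply, add_apply, ContinuousLinearMap.smulRight_apply,
    h.apply_inverse, h.inverse_apply, map_sub, map_add, map_smul]
  module

theorem hasDerivAt_pencilMoment [CompleteSpace E] (h : IsDressingPencil B Q b c M) (m n : ℕ)
    (x : ℝ) :
    HasDerivAt (pencilMoment B Q b M m n)
      (-(2⁻¹ * (pencilMoment B Q b M m (n + 1) x + pencilMoment B Q b M (m + 1) n x)) +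
        c / 2 * (pencilMoment B Q b M m 0 x * pencilMoment B Q b M 0 n x)) x := by
  refine ((B ((Q ^ m) b)).hasFDerivAt.comp_hasDerivAt x
    (h.hasDerivAt_inverse x ((Q ^ n) b))).congr_deriv ?_
  simp only [pencilMoment, pow_succ', mul_apply_eq_comp, h.form_left, map_add, map_smul,
    smul_eq_mul, pow_zero, one_apply_eq_self]
  ring

theorem pencilMoment_one_two (h : IsDressingPencil B Q b c M) (x : ℝ) :
    pencilMoment B Q b M 1 2 x = pencilMoment B Q b M 0 3 x +
      c * (pencilMoment B Q b M 1 1 x * pencilMoment B Q b M 0 0 x -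
        pencilMoment B Q b M 0 1 x ^ 2) := by
  set w := Ring.inverse (M x) b with hw
  have hcomm : (Q ^ 2) b - M x ((Q ^ 2) w) = c • (B b w • Q b - B (Q b) w • b) := by
    simpa [h.apply_inverse, hw] using congrArg (fun A : E →L[ℝ] E => A w) (h.commutator x)
  have hinv : Ring.inverse (M x) ((Q ^ 2) b) = (Q ^ 2) w +
      c • (B b w • Ring.inverse (M x) (Q b) - B (Q b) w • w) := by
    rw [sub_eq_iff_eq_add.1 hcomm]
    simp only [map_add, map_smul, map_sub, h.inverse_apply, ← hw]
    abel
  have hthree : B (Q b) ((Q ^ 2) w) = pencilMoment B Q b M 0 3 x := by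
    rw [h.pencilMoment_symm, pencilMoment, ← form_pow_apply h.form_left, ← mul_apply_eq_comp,
      ← pow_succ, hw, pow_zero, one_apply_eq_self]
  have hone : B (Q b) w = pencilMoment B Q b M 0 1 x := by
    rw [h.pencilMoment_symm, pencilMoment, pow_one, pow_zero, one_apply_eq_self]
  have hzero : B b w = pencilMoment B Q b M 0 0 x := by
    rw [pencilMoment, pow_zero, one_apply_eq_self]
  have heleven : B (Q b) (Ring.inverse (M x) (Q b)) = pencilMoment B Q b M 1 1 x := by
    rw [pencilMoment, pow_one]
  rw [pencilMoment, pow_one, hinv]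
  simp only [map_add, map_smul, map_sub, smul_eq_mul, hthree, hone, hzero, heleven]
  ring

theorem pencilMoment_zero_zero_neg (h : IsDressingPencil B Q b c M) {J : E →L[ℝ] E}
    (hJB : ∀ u v, B (J u) (J v) = -B u v) (hJb : J b = -b)
    (hJM : ∀ x v, J (M x v) = M (-x) (J v)) (x : ℝ) :
    pencilMoment B Q b M 0 0 (-x) = -pencilMoment B Q b M 0 0 x := by
  have hinv : Ring.inverse (M (-x)) b = -J (Ring.inverse (M x) b) := by
    rw [← neg_eq_iff_eq_neg, ← map_neg, ← hJb]
    conv_lhs => rw [← h.apply_inverse x b, hJM, h.inverse_apply]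
  simp only [pencilMoment, pow_zero, one_apply_eq_self]
  rw [hinv, ← hJB, hJb]
  simp

theorem analyticAt_pencilMoment [CompleteSpace E] (h : IsDressingPencil B Q b c M) (m n : ℕ)
    (x : ℝ) : AnalyticAt ℝ (pencilMoment B Q b M m n) x := by
  obtain ⟨U, hU⟩ := h.isUnit x
  have hinv : AnalyticAt ℝ (fun x => Ring.inverse (M x)) x :=
    (hU ▸ analyticAt_inverse (𝕜 := ℝ) U).fun_comp (h.analyticAt x)
  have happly := ((B ((Q ^ m) b)).comp (ContinuousLinearMap.apply ℝ E ((Q ^ n) b))).analyticAt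
    (Ring.inverse (M x))
  exact happly.comp (f := fun x => Ring.inverse (M x)) hinv

end IsDressingPencil

theorem analyticAt_even_isBigO {u : ℝ → ℝ} (hu : AnalyticAt ℝ u 0) (heven : ∀ x, u (-x) = u x) :
    (fun x => u x - (u 0 + deriv (deriv u) 0 / 2 * x ^ 2)) =O[𝓝 0] fun x => x ^ 4 := by
  have hodd (n : ℕ) (hn : Odd n) : iteratedDeriv n u 0 = 0 := by
    have hneg := iteratedDeriv_comp_neg n u 0
    rw [funext heven, hn.neg_one_pow, neg_zero, smul_eq_mul] at hneg
    linarith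
  have htaylor := (hu.hasFPowerSeriesAt.isBigO_sub_partialSum_pow 4).congr_right
    (g₂ := fun x => x ^ 4) fun x => (by simp [Even.pow_abs ⟨2, rfl⟩])
  refine htaylor.congr_left fun x => ?_
  simp [FormalMultilinearSeries.partialSum, Finset.sum_range_succ, hodd 3 ⟨1, rfl⟩,
    hodd 1 odd_one, iteratedDeriv_succ, FormalMultilinearSeries.ofScalars, mul_comm]

namespace IsDressingPencil

variable [CompleteSpace E] {B : E →L[ℝ] E →L[ℝ] ℝ} {Q : E →L[ℝ] E} {b : E} {c : ℝ}
  {M : ℝ → E →L[ℝ] E}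

theorem deriv_pencilMoment_zero_zero (h : IsDressingPencil B Q b c M) :
    deriv (pencilMoment B Q b M 0 0) = fun x =>
      -pencilMoment B Q b M 0 1 x + c / 2 * pencilMoment B Q b M 0 0 x ^ 2 := by
  funext x
  rw [(h.hasDerivAt_pencilMoment 0 0 x).deriv, h.pencilMoment_symm 1 0]
  ring

theorem deriv_deriv_pencilMoment_zero_zero (h : IsDressingPencil B Q b c M) :
    deriv (deriv (pencilMoment B Q b M 0 0)) = fun x =>
      2⁻¹ * (pencilMoment B Q b M 0 2 x + pencilMoment B Q b M 1 1 x) +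
        c * pencilMoment B Q b M 0 0 x *
          (c / 2 * pencilMoment B Q b M 0 0 x ^ 2 - 3 / 2 * pencilMoment B Q b M 0 1 x) := by
  funext x
  rw [h.deriv_pencilMoment_zero_zero]
  refine ((h.hasDerivAt_pencilMoment 0 1 x).neg.add
    (((h.hasDerivAt_pencilMoment 0 0 x).pow 2).const_mul (c / 2))).deriv.trans ?_
  simp only [h.pencilMoment_symm 1 0, zero_add, Nat.reduceAdd, Nat.cast_ofNat, Nat.add_one_sub_one,
    pow_one]
  ring

theorem deriv_deriv_deriv_pencilMoment_zero (h : IsDressingPencil B Q b c M)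
    (h₀ : pencilMoment B Q b M 0 0 0 = 0) :
    deriv (deriv (deriv (pencilMoment B Q b M 0 0))) 0 =
      -pencilMoment B Q b M 0 3 0 + 5 / 2 * c * pencilMoment B Q b M 0 1 0 ^ 2 := by
  rw [h.deriv_deriv_pencilMoment_zero_zero]
  have h00 := h.hasDerivAt_pencilMoment 0 0 0
  refine ((((h.hasDerivAt_pencilMoment 0 2 0).add (h.hasDerivAt_pencilMoment 1 1 0)).const_mul
    2⁻¹).add ((h00.const_mul c).mul (((h00.pow 2).const_mul (c / 2)).sub
      ((h.hasDerivAt_pencilMoment 0 1 0).const_mul (3 / 2))))).deriv.trans ?_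
  simp only [h.pencilMoment_symm 1 0, h.pencilMoment_symm 2 1, zero_add, Nat.reduceAdd,
    h.pencilMoment_one_two 0, h₀, Pi.sub_apply, Pi.pow_apply]
  ring

theorem isBigO_deriv_pencilMoment (h : IsDressingPencil B Q b c M)
    (hodd : ∀ x, pencilMoment B Q b M 0 0 (-x) = -pencilMoment B Q b M 0 0 x) :
    (fun x => deriv (pencilMoment B Q b M 0 0) x - (-pencilMoment B Q b M 0 1 0 +
      (-pencilMoment B Q b M 0 3 0 + 5 / 2 * c * pencilMoment B Q b M 0 1 0 ^ 2) / 2 * x ^ 2))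
      =O[𝓝 0] fun x => x ^ 4 := by
  have h₀ : pencilMoment B Q b M 0 0 0 = 0 := by
    have := hodd 0
    rw [neg_zero] at this
    linarith
  have heven (x : ℝ) :
      deriv (pencilMoment B Q b M 0 0) (-x) = deriv (pencilMoment B Q b M 0 0) x := by
    have hneg := deriv_comp_neg (pencilMoment B Q b M 0 0) x
    rw [funext hodd, deriv.fun_neg, neg_inj] at hneg
    exact hneg.symm
  have htaylor := analyticAt_even_isBigO (h.analyticAt_pencilMoment 0 0 0).deriv heven
  rw [h.deriv_deriv_deriv_pencilMoment_zero h₀] at htaylor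
  refine htaylor.congr_left fun x => ?_
  simp only [h.deriv_pencilMoment_zero_zero, h₀]
  ring

end IsDressingPencil

end DressingPencil

theorem mulOperator_comm {α : Type*} [MeasurableSpace α] {μ : Measure α} {m m' : α → ℝ}
    (hm : MemLp m ∞ μ) (hm' : MemLp m' ∞ μ) (f : Lp ℝ 2 μ) :
    mulOperator hm (mulOperator hm' f) = mulOperator hm' (mulOperator hm f) := by
  refine Lp.ext ?_
  filter_upwards [mulOperator_ae_eq hm (mulOperator hm' f), mulOperator_ae_eq hm' f,
    mulOperator_ae_eq hm' (mulOperator hm f), mulOperator_ae_eq hm f] with p h₁ h₂ h₃ h₄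
  rw [h₁, h₂, h₃, h₄]
  ring

theorem reflection_mulOperator {m m' : ℝ → ℝ} (hm : MemLp m ∞ volume) (hm' : MemLp m' ∞ volume)
    (hmm' : ∀ p, m (-p) = m' p) (f : Lp ℝ 2 (volume : Measure ℝ)) :
    reflection (mulOperator hm f) = mulOperator hm' (reflection f) := by
  refine Lp.ext ?_
  filter_upwards [reflection_ae_eq (mulOperator hm f), ae_comp_neg (mulOperator_ae_eq hm f),
    mulOperator_ae_eq hm' (reflection f), reflection_ae_eq f] with p h₁ h₂ h₃ h₄
  rw [h₁, h₂, h₃, h₄, hmm']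

theorem inner_reflection_hilbertTransform (f g : Lp ℝ 2 (volume : Measure ℝ)) :
    inner ℝ (reflection (hilbertTransform f)) g = inner ℝ f (reflection (hilbertTransform g)) := by
  rw [inner_reflection, inner_hilbertTransform, hilbertTransform_reflection, inner_neg_right,
    neg_neg]

theorem inner_reflection_hilbertTransform_add_sub (f g : Lp ℝ 2 (volume : Measure ℝ)) :
    inner ℝ (reflection (hilbertTransform (f + reflection g))) (f - reflection g) =
      inner ℝ (reflection (hilbertTransform f)) f +
        inner ℝ (reflection (hilbertTransform g)) g := by
  have hcross : inner ℝ (hilbertTransform g) f = -inner ℝ (reflection (hilbertTransform f))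
      (reflection g) := by
    rw [inner_hilbertTransform, inner_reflection, reflection_reflection, real_inner_comm]
  have hreflect : inner ℝ (hilbertTransform g) (reflection g) =
      inner ℝ (reflection (hilbertTransform g)) g := (inner_reflection _ _).symm
  rw [map_add, hilbertTransform_reflection, map_add, map_neg, reflection_reflection,
    inner_add_left, inner_sub_right, inner_neg_left, inner_sub_right, hcross, hreflect]
  ring

section Bands

/-- The two bands `[-k₂, -k₁] ∪ [k₁, k₂]`. A pair `(f, g)` of densities on `[k₁, k₂]` is encoded as
the function on the bands equal to `g(q)` at `q` and to `f(q)` at `-q`. -/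
def bands (k₁ k₂ : ℝ) : Set ℝ := {p | |p| ∈ Set.Icc k₁ k₂}

/-- The sign function cut off to the bands. -/
noncomputable def bandSign (k₁ k₂ : ℝ) : ℝ → ℝ := (bands k₁ k₂).indicator Real.sign

/-- The exponent of `e^{-2px}` as a function of `p`, cut off to the bands. -/
noncomputable def bandExponent (k₁ k₂ : ℝ) : ℝ → ℝ := (bands k₁ k₂).indicator fun p => -2 * p

variable {k₁ k₂ : ℝ}

theorem measurableSet_bands : MeasurableSet (bands k₁ k₂) :=
  measurableSet_Icc.preimage continuous_abs.measurable

theorem neg_mem_bands {p : ℝ} : -p ∈ bands k₁ k₂ ↔ p ∈ bands k₁ k₂ := by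
  simp only [bands, Set.mem_ofPred_eq, abs_neg]

theorem measure_bands_lt_top : volume (bands k₁ k₂) < ∞ :=
  (measure_mono fun _ hp => abs_le.1 hp.2).trans_lt (measure_Icc_lt_top (a := -k₂) (b := k₂))

theorem memLp_bandSign (r : ℝ≥0∞) : MemLp (bandSign k₁ k₂) r volume := by
  have hmeas : Measurable Real.sign := Measurable.ite measurableSet_Iio measurable_const
    (Measurable.ite measurableSet_Ioi measurable_const measurable_const)
  have : IsFiniteMeasure (volume.restrict (bands k₁ k₂)) :=
    isFiniteMeasure_restrict.2 measure_bands_lt_top.ne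
  rw [bandSign, memLp_indicator_iff_restrict measurableSet_bands]
  refine MemLp.of_bound hmeas.aestronglyMeasurable 1 (Eventually.of_forall fun p => ?_)
  rcases Real.sign_apply_eq p with h | h | h <;> simp [h]

theorem abs_bandExponent_le (p : ℝ) : |bandExponent k₁ k₂ p| ≤ 2 * |k₂| := by
  by_cases hp : p ∈ bands k₁ k₂
  · rw [bandExponent, Set.indicator_of_mem hp, abs_mul, abs_neg, abs_two]
    exact mul_le_mul_of_nonneg_left (hp.2.trans (le_abs_self k₂)) zero_le_two
  · simp [bandExponent, hp]

theorem memLp_bandExponent : MemLp (bandExponent k₁ k₂) ∞ volume :=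
  memLp_top_of_bound
    ((measurable_const.mul measurable_id).indicator measurableSet_bands).aestronglyMeasurable
    (2 * |k₂|) (Eventually.of_forall abs_bandExponent_le)

theorem bandSign_neg (p : ℝ) : bandSign k₁ k₂ (-p) = -bandSign k₁ k₂ p := by
  by_cases hp : p ∈ bands k₁ k₂
  · simp [bandSign, hp, neg_mem_bands, Real.sign_neg]
  · simp [bandSign, hp, neg_mem_bands]

theorem bandExponent_neg (p : ℝ) : bandExponent k₁ k₂ (-p) = -bandExponent k₁ k₂ p := by
  by_cases hp : p ∈ bands k₁ k₂ <;> simp [bandExponent, hp, neg_mem_bands]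

theorem bandSign_of_mem (hk₁ : 0 < k₁) {p : ℝ} (hp : p ∈ Set.Icc k₁ k₂) : bandSign k₁ k₂ p = 1 := by
  have hpos : 0 < p := hk₁.trans_le hp.1
  have hmem : p ∈ bands k₁ k₂ := by rwa [bands, Set.mem_ofPred_eq, abs_of_pos hpos]
  rw [bandSign, Set.indicator_of_mem hmem, Real.sign_of_pos hpos]

theorem bandExponent_mul_bandSign (p : ℝ) :
    bandExponent k₁ k₂ p * bandSign k₁ k₂ p = -2 * p * bandSign k₁ k₂ p := by
  by_cases hp : p ∈ bands k₁ k₂ <;> simp [bandExponent, bandSign, hp]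

theorem bandSign_sq_add_self_of_lt {p : ℝ} (hp : p < k₁) :
    bandSign k₁ k₂ p * bandSign k₁ k₂ p + bandSign k₁ k₂ p = 0 := by
  by_cases hmem : p ∈ bands k₁ k₂
  · have hneg : p < 0 := by
      by_contra! hpos
      exact absurd (abs_of_nonneg hpos ▸ hmem.1) (not_le.2 hp)
    simp [bandSign, hmem, Real.sign_of_neg hneg]
  · simp [bandSign, hmem]

variable (k₁ k₂) in
/-- Multiplication by the sign function of the bands. -/
noncomputable def bandSignOperator :
    Lp ℝ 2 (volume : Measure ℝ) →L[ℝ] Lp ℝ 2 (volume : Measure ℝ) :=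
  mulOperator (memLp_bandSign (k₁ := k₁) (k₂ := k₂) ∞)

variable (k₁ k₂) in
/-- Multiplication by `-2p` on the bands, the generator of the factor `e^{-2px}`. -/
noncomputable def bandExponentOperator :
    Lp ℝ 2 (volume : Measure ℝ) →L[ℝ] Lp ℝ 2 (volume : Measure ℝ) :=
  mulOperator (memLp_bandExponent (k₁ := k₁) (k₂ := k₂))

variable (k₁ k₂) in
/-- The integral operator of the dressing equations. The square of `bandSignOperator` restricts to
the bands. -/
noncomputable def bandKernelOperator :
    Lp ℝ 2 (volume : Measure ℝ) →L[ℝ] Lp ℝ 2 (volume : Measure ℝ) :=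
  -Real.pi⁻¹ • (bandSignOperator k₁ k₂ * reflection * hilbertTransform *
    bandSignOperator k₁ k₂ * bandSignOperator k₁ k₂)

variable (k₁ k₂) in
/-- The operator of the dressing equations at `x`, divided by `R e^{-2px}` on each band; off the
bands it is the multiplication by `R⁻¹`. -/
noncomputable def bandPencil (R x : ℝ) :
    Lp ℝ 2 (volume : Measure ℝ) →L[ℝ] Lp ℝ 2 (volume : Measure ℝ) :=
  R⁻¹ • NormedSpace.exp (x • bandExponentOperator k₁ k₂) + bandKernelOperator k₁ k₂

variable (k₁ k₂) in
/-- The sign function of the bands as a vector, the right-hand side of the dressing equations up to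
its sign. -/
noncomputable def bandSignVector : Lp ℝ 2 (volume : Measure ℝ) :=
  (memLp_bandSign (k₁ := k₁) (k₂ := k₂) 2).toLp

variable (k₁ k₂) in
/-- The indefinite form `∫ sgn(p) u(p) v(p) dp` over the bands. -/
noncomputable def bandForm :
    Lp ℝ 2 (volume : Measure ℝ) →L[ℝ] Lp ℝ 2 (volume : Measure ℝ) →L[ℝ] ℝ :=
  (innerSL ℝ).comp (bandSignOperator k₁ k₂)

theorem bandForm_apply (u v : Lp ℝ 2 (volume : Measure ℝ)) :
    bandForm k₁ k₂ u v = inner ℝ (bandSignOperator k₁ k₂ u) v := rfl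

theorem bandKernelOperator_apply (f : Lp ℝ 2 (volume : Measure ℝ)) :
    bandKernelOperator k₁ k₂ f = -Real.pi⁻¹ • bandSignOperator k₁ k₂ (reflection (hilbertTransform
      (bandSignOperator k₁ k₂ (bandSignOperator k₁ k₂ f)))) := rfl

theorem bandSignOperator_ae_eq (f : Lp ℝ 2 (volume : Measure ℝ)) :
    bandSignOperator k₁ k₂ f =ᵐ[volume] fun p => bandSign k₁ k₂ p * f p :=
  mulOperator_ae_eq _ f

theorem bandExponentOperator_ae_eq (f : Lp ℝ 2 (volume : Measure ℝ)) :
    bandExponentOperator k₁ k₂ f =ᵐ[volume] fun p => bandExponent k₁ k₂ p * f p :=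
  mulOperator_ae_eq _ f

theorem exp_bandExponentOperator_ae_eq (x : ℝ) (f : Lp ℝ 2 (volume : Measure ℝ)) :
    NormedSpace.exp (x • bandExponentOperator k₁ k₂) f =ᵐ[volume]
      fun p => Real.exp (x * bandExponent k₁ k₂ p) * f p := by
  rw [bandExponentOperator, ← mulOperator_const_smul]
  exact exp_mulOperator_ae_eq _ f

theorem inner_bandSignOperator (f g : Lp ℝ 2 (volume : Measure ℝ)) :
    inner ℝ (bandSignOperator k₁ k₂ f) g = inner ℝ f (bandSignOperator k₁ k₂ g) :=
  inner_mulOperator _ _ (fun _ => rfl) f g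

theorem reflection_bandSignOperator (f : Lp ℝ 2 (volume : Measure ℝ)) :
    reflection (bandSignOperator k₁ k₂ f) = -bandSignOperator k₁ k₂ (reflection f) := by
  rw [bandSignOperator, reflection_mulOperator _ (memLp_bandSign ∞).neg bandSign_neg,
    mulOperator_neg, neg_apply]

theorem integrable_bandSignOperator (f : Lp ℝ 2 (volume : Measure ℝ)) :
    Integrable (bandSignOperator k₁ k₂ f) :=
  ((memLp_bandSign 2).integrable_mul (Lp.memLp f)).congr (bandSignOperator_ae_eq f).symm

theorem reflection_bandSignVector :
    reflection (bandSignVector k₁ k₂) = -bandSignVector k₁ k₂ := by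
  refine Lp.ext ?_
  have hcoe := (memLp_bandSign (k₁ := k₁) (k₂ := k₂) 2).coeFn_toLp
  filter_upwards [reflection_ae_eq (bandSignVector k₁ k₂), Lp.coeFn_neg (bandSignVector k₁ k₂),
    hcoe, ae_comp_neg hcoe] with p hrefl hneg hp hnp
  rw [hrefl, hneg, Pi.neg_apply, bandSignVector, hp, hnp, bandSign_neg]

theorem bandForm_symm (u v : Lp ℝ 2 (volume : Measure ℝ)) :
    bandForm k₁ k₂ u v = bandForm k₁ k₂ v u := by
  rw [bandForm_apply, bandForm_apply, inner_bandSignOperator, real_inner_comm]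

theorem bandForm_bandExponentOperator (u v : Lp ℝ 2 (volume : Measure ℝ)) :
    bandForm k₁ k₂ (bandExponentOperator k₁ k₂ u) v =
      bandForm k₁ k₂ u (bandExponentOperator k₁ k₂ v) := by
  rw [bandForm_apply, bandForm_apply, bandSignOperator, bandExponentOperator, mulOperator_comm,
    inner_mulOperator memLp_bandExponent memLp_bandExponent fun _ => rfl]

theorem bandForm_bandKernelOperator (u v : Lp ℝ 2 (volume : Measure ℝ)) :
    bandForm k₁ k₂ (bandKernelOperator k₁ k₂ u) v =
      bandForm k₁ k₂ u (bandKernelOperator k₁ k₂ v) := by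
  simp only [bandForm_apply, bandKernelOperator_apply, map_smul, smul_apply,
    inner_bandSignOperator, inner_reflection_hilbertTransform]

theorem bandForm_reflection (u v : Lp ℝ 2 (volume : Measure ℝ)) :
    bandForm k₁ k₂ (reflection u) (reflection v) = -bandForm k₁ k₂ u v := by
  rw [bandForm_apply, bandForm_apply, ← inner_reflection, reflection_bandSignOperator,
    reflection_reflection, inner_neg_left]

theorem bandForm_bandSignVector (f : Lp ℝ 2 (volume : Measure ℝ)) :
    bandForm k₁ k₂ (bandSignVector k₁ k₂) f =
      ∫ p, bandSignOperator k₁ k₂ (bandSignOperator k₁ k₂ f) p := by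
  rw [bandForm_apply, inner_bandSignOperator, L2.inner_def]
  refine integral_congr_ae ?_
  filter_upwards [(memLp_bandSign (k₁ := k₁) (k₂ := k₂) 2).coeFn_toLp,
    bandSignOperator_ae_eq (k₁ := k₁) (k₂ := k₂) (bandSignOperator k₁ k₂ f)] with p hvec hop
  rw [hop, bandSignVector, hvec, RCLike.inner_apply, conj_trivial, mul_comm]

theorem bandKernelOperator_ae_eq (f : Lp ℝ 2 (volume : Measure ℝ)) :
    bandKernelOperator k₁ k₂ f =ᵐ[volume] fun p => -Real.pi⁻¹ * (bandSign k₁ k₂ p *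
      hilbertTransform (bandSignOperator k₁ k₂ (bandSignOperator k₁ k₂ f)) (-p)) := by
  set g := hilbertTransform (bandSignOperator k₁ k₂ (bandSignOperator k₁ k₂ f)) with hg
  rw [bandKernelOperator_apply, ← hg]
  filter_upwards [Lp.coeFn_smul (-Real.pi⁻¹) (bandSignOperator k₁ k₂ (reflection g)),
    bandSignOperator_ae_eq (k₁ := k₁) (k₂ := k₂) (reflection g), reflection_ae_eq g]
    with p hsmul hop hrefl
  rw [hsmul, Pi.smul_apply, hop, hrefl, smul_eq_mul]

theorem bandSignOperator_bandSignOperator_bandExponentOperator_ae_eq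
    (f : Lp ℝ 2 (volume : Measure ℝ)) :
    bandSignOperator k₁ k₂ (bandSignOperator k₁ k₂ (bandExponentOperator k₁ k₂ f)) =ᵐ[volume]
      fun q => q * ((-2 : ℝ) • bandSignOperator k₁ k₂ (bandSignOperator k₁ k₂ f)) q := by
  filter_upwards [bandSignOperator_ae_eq (k₁ := k₁) (k₂ := k₂)
      (bandSignOperator k₁ k₂ (bandExponentOperator k₁ k₂ f)),
    bandSignOperator_ae_eq (k₁ := k₁) (k₂ := k₂) (bandExponentOperator k₁ k₂ f),
    bandExponentOperator_ae_eq (k₁ := k₁) (k₂ := k₂) f,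
    bandSignOperator_ae_eq (k₁ := k₁) (k₂ := k₂) (bandSignOperator k₁ k₂ f),
    bandSignOperator_ae_eq (k₁ := k₁) (k₂ := k₂) f,
    Lp.coeFn_smul (-2 : ℝ) (bandSignOperator k₁ k₂ (bandSignOperator k₁ k₂ f))]
    with q h₁ h₂ h₃ h₄ h₅ hsmul
  rw [h₁, h₂, h₃, hsmul, Pi.smul_apply, h₄, h₅, smul_eq_mul]
  linear_combination bandSign k₁ k₂ q * f q * bandExponent_mul_bandSign q

theorem hilbertTransform_bandExponentOperator_ae_eq (f : Lp ℝ 2 (volume : Measure ℝ)) :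
    hilbertTransform (bandSignOperator k₁ k₂ (bandSignOperator k₁ k₂
      (bandExponentOperator k₁ k₂ f))) =ᵐ[volume] fun p =>
        -2 * p * hilbertTransform (bandSignOperator k₁ k₂ (bandSignOperator k₁ k₂ f)) p +
          2 * bandForm k₁ k₂ (bandSignVector k₁ k₂) f := by
  rw [bandForm_bandSignVector]
  set k := bandSignOperator k₁ k₂ (bandSignOperator k₁ k₂ f)
  have hint : Integrable ⇑((-2 : ℝ) • k) :=
    ((integrable_bandSignOperator _).smul (-2 : ℝ)).congr (Lp.coeFn_smul _ _).symm
  have hvalue : ∫ q, ((-2 : ℝ) • k) q = -2 * ∫ q, k q := by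
    rw [integral_congr_ae (Lp.coeFn_smul _ _), ← integral_const_mul]
    rfl
  have hcommutator := mul_hilbertTransform_sub hint
    (bandSignOperator_bandSignOperator_bandExponentOperator_ae_eq f)
  rw [hvalue, map_smul] at hcommutator
  filter_upwards [hcommutator, Lp.coeFn_smul (-2 : ℝ) (hilbertTransform k)] with p hcomm hsmul
  rw [hsmul, Pi.smul_apply, smul_eq_mul] at hcomm
  linear_combination -hcomm

theorem bandExponentOperator_mul_bandKernelOperator_add :
    bandExponentOperator k₁ k₂ * bandKernelOperator k₁ k₂ +
      bandKernelOperator k₁ k₂ * bandExponentOperator k₁ k₂ =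
      (-2 / Real.pi) •
        (bandForm k₁ k₂ (bandSignVector k₁ k₂)).smulRight (bandSignVector k₁ k₂) := by
  refine ContinuousLinearMap.ext fun f => Lp.ext ?_
  filter_upwards [ae_comp_neg (hilbertTransform_bandExponentOperator_ae_eq (k₁ := k₁) (k₂ := k₂) f),
    Lp.coeFn_add (bandExponentOperator k₁ k₂ (bandKernelOperator k₁ k₂ f))
      (bandKernelOperator k₁ k₂ (bandExponentOperator k₁ k₂ f)),
    bandExponentOperator_ae_eq (k₁ := k₁) (k₂ := k₂) (bandKernelOperator k₁ k₂ f),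
    bandKernelOperator_ae_eq (k₁ := k₁) (k₂ := k₂) f,
    bandKernelOperator_ae_eq (k₁ := k₁) (k₂ := k₂) (bandExponentOperator k₁ k₂ f),
    Lp.coeFn_smul (-2 / Real.pi * bandForm k₁ k₂ (bandSignVector k₁ k₂) f) (bandSignVector k₁ k₂),
    (memLp_bandSign (k₁ := k₁) (k₂ := k₂) 2).coeFn_toLp]
    with p hcomm hadd hQ hT hTQ hvec hsign
  simp only [add_apply, mul_apply_eq_comp, smul_apply, ContinuousLinearMap.smulRight_apply,
    smul_smul]
  rw [hadd, Pi.add_apply, hQ, hT, hTQ, hcomm, hvec, Pi.smul_apply]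
  rw [← bandSignVector] at hsign
  rw [hsign, smul_eq_mul]
  linear_combination -Real.pi⁻¹ *
    hilbertTransform (bandSignOperator k₁ k₂ (bandSignOperator k₁ k₂ f)) (-p) *
      bandExponent_mul_bandSign (k₁ := k₁) (k₂ := k₂) p

theorem reflection_bandKernelOperator (f : Lp ℝ 2 (volume : Measure ℝ)) :
    reflection (bandKernelOperator k₁ k₂ f) = bandKernelOperator k₁ k₂ (reflection f) := by
  have hanti (g : Lp ℝ 2 (volume : Measure ℝ)) :
      reflection (hilbertTransform g) = -hilbertTransform (reflection g) := by
    rw [hilbertTransform_reflection, neg_neg]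
  simp only [bandKernelOperator_apply, map_smul, reflection_bandSignOperator, map_neg, neg_neg,
    hanti, reflection_reflection]

theorem reflection_bandPencil (R x : ℝ) (f : Lp ℝ 2 (volume : Measure ℝ)) :
    reflection (bandPencil k₁ k₂ R x f) = bandPencil k₁ k₂ R (-x) (reflection f) := by
  have hexp : reflection (NormedSpace.exp (x • bandExponentOperator k₁ k₂) f) =
      NormedSpace.exp (-x • bandExponentOperator k₁ k₂) (reflection f) := by
    refine Lp.ext ?_
    have hx := exp_bandExponentOperator_ae_eq (k₁ := k₁) (k₂ := k₂) x f
    filter_upwards [reflection_ae_eq (NormedSpace.exp (x • bandExponentOperator k₁ k₂) f),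
      ae_comp_neg hx, exp_bandExponentOperator_ae_eq (k₁ := k₁) (k₂ := k₂) (-x) (reflection f),
      reflection_ae_eq f] with p h₁ h₂ h₃ h₄
    rw [h₁, h₂, h₃, h₄, bandExponent_neg, mul_neg, neg_mul]
  simp only [bandPencil, add_apply, smul_apply, map_add, map_smul, hexp,
    reflection_bandKernelOperator]

variable (k₁ k₂) in
/-- The restriction to the band `[k₁, k₂]`, as half the sum of `bandSignOperator` and its square. -/
noncomputable def upperBandRestriction (f : Lp ℝ 2 (volume : Measure ℝ)) :
    Lp ℝ 2 (volume : Measure ℝ) :=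
  (2⁻¹ : ℝ) • (bandSignOperator k₁ k₂ (bandSignOperator k₁ k₂ f) + bandSignOperator k₁ k₂ f)

theorem integrable_upperBandRestriction (f : Lp ℝ 2 (volume : Measure ℝ)) :
    Integrable (upperBandRestriction k₁ k₂ f) := by
  rw [upperBandRestriction, ← map_add, ← map_smul]
  exact integrable_bandSignOperator _

theorem upperBandRestriction_ae_eq_zero (f : Lp ℝ 2 (volume : Measure ℝ)) :
    ∀ᵐ p, p < k₁ → upperBandRestriction k₁ k₂ f p = 0 := by
  filter_upwards [
    Lp.coeFn_smul (2⁻¹ : ℝ) (bandSignOperator k₁ k₂ (bandSignOperator k₁ k₂ f) +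
      bandSignOperator k₁ k₂ f),
    Lp.coeFn_add (bandSignOperator k₁ k₂ (bandSignOperator k₁ k₂ f)) (bandSignOperator k₁ k₂ f),
    bandSignOperator_ae_eq (k₁ := k₁) (k₂ := k₂) (bandSignOperator k₁ k₂ f),
    bandSignOperator_ae_eq (k₁ := k₁) (k₂ := k₂) f] with p hsmul hadd h₁ h₂ hp
  rw [upperBandRestriction, hsmul, Pi.smul_apply, hadd, Pi.add_apply, h₁, h₂, ← mul_assoc,
    ← add_mul, bandSign_sq_add_self_of_lt hp, zero_mul, smul_zero]

theorem inner_bandKernelOperator_nonneg (hk₁ : 0 < k₁) (f : Lp ℝ 2 (volume : Measure ℝ)) :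
    0 ≤ inner ℝ (bandKernelOperator k₁ k₂ f) f := by
  have hrefl : reflection (upperBandRestriction k₁ k₂ (reflection f)) =
      (2⁻¹ : ℝ) • (bandSignOperator k₁ k₂ (bandSignOperator k₁ k₂ f) -
        bandSignOperator k₁ k₂ f) := by
    simp only [upperBandRestriction, map_smul, map_add, reflection_bandSignOperator, map_neg,
      neg_neg, reflection_reflection, ← sub_eq_add_neg]
  have hadd : bandSignOperator k₁ k₂ (bandSignOperator k₁ k₂ f) = upperBandRestriction k₁ k₂ f +
      reflection (upperBandRestriction k₁ k₂ (reflection f)) := by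
    rw [hrefl, upperBandRestriction]
    module
  have hsub : bandSignOperator k₁ k₂ f = upperBandRestriction k₁ k₂ f -
      reflection (upperBandRestriction k₁ k₂ (reflection f)) := by
    rw [hrefl, upperBandRestriction]
    module
  have hnonpos (g : Lp ℝ 2 (volume : Measure ℝ)) := inner_reflection_hilbertTransform_nonpos hk₁
    (integrable_upperBandRestriction (k₂ := k₂) g) (upperBandRestriction_ae_eq_zero g)
  rw [bandKernelOperator_apply, real_inner_smul_left, inner_bandSignOperator, hadd,
    hsub, inner_reflection_hilbertTransform_add_sub]
  exact mul_nonneg_of_nonpos_of_nonpos (neg_nonpos.2 (by positivity))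
    (add_nonpos (hnonpos f) (hnonpos (reflection f)))

theorem isUnit_bandPencil (hk₁ : 0 < k₁) {R : ℝ} (hR : 0 < R) (x : ℝ) :
    IsUnit (bandPencil k₁ k₂ R x) := by
  have hbound (p : ℝ) : Real.exp (-(|x| * (2 * |k₂|))) ≤ Real.exp ((x • bandExponent k₁ k₂) p) := by
    refine Real.exp_le_exp.2 (neg_le_of_abs_le ?_)
    rw [Pi.smul_apply, smul_eq_mul, abs_mul]
    exact mul_le_mul_of_nonneg_left (abs_bandExponent_le p) (abs_nonneg x)
  refine isUnit_of_coercive (C := R⁻¹ * Real.exp (-(|x| * (2 * |k₂|)))) (by positivity) fun f => ?_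
  rw [bandPencil, bandExponentOperator, ← mulOperator_const_smul, add_apply, smul_apply,
    inner_add_left, real_inner_smul_left, mul_assoc]
  exact le_add_of_le_of_nonneg (mul_le_mul_of_nonneg_left
    (le_inner_exp_mulOperator _ hbound f) (inv_nonneg.2 hR.le))
    (inner_bandKernelOperator_nonneg hk₁ f)

theorem isDressingPencil_bandPencil (hk₁ : 0 < k₁) {R : ℝ} (hR : 0 < R) :
    IsDressingPencil (bandForm k₁ k₂) (bandExponentOperator k₁ k₂) (bandSignVector k₁ k₂)
      (-2 / Real.pi) (bandPencil k₁ k₂ R) :=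
  isDressingPencil_exp_add R⁻¹ bandForm_symm bandForm_bandExponentOperator
    bandForm_bandKernelOperator bandExponentOperator_mul_bandKernelOperator_add
    (isUnit_bandPencil hk₁ hR)

end Bands

section JacobiWeight

variable {a b γ : ℝ}

/-- The Jacobi weight `((t - a) / (b - t)) ^ γ` of the interval `(a, b)`, whose Cauchy transform is
elementary. Its values outside `(a, b)` are junk. -/
noncomputable def jacobiWeight (a b γ t : ℝ) : ℝ := ((t - a) / (b - t)) ^ γ

@[fun_prop]
theorem measurable_jacobiWeight (a b γ : ℝ) : Measurable (jacobiWeight a b γ) := by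
  unfold jacobiWeight
  fun_prop

theorem jacobiWeight_pos {t : ℝ} (ht : t ∈ Set.Ioo a b) : 0 < jacobiWeight a b γ t :=
  Real.rpow_pos_of_pos (div_pos (sub_pos.2 ht.1) (sub_pos.2 ht.2)) _

theorem jacobiWeight_sq {t : ℝ} (ht : t ∈ Set.Ioo a b) (γ : ℝ) :
    jacobiWeight a b γ t ^ 2 = jacobiWeight a b (γ + γ) t := by
  rw [sq]
  exact (Real.rpow_add (div_pos (sub_pos.2 ht.1) (sub_pos.2 ht.2)) γ γ).symm

theorem jacobiWeight_eq {t : ℝ} (ht : t ∈ Set.Ioo a b) (γ : ℝ) :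
    jacobiWeight a b γ t = (t - a) ^ γ * (b - t) ^ (-γ) := by
  rw [jacobiWeight, Real.div_rpow (sub_pos.2 ht.1).le (sub_pos.2 ht.2).le,
    Real.rpow_neg (sub_pos.2 ht.2).le, div_eq_mul_inv]

theorem integrableOn_sub_rpow_Ioo (a b : ℝ) {r : ℝ} (hr : -1 < r) :
    IntegrableOn (fun t : ℝ => (t - a) ^ r) (Set.Ioo a b) := by
  rcases le_or_gt a b with hab | hab
  · have h := (intervalIntegral.intervalIntegrable_rpow' hr (a := 0) (b := b - a)).comp_sub_right a
    simp only [zero_add, sub_add_cancel] at h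
    exact (intervalIntegrable_iff_integrableOn_Ioo_of_le hab).1 h
  · simp [Set.Ioo_eq_empty hab.not_gt]

theorem integrableOn_rpow_sub_Ioo (a b : ℝ) {r : ℝ} (hr : -1 < r) :
    IntegrableOn (fun t : ℝ => (b - t) ^ r) (Set.Ioo a b) := by
  rcases le_or_gt a b with hab | hab
  · have h := (intervalIntegral.intervalIntegrable_rpow' hr (a := 0) (b := b - a)).comp_sub_left b
    simp only [sub_zero, sub_sub_cancel] at h
    exact (intervalIntegrable_iff_integrableOn_Ioo_of_le hab).1 h.symm
  · simp [Set.Ioo_eq_empty hab.not_gt]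

theorem integrableOn_jacobiWeight (a b : ℝ) (h1 : -1 < γ) (h2 : γ < 1) :
    IntegrableOn (jacobiWeight a b γ) (Set.Ioo a b) := by
  rcases le_or_gt 0 γ with h0 | h0
  · refine ((integrableOn_rpow_sub_Ioo a b (r := -γ) (by linarith)).const_mul ((b - a) ^ γ)).mono'
      (measurable_jacobiWeight a b γ).aestronglyMeasurable ?_
    filter_upwards [ae_restrict_mem measurableSet_Ioo] with t ht
    rw [Real.norm_eq_abs, abs_of_pos (jacobiWeight_pos ht), jacobiWeight_eq ht]
    refine mul_le_mul_of_nonneg_right ?_ (Real.rpow_nonneg (sub_pos.2 ht.2).le _)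
    exact Real.rpow_le_rpow (sub_pos.2 ht.1).le (by linarith [ht.2]) h0
  · refine ((integrableOn_sub_rpow_Ioo a b (r := γ) h1).mul_const ((b - a) ^ (-γ))).mono'
      (measurable_jacobiWeight a b γ).aestronglyMeasurable ?_
    filter_upwards [ae_restrict_mem measurableSet_Ioo] with t ht
    rw [Real.norm_eq_abs, abs_of_pos (jacobiWeight_pos ht), jacobiWeight_eq ht]
    refine mul_le_mul_of_nonneg_left ?_ (Real.rpow_nonneg (sub_pos.2 ht.1).le _)
    exact Real.rpow_le_rpow (sub_pos.2 ht.2).le (by linarith [ht.1]) (by linarith)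

theorem integrableOn_jacobiWeight_smul {E : Type*} [NormedAddCommGroup E] [NormedSpace ℝ E]
    (h1 : -1 < γ) (h2 : γ < 1) {φ : ℝ → E} (hφ : Continuous φ) :
    IntegrableOn (fun t => jacobiWeight a b γ t • φ t) (Set.Ioo a b) := by
  obtain ⟨C, hC⟩ := (isCompact_Icc (a := a) (b := b)).exists_bound_of_continuousOn hφ.continuousOn
  refine (integrableOn_jacobiWeight a b h1 h2).smul_bdd C hφ.aestronglyMeasurable ?_
  filter_upwards [ae_restrict_mem measurableSet_Ioo] with t ht
  exact hC t (Set.Ioo_subset_Icc_self ht)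

theorem integral_rpow_mul_one_sub_rpow_neg (h1 : -1 < γ) (h2 : γ < 1) (h0 : γ ≠ 0) :
    ∫ x in (0 : ℝ)..1, x ^ γ * (1 - x) ^ (-γ) = γ * (Real.pi / Real.sin (Real.pi * γ)) := by
  have hbeta := ProbabilityTheory.beta_eq_betaIntegralReal (1 + γ) (1 - γ) (by linarith)
    (by linarith)
  have hcomplex : Complex.betaIntegral (1 + γ : ℝ) (1 - γ : ℝ) =
      ((∫ x in (0 : ℝ)..1, x ^ γ * (1 - x) ^ (-γ) : ℝ) : ℂ) := by
    rw [Complex.betaIntegral, ← intervalIntegral.integral_ofReal]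
    refine intervalIntegral.integral_congr fun x hx => ?_
    rw [Set.uIcc_of_le zero_le_one] at hx
    push_cast
    rw [Complex.ofReal_cpow hx.1, Complex.ofReal_cpow (by linarith [hx.2])]
    push_cast
    congr 2 <;> ring
  rw [hcomplex, Complex.ofReal_re, ProbabilityTheory.beta, add_comm 1 γ, Real.Gamma_add_one h0,
    show γ + 1 + (1 - γ) = 2 by ring, Real.Gamma_two, div_one, mul_assoc,
    Real.Gamma_mul_Gamma_one_sub] at hbeta
  exact hbeta.symm

theorem integral_jacobiWeight (hab : a < b) (h1 : -1 < γ) (h2 : γ < 1) (h0 : γ ≠ 0) :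
    ∫ t in Set.Ioo a b, jacobiWeight a b γ t =
      (b - a) * (γ * (Real.pi / Real.sin (Real.pi * γ))) := by
  have hba : 0 < b - a := sub_pos.2 hab
  have hsubst := intervalIntegral.smul_integral_comp_mul_add (jacobiWeight a b γ) (b - a) a
    (a := 0) (b := 1)
  rw [show (b - a) * 0 + a = a by ring, show (b - a) * 1 + a = b by ring] at hsubst
  rw [← integral_Ioc_eq_integral_Ioo, ← intervalIntegral.integral_of_le hab.le, ← hsubst,
    ← integral_rpow_mul_one_sub_rpow_neg h1 h2 h0, smul_eq_mul]
  congr 1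
  refine intervalIntegral.integral_congr_ae ?_
  filter_upwards [volume.ae_ne 1] with x hx1 hx
  rw [Set.uIoc_of_le zero_le_one] at hx
  have hx' : 0 < 1 - x := sub_pos.2 (lt_of_le_of_ne hx.2 hx1)
  rw [jacobiWeight, Real.rpow_neg hx'.le, ← div_eq_mul_inv, ← Real.div_rpow hx.1.le hx'.le,
    show b - ((b - a) * x + a) = (b - a) * (1 - x) by ring, add_sub_cancel_right,
    mul_div_mul_left _ _ hba.ne']

theorem hasDerivAt_sub_rpow_mul_rpow_sub {t : ℝ} (ht : t ∈ Set.Ioo a b) (γ : ℝ) :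
    HasDerivAt (fun t => (t - a) ^ (1 + γ) * (b - t) ^ (1 - γ))
      (jacobiWeight a b γ t * (γ * (b - a) + a + b - 2 * t)) t := by
  have hta : 0 < t - a := sub_pos.2 ht.1
  have hbt : 0 < b - t := sub_pos.2 ht.2
  have dleft : HasDerivAt (fun t => (t - a) ^ (1 + γ)) ((1 + γ) * (t - a) ^ γ) t := by
    refine (((hasDerivAt_id t).sub_const a).rpow_const (Or.inl hta.ne')).congr_deriv ?_
    simp
  have dright : HasDerivAt (fun t => (b - t) ^ (1 - γ)) (-((1 - γ) * (b - t) ^ (-γ))) t := by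
    refine (((hasDerivAt_id t).const_sub b).rpow_const (Or.inl hbt.ne')).congr_deriv ?_
    simp
    ring
  refine (dleft.mul dright).congr_deriv ?_
  rw [jacobiWeight_eq ht, Real.rpow_add hta, sub_eq_add_neg 1 γ, Real.rpow_add hbt,
    Real.rpow_one, Real.rpow_one]
  ring

theorem integral_jacobiWeight_smul_deriv {E : Type*} [NormedAddCommGroup E] [NormedSpace ℝ E]
    [CompleteSpace E] (hab : a ≤ b) (h1 : -1 < γ) (h2 : γ < 1) {φ φ' : ℝ → E}
    (hφ : ∀ t, HasDerivAt φ (φ' t) t) (hφ' : Continuous φ') :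
    ∫ t in Set.Ioo a b, jacobiWeight a b γ t •
      ((γ * (b - a) + a + b - 2 * t) • φ t + ((t - a) * (b - t)) • φ' t) = 0 := by
  have hc : Continuous φ := continuous_iff_continuousAt.2 fun t => (hφ t).continuousAt
  have hint := integrableOn_jacobiWeight_smul (a := a) (b := b) h1 h2
    (φ := fun t => (γ * (b - a) + a + b - 2 * t) • φ t + ((t - a) * (b - t)) • φ' t) (by fun_prop)
  rw [← integral_Ioc_eq_integral_Ioo, ← intervalIntegral.integral_of_le hab,
    intervalIntegral.integral_eq_sub_of_hasDerivAt_of_le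
      (f := fun t => ((t - a) ^ (1 + γ) * (b - t) ^ (1 - γ)) • φ t) hab ?_ ?_
      ((intervalIntegrable_iff_integrableOn_Ioo_of_le hab).2 hint)]
  · rw [sub_self, sub_self, Real.zero_rpow (by linarith), Real.zero_rpow (by linarith)]
    simp
  · refine ((Continuous.mul ?_ ?_).smul hc).continuousOn
    · exact (continuous_id.sub continuous_const).rpow_const fun t => Or.inr (by linarith)
    · exact (continuous_const.sub continuous_id).rpow_const fun t => Or.inr (by linarith)
  · intro t ht
    have hta : 0 < t - a := sub_pos.2 ht.1
    have hbt : 0 < b - t := sub_pos.2 ht.2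
    refine ((hasDerivAt_sub_rpow_mul_rpow_sub ht γ).smul (hφ t)).congr_deriv ?_
    rw [jacobiWeight_eq ht, Real.rpow_add hta, sub_eq_add_neg 1 γ, Real.rpow_add hbt,
      Real.rpow_one, Real.rpow_one]
    module

theorem integral_mul_jacobiWeight (hab : a ≤ b) (h1 : -1 < γ) (h2 : γ < 1) :
    ∫ t in Set.Ioo a b, t * jacobiWeight a b γ t =
      (γ * (b - a) + a + b) / 2 * ∫ t in Set.Ioo a b, jacobiWeight a b γ t := by
  have h := integral_jacobiWeight_smul_deriv hab h1 h2 (φ := fun _ => (1 : ℝ)) (φ' := fun _ => 0)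
    (fun t => hasDerivAt_const t 1) continuous_const
  have hw := integrableOn_jacobiWeight a b h1 h2
  have htw := integrableOn_jacobiWeight_smul (a := a) (b := b) h1 h2 (φ := fun t => t) continuous_id
  have hsplit : ∀ t, jacobiWeight a b γ t • ((γ * (b - a) + a + b - 2 * t) • (1 : ℝ) +
      ((t - a) * (b - t)) • (0 : ℝ)) = (γ * (b - a) + a + b) * jacobiWeight a b γ t -
      2 * (jacobiWeight a b γ t • t) := by
    intro t
    simp only [smul_eq_mul]
    ring
  simp_rw [hsplit] at h
  rw [integral_sub (hw.const_mul _) (htw.const_mul _), integral_const_mul, integral_const_mul] at h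
  simp_rw [smul_eq_mul, mul_comm (jacobiWeight a b γ _)] at h
  linarith

end JacobiWeight

section JacobiCauchy

variable {a b γ : ℝ} {z : ℂ}

theorem sub_ofReal_ne_zero_of_im_pos (hz : 0 < z.im) (t : ℝ) : z - t ≠ 0 := by
  intro h
  have := congrArg Complex.im h
  simp only [Complex.sub_im, Complex.ofReal_im, sub_zero, Complex.zero_im] at this
  exact hz.ne' this

theorem ofReal_sub_ne_zero_of_im_pos (hz : 0 < z.im) (t : ℝ) : (t : ℂ) - z ≠ 0 :=
  sub_ne_zero.2 (sub_ne_zero.1 (sub_ofReal_ne_zero_of_im_pos hz t)).symm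

theorem im_le_norm_ofReal_sub (z : ℂ) (t : ℝ) : z.im ≤ ‖(t : ℂ) - z‖ := by
  have := Complex.abs_im_le_norm ((t : ℂ) - z)
  simp only [Complex.sub_im, Complex.ofReal_im, zero_sub, abs_neg] at this
  exact (le_abs_self _).trans this

theorem continuous_ofReal_sub_inv (hz : 0 < z.im) :
    Continuous fun t : ℝ => ((t : ℂ) - z)⁻¹ :=
  (Complex.continuous_ofReal.sub continuous_const).inv₀ (ofReal_sub_ne_zero_of_im_pos hz)

/-- The Cauchy transform of the Jacobi weight on `(a, b)`, meant for `z` in the upper half plane. -/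
noncomputable def jacobiCauchy (a b γ : ℝ) (z : ℂ) : ℂ :=
  ∫ t in Set.Ioo a b, jacobiWeight a b γ t • ((t : ℂ) - z)⁻¹

theorem norm_jacobiCauchy_le (h1 : -1 < γ) (h2 : γ < 1) (hz : 0 < z.im) :
    ‖jacobiCauchy a b γ z‖ ≤ (∫ t in Set.Ioo a b, jacobiWeight a b γ t) * z.im⁻¹ := by
  rw [← integral_mul_const]
  refine norm_integral_le_of_norm_le ((integrableOn_jacobiWeight a b h1 h2).mul_const _) ?_
  filter_upwards [ae_restrict_mem measurableSet_Ioo] with t ht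
  rw [norm_smul, Real.norm_eq_abs, abs_of_pos (jacobiWeight_pos ht), norm_inv]
  exact mul_le_mul_of_nonneg_left (inv_anti₀ hz (im_le_norm_ofReal_sub z t))
    (jacobiWeight_pos ht).le

theorem hasDerivAt_jacobiCauchy (h1 : -1 < γ) (h2 : γ < 1) (hz : 0 < z.im) :
    HasDerivAt (jacobiCauchy a b γ)
      (∫ t in Set.Ioo a b, jacobiWeight a b γ t • (((t : ℂ) - z)⁻¹) ^ 2) z := by
  have hs : {w : ℂ | z.im / 2 < w.im} ∈ 𝓝 z :=
    (isOpen_lt continuous_const Complex.continuous_im).mem_nhds (half_lt_self hz)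
  have hpos : ∀ w ∈ {w : ℂ | z.im / 2 < w.im}, 0 < w.im := fun w hw => (half_pos hz).trans hw
  refine (hasDerivAt_integral_of_dominated_loc_of_deriv_le
    (F := fun z t => jacobiWeight a b γ t • ((t : ℂ) - z)⁻¹)
    (F' := fun z t => jacobiWeight a b γ t • (((t : ℂ) - z)⁻¹) ^ 2)
    (bound := fun t => jacobiWeight a b γ t * ((z.im / 2)⁻¹) ^ 2) hs ?_ ?_ ?_ ?_ ?_ ?_).2
  · filter_upwards [hs] with w hw
    exact (integrableOn_jacobiWeight_smul h1 h2 (continuous_ofReal_sub_inv (hpos w hw))).1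
  · exact integrableOn_jacobiWeight_smul h1 h2 (continuous_ofReal_sub_inv hz)
  · exact (integrableOn_jacobiWeight_smul h1 h2 ((continuous_ofReal_sub_inv hz).pow 2)).1
  · filter_upwards [ae_restrict_mem measurableSet_Ioo] with t ht w hw
    rw [norm_smul, Real.norm_eq_abs, abs_of_pos (jacobiWeight_pos ht), norm_pow, norm_inv]
    refine mul_le_mul_of_nonneg_left ?_ (jacobiWeight_pos ht).le
    exact pow_le_pow_left₀ (by positivity)
      (inv_anti₀ (half_pos hz) (le_of_lt hw |>.trans (im_le_norm_ofReal_sub w t))) 2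
  · exact (integrableOn_jacobiWeight a b h1 h2).mul_const _
  · filter_upwards with t w hw
    have hd := ((hasDerivAt_id w).const_sub (t : ℂ)).inv
      (ofReal_sub_ne_zero_of_im_pos (hpos w hw) t)
    refine (hd.const_smul (jacobiWeight a b γ t)).congr_deriv ?_
    simp

theorem deriv_jacobiCauchy_ode (hab : a ≤ b) (h1 : -1 < γ) (h2 : γ < 1) (hz : 0 < z.im) :
    (z - a) * (b - z) * deriv (jacobiCauchy a b γ) z =
      γ * (b - a) * jacobiCauchy a b γ z -
        ((∫ t in Set.Ioo a b, jacobiWeight a b γ t : ℝ) : ℂ) := by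
  have hne := ofReal_sub_ne_zero_of_im_pos hz
  have hcont := continuous_ofReal_sub_inv hz
  have hderiv : ∀ t : ℝ, HasDerivAt (fun t : ℝ => ((t : ℂ) - z)⁻¹) (-(((t : ℂ) - z)⁻¹) ^ 2) t := by
    intro t
    refine (((hasDerivAt_id (t : ℂ)).sub_const z).inv (hne t)).comp_ofReal.congr_deriv ?_
    simp [neg_div]
  have hzero := integral_jacobiWeight_smul_deriv hab h1 h2 hderiv (hcont.pow 2).neg
  have hint0 : IntegrableOn (fun t => (jacobiWeight a b γ t : ℂ)) (Set.Ioo a b) :=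
    (integrableOn_jacobiWeight a b h1 h2).ofReal (𝕜 := ℂ)
  have hint1 : IntegrableOn (fun t => (γ : ℂ) * (b - a) * (jacobiWeight a b γ t • ((t : ℂ) - z)⁻¹))
      (Set.Ioo a b) :=
    (integrableOn_jacobiWeight_smul h1 h2 hcont).const_mul _
  have hint2 : IntegrableOn (fun t => (z - a) * (b - z) *
      (jacobiWeight a b γ t • (((t : ℂ) - z)⁻¹) ^ 2)) (Set.Ioo a b) :=
    (integrableOn_jacobiWeight_smul h1 h2 (hcont.pow 2)).const_mul _
  have hint10 : IntegrableOn (fun t : ℝ => (γ : ℂ) * (b - a) *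
      (jacobiWeight a b γ t • ((t : ℂ) - z)⁻¹) - jacobiWeight a b γ t) (Set.Ioo a b) :=
    hint1.sub hint0
  have hsplit : ∀ t : ℝ, jacobiWeight a b γ t • ((γ * (b - a) + a + b - 2 * t) • ((t : ℂ) - z)⁻¹ +
      ((t - a) * (b - t)) • (-(((t : ℂ) - z)⁻¹) ^ 2)) =
      γ * (b - a) * (jacobiWeight a b γ t • ((t : ℂ) - z)⁻¹) - (jacobiWeight a b γ t : ℂ) -
      (z - a) * (b - z) * (jacobiWeight a b γ t • (((t : ℂ) - z)⁻¹) ^ 2) := by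
    intro t
    simp only [Complex.real_smul]
    have := hne t
    push_cast
    field_simp
    ring
  simp_rw [hsplit] at hzero
  rw [integral_sub hint10 hint2, integral_sub hint1 hint0, integral_const_mul,
    integral_const_mul, integral_complex_ofReal] at hzero
  rw [(hasDerivAt_jacobiCauchy h1 h2 hz).deriv, jacobiCauchy]
  exact (sub_eq_zero.1 hzero).symm

theorem im_sub_div_sub_neg (hab : a < b) (hz : 0 < z.im) : ((z - a) / (z - b)).im < 0 := by
  have hn : 0 < Complex.normSq (z - b) :=
    Complex.normSq_pos.2 (sub_ofReal_ne_zero_of_im_pos hz b)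
  rw [Complex.div_im]
  simp only [Complex.sub_im, Complex.sub_re, Complex.ofReal_im, Complex.ofReal_re, sub_zero]
  rw [← sub_div]
  exact div_neg_of_neg_of_pos (by nlinarith) hn

theorem sub_div_sub_mem_slitPlane (hab : a < b) (hz : 0 < z.im) :
    (z - a) / (z - b) ∈ Complex.slitPlane :=
  Complex.mem_slitPlane_iff.2 (Or.inr (im_sub_div_sub_neg hab hz).ne)

theorem hasDerivAt_jacobiCauchy_sub_mul_cpow (hab : a < b) (h1 : -1 < γ) (h2 : γ < 1)
    (h0 : γ ≠ 0) (hz : 0 < z.im) :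
    HasDerivAt (fun w => (jacobiCauchy a b γ w - (Real.pi / Real.sin (Real.pi * γ) : ℝ)) *
      ((w - a) / (w - b)) ^ (-γ : ℂ)) 0 z := by
  set κ : ℝ := Real.pi / Real.sin (Real.pi * γ) with hκ
  have hza : z - a ≠ 0 := sub_ofReal_ne_zero_of_im_pos hz a
  have hzb : z - b ≠ 0 := sub_ofReal_ne_zero_of_im_pos hz b
  have hslit := sub_div_sub_mem_slitPlane hab hz
  have hode := deriv_jacobiCauchy_ode hab.le h1 h2 hz
  rw [integral_jacobiWeight hab h1 h2 h0, ← hκ] at hode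
  have hderiv : deriv (jacobiCauchy a b γ) z =
      -(γ * (b - a) * (jacobiCauchy a b γ z - κ) / ((z - a) * (z - b))) := by
    rw [eq_neg_iff_add_eq_zero, ← mul_right_inj' (mul_ne_zero hza hzb)]
    field_simp
    push_cast at hode
    linear_combination -hode
  have dmoebius : HasDerivAt (fun w : ℂ => (w - a) / (w - b)) ((a - b) / (z - b) ^ 2) z := by
    refine (((hasDerivAt_id z).sub_const (a : ℂ)).div ((hasDerivAt_id z).sub_const (b : ℂ))
      hzb).congr_deriv ?_
    simp
  have dcauchy := (hasDerivAt_jacobiCauchy (a := a) (b := b) h1 h2 hz).differentiableAt.hasDerivAt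
  refine ((dcauchy.sub_const (κ : ℂ)).mul (dmoebius.cpow_const (c := (-γ : ℂ)) hslit)).congr_deriv
    ?_
  rw [Complex.cpow_sub _ _ (Complex.slitPlane_ne_zero hslit), Complex.cpow_one, hderiv]
  field_simp
  ring

theorem tendsto_jacobiCauchy_mul_I (a b : ℝ) (h1 : -1 < γ) (h2 : γ < 1) :
    Tendsto (fun y : ℝ => jacobiCauchy a b γ (y * Complex.I)) atTop (𝓝 0) := by
  have hbound : Tendsto (fun y : ℝ => (∫ t in Set.Ioo a b, jacobiWeight a b γ t) * y⁻¹) atTop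
      (𝓝 0) := by
    simpa using tendsto_inv_atTop_zero.const_mul (∫ t in Set.Ioo a b, jacobiWeight a b γ t)
  refine squeeze_zero_norm' ?_ hbound
  filter_upwards [eventually_gt_atTop 0] with y hy
  simpa using norm_jacobiCauchy_le (a := a) (b := b) (z := y * Complex.I) h1 h2 (by simpa using hy)

theorem tendsto_sub_div_sub_mul_I (a b : ℝ) :
    Tendsto (fun y : ℝ => ((y * Complex.I : ℂ) - a) / (y * Complex.I - b)) atTop (𝓝 1) := by
  have hbound : Tendsto (fun y : ℝ => ‖(b : ℂ) - a‖ * y⁻¹) atTop (𝓝 0) := by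
    simpa using tendsto_inv_atTop_zero.const_mul ‖(b : ℂ) - a‖
  rw [tendsto_iff_norm_sub_tendsto_zero]
  refine squeeze_zero' (Eventually.of_forall fun _ => norm_nonneg _) ?_ hbound
  filter_upwards [eventually_gt_atTop 0] with y hy
  have him : 0 < (y * Complex.I : ℂ).im := by simpa using hy
  rw [div_sub_one (sub_ofReal_ne_zero_of_im_pos him b), sub_sub_sub_cancel_left, norm_div,
    div_eq_mul_inv, norm_sub_rev (y * Complex.I : ℂ)]
  refine mul_le_mul_of_nonneg_left (inv_anti₀ hy ?_) (norm_nonneg _)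
  simpa using im_le_norm_ofReal_sub (y * Complex.I) b

theorem jacobiCauchy_eq (hab : a < b) (h1 : -1 < γ) (h2 : γ < 1) (h0 : γ ≠ 0) (hz : 0 < z.im) :
    jacobiCauchy a b γ z = (Real.pi / Real.sin (Real.pi * γ) : ℝ) *
      (1 - ((z - a) / (z - b)) ^ (γ : ℂ)) := by
  set κ : ℝ := Real.pi / Real.sin (Real.pi * γ)
  let G : ℂ → ℂ := fun w => (jacobiCauchy a b γ w - κ) * ((w - a) / (w - b)) ^ (-γ : ℂ)
  have hderiv : ∀ w ∈ {w : ℂ | 0 < w.im}, HasDerivAt G 0 w := fun w hw =>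
    hasDerivAt_jacobiCauchy_sub_mul_cpow hab h1 h2 h0 hw
  have hconst : ∀ w ∈ {w : ℂ | 0 < w.im}, G w = G z := fun w hw =>
    (isOpen_lt continuous_const Complex.continuous_im).is_const_of_deriv_eq_zero
      (convex_halfSpace_im_gt 0).isPreconnected
      (fun x hx => (hderiv x hx).differentiableAt.differentiableWithinAt)
      (fun x hx => (hderiv x hx).deriv) hw hz
  have hlim : Tendsto (fun y : ℝ => G (y * Complex.I)) atTop (𝓝 (-κ)) := by
    have hcpow : ContinuousAt (fun x : ℂ => x ^ (-γ : ℂ)) 1 :=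
      continuousAt_cpow_const Complex.one_mem_slitPlane
    simpa using ((tendsto_jacobiCauchy_mul_I a b h1 h2).sub_const (κ : ℂ)).mul
      (hcpow.tendsto.comp (tendsto_sub_div_sub_mul_I a b))
  have hGz : G z = -κ := by
    refine tendsto_nhds_unique (tendsto_const_nhds.congr' ?_) hlim
    filter_upwards [eventually_gt_atTop 0] with y hy
    exact (hconst _ (by simpa using hy)).symm
  have hne := Complex.slitPlane_ne_zero (sub_div_sub_mem_slitPlane hab hz)
  have hmul := congrArg (· * ((z - a) / (z - b)) ^ (γ : ℂ)) hGz
  simp only [G] at hmul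
  rw [mul_assoc, ← Complex.cpow_add _ _ hne, neg_add_cancel, Complex.cpow_zero, mul_one] at hmul
  linear_combination hmul

theorem sub_div_sub_cpow_eq (hab : a < b) (hz : 0 < z.im) :
    ((z - a) / (z - b)) ^ (γ : ℂ) =
      ((z - a) / (b - z)) ^ (γ : ℂ) * Complex.exp (-(Real.pi * γ) * Complex.I) := by
  set m := (z - a) / (b - z) with hm
  have hneg : (z - a) / (z - b) = -m := by rw [hm, ← neg_sub z (b : ℂ), div_neg, neg_neg]
  have him : 0 < m.im := by simpa [hneg] using im_sub_div_sub_neg hab hz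
  have hm0 : m ≠ 0 := fun h => by simp [h] at him
  rw [hneg, Complex.cpow_def_of_ne_zero hm0, Complex.cpow_def_of_ne_zero (neg_ne_zero.2 hm0),
    ← Complex.exp_add, Complex.log, Complex.log, norm_neg,
    Complex.arg_neg_eq_arg_sub_pi_of_im_pos him]
  congr 1
  push_cast
  ring

theorem tendsto_jacobiCauchy (h1 : -1 < γ) (h2 : γ < 1) (h0 : γ ≠ 0) {s : ℝ}
    (hs : s ∈ Set.Ioo a b) :
    Tendsto (jacobiCauchy a b γ) (𝓝[{z | 0 < z.im}] s)
      (𝓝 ((Real.pi / Real.sin (Real.pi * γ) : ℝ) *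
        (1 - jacobiWeight a b γ s * Complex.exp (-(Real.pi * γ) * Complex.I)))) := by
  have hbs : (b : ℂ) - s ≠ 0 := by exact_mod_cast (sub_pos.2 hs.2).ne'
  have hpos : 0 < (s - a) / (b - s) := div_pos (sub_pos.2 hs.1) (sub_pos.2 hs.2)
  have hcont : ContinuousAt (fun z : ℂ => ((z - a) / (b - z)) ^ (γ : ℂ)) s := by
    refine ContinuousAt.cpow (by fun_prop (disch := exact hbs)) continuousAt_const ?_
    exact_mod_cast Complex.ofReal_mem_slitPlane.2 hpos
  have hvalue : (((s : ℂ) - a) / (b - s)) ^ (γ : ℂ) = jacobiWeight a b γ s := by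
    rw [jacobiWeight, Complex.ofReal_cpow hpos.le]
    push_cast
    rfl
  rw [← hvalue]
  refine ((((hcont.tendsto.mono_left nhdsWithin_le_nhds).mul_const _).const_sub 1).const_mul
    _).congr' ?_
  filter_upwards [self_mem_nhdsWithin] with z hz
  rw [jacobiCauchy_eq (hs.1.trans hs.2) h1 h2 h0 hz, sub_div_sub_cpow_eq (hs.1.trans hs.2) hz]

theorem tendsto_re_jacobiCauchy (h1 : -1 < γ) (h2 : γ < 1) (h0 : γ ≠ 0) {s : ℝ}
    (hs : s ∈ Set.Ioo a b) :
    Tendsto (fun z => (jacobiCauchy a b γ z).re) (𝓝[{z | 0 < z.im}] s)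
      (𝓝 (Real.pi / Real.sin (Real.pi * γ) -
        Real.pi * Real.cot (Real.pi * γ) * jacobiWeight a b γ s)) := by
  have hexp : Complex.exp (-(Real.pi * γ) * Complex.I) =
      Real.cos (Real.pi * γ) - Real.sin (Real.pi * γ) * Complex.I := by
    rw [Complex.exp_mul_I, Complex.cos_neg, Complex.sin_neg, neg_mul, ← sub_eq_add_neg]
    push_cast
    rfl
  have hlimit := (Complex.continuous_re.tendsto _).comp (tendsto_jacobiCauchy h1 h2 h0 hs)
  rw [hexp, Complex.re_ofReal_mul] at hlimit
  convert! hlimit using 2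
  rw [Real.cot_eq_cos_div_sin]
  simp only [Complex.sub_re, Complex.one_re, Complex.mul_re, Complex.ofReal_re, Complex.ofReal_im,
    Complex.I_re, Complex.I_im]
  ring

end JacobiCauchy

section BandIntegrals

variable {k₁ k₂ : ℝ} {E : Type*} [NormedAddCommGroup E]

theorem bands_eq_union (hk₁ : 0 < k₁) :
    bands k₁ k₂ = Set.Icc k₁ k₂ ∪ Neg.neg ⁻¹' Set.Icc k₁ k₂ := by
  ext p
  simp only [bands, Set.mem_ofPred_eq, Set.mem_union, Set.mem_preimage]
  rcases le_total 0 p with hp | hp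
  · rw [abs_of_nonneg hp, or_iff_left]
    exact fun h => by linarith [h.1]
  · rw [abs_of_nonpos hp, or_iff_right]
    exact fun h => by linarith [h.1]

theorem disjoint_Icc_preimage_neg (hk₁ : 0 < k₁) :
    Disjoint (Set.Icc k₁ k₂) (Neg.neg ⁻¹' Set.Icc k₁ k₂) :=
  Set.disjoint_left.2 fun p hp hnp => by
    have hneg : k₁ ≤ -p := hnp.1
    linarith [hp.1]

theorem integrableOn_preimage_neg {F : ℝ → E} {s : Set ℝ} :
    IntegrableOn F (Neg.neg ⁻¹' s) ↔ IntegrableOn (fun p => F (-p)) s := by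
  simpa only [Function.comp_def, neg_neg] using
    (Measure.measurePreserving_neg (volume : Measure ℝ)).integrableOn_comp_preimage
      (MeasurableEquiv.neg ℝ).measurableEmbedding (f := fun p => F (-p)) (s := s)

theorem setIntegral_preimage_neg [NormedSpace ℝ E] (F : ℝ → E) (s : Set ℝ) :
    ∫ p in Neg.neg ⁻¹' s, F p = ∫ p in s, F (-p) := by
  simpa only [neg_neg] using
    (Measure.measurePreserving_neg (volume : Measure ℝ)).setIntegral_preimage_emb
      (MeasurableEquiv.neg ℝ).measurableEmbedding (fun p => F (-p)) s

theorem integrableOn_bands_iff (hk₁ : 0 < k₁) {F : ℝ → E} :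
    IntegrableOn F (bands k₁ k₂) ↔
      IntegrableOn F (Set.Icc k₁ k₂) ∧ IntegrableOn (fun p => F (-p)) (Set.Icc k₁ k₂) := by
  rw [bands_eq_union hk₁, integrableOn_union, integrableOn_preimage_neg]

theorem setIntegral_bands [NormedSpace ℝ E] (hk₁ : 0 < k₁) {F : ℝ → E}
    (hF : IntegrableOn F (bands k₁ k₂)) :
    ∫ p in bands k₁ k₂, F p =
      (∫ p in Set.Icc k₁ k₂, F p) + ∫ p in Set.Icc k₁ k₂, F (-p) := by
  rw [bands_eq_union hk₁, integrableOn_union] at hF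
  rw [bands_eq_union hk₁, setIntegral_union (disjoint_Icc_preimage_neg hk₁)
    (measurableSet_Icc.preimage measurable_neg) hF.1 hF.2, setIntegral_preimage_neg]

theorem ae_iff_of_notMem_bands (hk₁ : 0 < k₁) {P : ℝ → Prop}
    (hP : ∀ᵐ p, p ∉ bands k₁ k₂ → P p) :
    (∀ᵐ p, P p) ↔ ∀ᵐ p ∂(volume.restrict (Set.Icc k₁ k₂)), P p ∧ P (-p) := by
  rw [ae_restrict_iff' measurableSet_Icc]
  refine ⟨fun h => ?_, fun h => ?_⟩
  · filter_upwards [h, ae_comp_neg h] with p hp hnp _ using ⟨hp, hnp⟩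
  · filter_upwards [h, ae_comp_neg h, hP] with p hp hnp hoff
    by_cases hmem : p ∈ bands k₁ k₂
    · rcases bands_eq_union hk₁ ▸ hmem with hupper | hlower
      · exact (hp hupper).1
      · simpa only [neg_neg] using (hnp hlower).2
    · exact hoff hmem

end BandIntegrals

section SquareSubstitution

variable {k₁ k₂ : ℝ}

theorem image_sq_Ioo (hk₁ : 0 ≤ k₁) (hk₂ : 0 < k₂) :
    (fun p : ℝ => p ^ 2) '' Set.Ioo k₁ k₂ = Set.Ioo (k₁ ^ 2) (k₂ ^ 2) := by
  ext s
  constructor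
  · rintro ⟨p, hp, rfl⟩
    exact ⟨pow_lt_pow_left₀ hp.1 hk₁ two_ne_zero,
      pow_lt_pow_left₀ hp.2 (hk₁.trans hp.1.le) two_ne_zero⟩
  · rintro ⟨hs₁, hs₂⟩
    exact ⟨√s, ⟨Real.lt_sqrt_of_sq_lt hs₁, (Real.sqrt_lt' hk₂).2 hs₂⟩,
      Real.sq_sqrt ((sq_nonneg _).trans hs₁.le)⟩

theorem injOn_sq_Ioo (hk₁ : 0 ≤ k₁) : Set.InjOn (fun p : ℝ => p ^ 2) (Set.Ioo k₁ k₂) :=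
  fun _ hp _ hq h => (pow_left_inj₀ (hk₁.trans hp.1.le) (hk₁.trans hq.1.le) two_ne_zero).1 h

theorem hasDerivWithinAt_sq (s : Set ℝ) (p : ℝ) :
    HasDerivWithinAt (fun p : ℝ => p ^ 2) (2 * p) s p := by
  simpa using (hasDerivAt_pow 2 p).hasDerivWithinAt

theorem setIntegral_two_mul_comp_sq (hk₁ : 0 ≤ k₁) (hk₂ : 0 < k₂) (φ : ℝ → ℝ) :
    ∫ p in Set.Icc k₁ k₂, 2 * p * φ (p ^ 2) = ∫ t in Set.Ioo (k₁ ^ 2) (k₂ ^ 2), φ t := by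
  rw [← image_sq_Ioo hk₁ hk₂, integral_image_eq_integral_abs_deriv_smul measurableSet_Ioo
    (fun p _ => hasDerivWithinAt_sq _ p) (injOn_sq_Ioo hk₁), integral_Icc_eq_integral_Ioo]
  refine setIntegral_congr_fun measurableSet_Ioo fun p hp => ?_
  rw [abs_of_pos (mul_pos two_pos (hk₁.trans_lt hp.1)), smul_eq_mul]

theorem integrableOn_two_mul_comp_sq (hk₁ : 0 ≤ k₁) (hk₂ : 0 < k₂) {φ : ℝ → ℝ}
    (hφ : IntegrableOn φ (Set.Ioo (k₁ ^ 2) (k₂ ^ 2))) :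
    IntegrableOn (fun p => 2 * p * φ (p ^ 2)) (Set.Icc k₁ k₂) := by
  rw [← image_sq_Ioo hk₁ hk₂, integrableOn_image_iff_integrableOn_abs_deriv_smul
    measurableSet_Ioo (fun p _ => hasDerivWithinAt_sq _ p) (injOn_sq_Ioo hk₁)] at hφ
  rw [integrableOn_Icc_iff_integrableOn_Ioo]
  refine hφ.congr_fun (fun p hp => ?_) measurableSet_Ioo
  simp only [smul_eq_mul, abs_of_pos (mul_pos two_pos (hk₁.trans_lt hp.1))]

theorem bandSign_mul_comp_sq_of_mem (hk₁ : 0 < k₁) {p : ℝ} (hp : p ∈ Set.Icc k₁ k₂) (φ : ℝ → ℝ) :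
    bandSign k₁ k₂ p * (p * φ (p ^ 2)) = 2⁻¹ * (2 * p * φ (p ^ 2)) := by
  rw [bandSign_of_mem hk₁ hp]
  ring

theorem bandSign_mul_comp_sq_neg (p : ℝ) (φ : ℝ → ℝ) :
    bandSign k₁ k₂ (-p) * (-p * φ ((-p) ^ 2)) = bandSign k₁ k₂ p * (p * φ (p ^ 2)) := by
  rw [bandSign_neg, neg_sq, neg_mul, neg_mul, mul_neg, neg_neg]

theorem integrable_bandSign_mul_comp_sq (hk₁ : 0 < k₁) (hk₂ : 0 < k₂) {φ : ℝ → ℝ}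
    (hφ : IntegrableOn φ (Set.Ioo (k₁ ^ 2) (k₂ ^ 2))) :
    Integrable fun p => bandSign k₁ k₂ p * (p * φ (p ^ 2)) := by
  have hupper : IntegrableOn (fun p => bandSign k₁ k₂ p * (p * φ (p ^ 2))) (Set.Icc k₁ k₂) :=
    IntegrableOn.congr_fun ((integrableOn_two_mul_comp_sq hk₁.le hk₂ hφ).const_mul 2⁻¹)
      (fun p hp => (bandSign_mul_comp_sq_of_mem hk₁ hp φ).symm) measurableSet_Icc
  rw [← integrableOn_iff_integrable_of_support_subset (s := bands k₁ k₂)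
    (Function.support_subset_iff'.2 fun p hp => by simp [bandSign, hp]), integrableOn_bands_iff hk₁]
  exact ⟨hupper, by simpa only [bandSign_mul_comp_sq_neg] using hupper⟩

theorem integral_bandSign_mul_comp_sq (hk₁ : 0 < k₁) (hk₂ : 0 < k₂) {φ : ℝ → ℝ}
    (hφ : IntegrableOn φ (Set.Ioo (k₁ ^ 2) (k₂ ^ 2))) :
    ∫ p, bandSign k₁ k₂ p * (p * φ (p ^ 2)) = ∫ t in Set.Ioo (k₁ ^ 2) (k₂ ^ 2), φ t := by
  rw [← setIntegral_eq_integral_of_forall_compl_eq_zero (s := bands k₁ k₂)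
      (fun p hp => by simp [bandSign, hp]),
    setIntegral_bands hk₁ (integrable_bandSign_mul_comp_sq hk₁ hk₂ hφ).integrableOn]
  simp only [bandSign_mul_comp_sq_neg]
  rw [setIntegral_congr_fun measurableSet_Icc fun p hp => bandSign_mul_comp_sq_of_mem hk₁ hp φ,
    integral_const_mul, setIntegral_two_mul_comp_sq hk₁.le hk₂]
  ring

end SquareSubstitution

section BandJacobiWeight

variable {k₁ k₂ γ : ℝ}

variable (k₁ k₂ γ) in
/-- The odd function on the bands that is a Jacobi weight in the variable `p²` on `[k₁, k₂]`. -/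
noncomputable def bandJacobiWeight (p : ℝ) : ℝ :=
  bandSign k₁ k₂ p * jacobiWeight (k₁ ^ 2) (k₂ ^ 2) γ (p ^ 2)

theorem bandJacobiWeight_neg (p : ℝ) :
    bandJacobiWeight k₁ k₂ γ (-p) = -bandJacobiWeight k₁ k₂ γ p := by
  rw [bandJacobiWeight, bandSign_neg, neg_sq, neg_mul, bandJacobiWeight]

theorem ae_sq_mem_Ioo_of_mem_bands (hk₁ : 0 ≤ k₁) :
    ∀ᵐ p, p ∈ bands k₁ k₂ → p ^ 2 ∈ Set.Ioo (k₁ ^ 2) (k₂ ^ 2) := by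
  filter_upwards [volume.ae_ne k₁, volume.ae_ne (-k₁), volume.ae_ne k₂, volume.ae_ne (-k₂)]
    with p h₁ h₁' h₂ h₂' hp
  have hlower : k₁ ≠ |p| := fun h => (eq_or_eq_neg_of_abs_eq h.symm).elim h₁ h₁'
  have hupper : |p| ≠ k₂ := fun h => (eq_or_eq_neg_of_abs_eq h).elim h₂ h₂'
  rw [← sq_abs p]
  exact ⟨pow_lt_pow_left₀ (hp.1.lt_of_ne hlower) hk₁ two_ne_zero,
    pow_lt_pow_left₀ (hp.2.lt_of_ne hupper) (abs_nonneg p) two_ne_zero⟩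

theorem bandSign_mul_self_of_mem (hk₁ : 0 < k₁) {p : ℝ} (hp : p ∈ bands k₁ k₂) :
    bandSign k₁ k₂ p * bandSign k₁ k₂ p = 1 := by
  have hp0 : p ≠ 0 := abs_pos.1 (hk₁.trans_le hp.1)
  rw [bandSign, Set.indicator_of_mem hp]
  rcases Real.sign_apply_eq_of_ne_zero p hp0 with h | h <;> rw [h] <;> norm_num

theorem le_bandSign_mul_of_mem (hk₁ : 0 < k₁) {p : ℝ} (hp : p ∈ bands k₁ k₂) :
    k₁ ≤ bandSign k₁ k₂ p * p := by
  rw [bandSign, Set.indicator_of_mem hp]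
  rcases lt_or_gt_of_ne (abs_pos.1 (hk₁.trans_le hp.1)) with h | h
  · rw [Real.sign_of_neg h, neg_one_mul, ← abs_of_neg h]
    exact hp.1
  · rw [Real.sign_of_pos h, one_mul, ← abs_of_pos h]
    exact hp.1

theorem aestronglyMeasurable_bandJacobiWeight :
    AEStronglyMeasurable (bandJacobiWeight k₁ k₂ γ) volume :=
  (memLp_bandSign 2).aestronglyMeasurable.mul (by fun_prop : Measurable fun p : ℝ =>
    jacobiWeight (k₁ ^ 2) (k₂ ^ 2) γ (p ^ 2)).aestronglyMeasurable

theorem memLp_bandJacobiWeight (hk₁ : 0 < k₁) (hk₂ : 0 < k₂) (h1 : -(1 / 2) < γ) (h2 : γ < 1 / 2) :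
    MemLp (bandJacobiWeight k₁ k₂ γ) 2 volume := by
  rw [memLp_two_iff_integrable_sq aestronglyMeasurable_bandJacobiWeight]
  have hdouble := integrable_bandSign_mul_comp_sq hk₁ hk₂ (integrableOn_jacobiWeight (k₁ ^ 2)
    (k₂ ^ 2) (γ := γ + γ) (by linarith) (by linarith))
  refine (hdouble.const_mul k₁⁻¹).mono' (aestronglyMeasurable_bandJacobiWeight.pow 2) ?_
  filter_upwards [ae_sq_mem_Ioo_of_mem_bands (k₂ := k₂) hk₁.le] with p hmem
  rw [Real.norm_of_nonneg (sq_nonneg _), bandJacobiWeight, mul_pow]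
  by_cases hp : p ∈ bands k₁ k₂
  · have hone : 1 ≤ k₁⁻¹ * (bandSign k₁ k₂ p * p) := by
      rw [← inv_mul_cancel₀ hk₁.ne']
      exact mul_le_mul_of_nonneg_left (le_bandSign_mul_of_mem hk₁ hp) (inv_nonneg.2 hk₁.le)
    rw [pow_two (bandSign k₁ k₂ p), bandSign_mul_self_of_mem hk₁ hp, jacobiWeight_sq (hmem hp),
      ← mul_assoc (bandSign k₁ k₂ p), ← mul_assoc]
    exact mul_le_mul_of_nonneg_right hone (jacobiWeight_pos (hmem hp)).le
  · simp [bandSign, hp]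

theorem conjPoissonKer_sub_sub_conjPoissonKer_add {y : ℝ} (hy : 0 < y) (p q : ℝ) :
    conjPoissonKer y (p - q) - conjPoissonKer y (p + q) =
      q * (-2 * (((q ^ 2 : ℝ) : ℂ) - ((p : ℂ) + y * Complex.I) ^ 2)⁻¹.re) := by
  set z : ℂ := (p : ℂ) + y * Complex.I with hz
  have him : 0 < z.im := by simpa [hz] using hy
  have hsub := sub_ofReal_ne_zero_of_im_pos him q
  have hadd := sub_ofReal_ne_zero_of_im_pos him (-q)
  rw [Complex.ofReal_neg, sub_neg_eq_add] at hadd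
  have hfactor : (q : ℂ) ^ 2 - z ^ 2 = -((z - q) * (z + q)) := by ring
  have hpartial : (z - q)⁻¹ - (z + q)⁻¹ = ((q * -2 : ℝ) : ℂ) * ((q ^ 2 : ℝ) - z ^ 2)⁻¹ := by
    push_cast
    rw [hfactor]
    field_simp
    ring
  have hre (t : ℝ) : (z + t)⁻¹.re = conjPoissonKer y (p + t) := by
    have hz' : z + t = ((p + t : ℝ) : ℂ) + y * Complex.I := by
      push_cast
      ring
    rw [hz', inv_add_mul_I]
    simp
  have hresub := hre (-q)
  rw [Complex.ofReal_neg, ← sub_eq_add_neg, ← sub_eq_add_neg] at hresub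
  rw [← hre, ← hresub, ← Complex.sub_re, hpartial, Complex.re_ofReal_mul, mul_assoc]

theorem im_sq_add_mul_I_pos {p y : ℝ} (hp : 0 < p) (hy : 0 < y) :
    0 < (((p : ℂ) + y * Complex.I) ^ 2).im := by
  have him : (((p : ℂ) + y * Complex.I) ^ 2).im = 2 * (p * y) := by
    simp only [sq, Complex.mul_im, Complex.add_re, Complex.add_im, Complex.ofReal_re,
      Complex.ofReal_im, Complex.re_ofReal_mul, Complex.I_re, Complex.I_im]
    ring
  rw [him]
  positivity

theorem integral_bandJacobiWeight_mul_conjPoissonKer (hk₁ : 0 < k₁) (hk₂ : 0 < k₂)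
    (h1 : -(1 / 2) < γ) (h2 : γ < 1 / 2) {p y : ℝ} (hp : 0 < p) (hy : 0 < y) :
    ∫ q, bandJacobiWeight k₁ k₂ γ q * conjPoissonKer y (p - q) =
      -(jacobiCauchy (k₁ ^ 2) (k₂ ^ 2) γ (((p : ℂ) + y * Complex.I) ^ 2)).re := by
  set z : ℂ := ((p : ℂ) + y * Complex.I) ^ 2
  have hzim : 0 < z.im := im_sq_add_mul_I_pos hp hy
  have hcauchy := integrableOn_jacobiWeight_smul (a := k₁ ^ 2) (b := k₂ ^ 2) (γ := γ)
    (by linarith) (by linarith) (continuous_ofReal_sub_inv hzim)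
  have hint : Integrable fun q => bandJacobiWeight k₁ k₂ γ q * conjPoissonKer y (p - q) :=
    (memLp_bandJacobiWeight hk₁ hk₂ h1 h2).integrable_mul
      (memLp_comp_sub_left (memLp_conjPoissonKer hy) p)
  have hdouble (q : ℝ) : bandJacobiWeight k₁ k₂ γ q * conjPoissonKer y (p - q) +
      bandJacobiWeight k₁ k₂ γ (-q) * conjPoissonKer y (p - -q) = bandSign k₁ k₂ q *
        (q * (-2 * (jacobiWeight (k₁ ^ 2) (k₂ ^ 2) γ (q ^ 2) • ((q ^ 2 : ℝ) - z)⁻¹).re)) := by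
    rw [bandJacobiWeight_neg, sub_neg_eq_add, Complex.smul_re, smul_eq_mul, bandJacobiWeight]
    linear_combination bandSign k₁ k₂ q * jacobiWeight (k₁ ^ 2) (k₂ ^ 2) γ (q ^ 2) *
      conjPoissonKer_sub_sub_conjPoissonKer_add hy p q
  have hsum := integral_add hint hint.comp_neg
  rw [integral_neg_eq_self fun q => bandJacobiWeight k₁ k₂ γ q * conjPoissonKer y (p - q),
    integral_congr_ae (Eventually.of_forall hdouble), integral_bandSign_mul_comp_sq hk₁ hk₂
      (φ := fun t => -2 * (jacobiWeight (k₁ ^ 2) (k₂ ^ 2) γ t • ((t : ℂ) - z)⁻¹).re)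
      (hcauchy.re.const_mul (-2)), integral_const_mul] at hsum
  have hcauchy_re : ∫ t in Set.Ioo (k₁ ^ 2) (k₂ ^ 2),
      (jacobiWeight (k₁ ^ 2) (k₂ ^ 2) γ t • ((t : ℂ) - z)⁻¹).re =
        (jacobiCauchy (k₁ ^ 2) (k₂ ^ 2) γ z).re := integral_re hcauchy
  rw [hcauchy_re] at hsum
  linarith

theorem tendsto_sq_add_mul_I {p : ℝ} (hp : 0 < p) :
    Tendsto (fun y : ℝ => ((p : ℂ) + y * Complex.I) ^ 2) (𝓝[>] 0)
      (𝓝[{z | 0 < z.im}] ((p ^ 2 : ℝ) : ℂ)) := by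
  have hcont : Continuous fun y : ℝ => ((p : ℂ) + y * Complex.I) ^ 2 := by fun_prop
  refine tendsto_nhdsWithin_iff.2 ⟨?_, ?_⟩
  · simpa using (hcont.tendsto 0).mono_left nhdsWithin_le_nhds
  · filter_upwards [self_mem_nhdsWithin] with y hy using im_sq_add_mul_I_pos hp hy

theorem hilbertTransform_bandJacobiWeight_upper (hk₁ : 0 < k₁) (hk₂ : 0 < k₂)
    (h1 : -(1 / 2) < γ) (h2 : γ < 1 / 2) (h0 : γ ≠ 0) :
    ∀ᵐ p, 0 < p → p ∈ bands k₁ k₂ →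
      hilbertTransform (memLp_bandJacobiWeight hk₁ hk₂ h1 h2).toLp p =
        Real.pi * Real.cot (Real.pi * γ) * jacobiWeight (k₁ ^ 2) (k₂ ^ 2) γ (p ^ 2) -
          Real.pi / Real.sin (Real.pi * γ) := by
  have hcoe := (memLp_bandJacobiWeight hk₁ hk₂ h1 h2).coeFn_toLp
  filter_upwards [ae_tendsto_integral_mul_conjPoissonKer
      (memLp_bandJacobiWeight hk₁ hk₂ h1 h2).toLp, ae_sq_mem_Ioo_of_mem_bands (k₂ := k₂) hk₁.le]
    with p hlim hmem hp hband
  have hboundary := ((tendsto_re_jacobiCauchy (by linarith) (by linarith) h0 (hmem hband)).comp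
    (tendsto_sq_add_mul_I hp)).neg
  rw [neg_sub] at hboundary
  refine tendsto_nhds_unique_of_eventuallyEq hlim hboundary ?_
  filter_upwards [self_mem_nhdsWithin] with y hy
  rw [Function.comp_apply, ← integral_bandJacobiWeight_mul_conjPoissonKer hk₁ hk₂ h1 h2 hp hy]
  refine integral_congr_ae ?_
  filter_upwards [hcoe] with q hq
  rw [hq]

theorem hilbertTransform_bandJacobiWeight (hk₁ : 0 < k₁) (hk₂ : 0 < k₂)
    (h1 : -(1 / 2) < γ) (h2 : γ < 1 / 2) (h0 : γ ≠ 0) :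
    ∀ᵐ p, p ∈ bands k₁ k₂ →
      hilbertTransform (memLp_bandJacobiWeight hk₁ hk₂ h1 h2).toLp p =
        Real.pi * Real.cot (Real.pi * γ) * jacobiWeight (k₁ ^ 2) (k₂ ^ 2) γ (p ^ 2) -
          Real.pi / Real.sin (Real.pi * γ) := by
  have hupper := hilbertTransform_bandJacobiWeight_upper hk₁ hk₂ h1 h2 h0
  set w := (memLp_bandJacobiWeight hk₁ hk₂ h1 h2).toLp
  have hodd : reflection w = -w := by
    have hcoe := (memLp_bandJacobiWeight hk₁ hk₂ h1 h2).coeFn_toLp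
    refine Lp.ext ?_
    filter_upwards [reflection_ae_eq w, Lp.coeFn_neg w, hcoe, ae_comp_neg hcoe]
      with p hrefl hneg hp hnp
    rw [hrefl, hneg, Pi.neg_apply, hp, hnp, bandJacobiWeight_neg]
  have heven : reflection (hilbertTransform w) = hilbertTransform w := by
    rw [← neg_inj, ← hilbertTransform_reflection, hodd, map_neg]
  have hrefl := reflection_ae_eq (hilbertTransform w)
  rw [heven] at hrefl
  filter_upwards [hupper, ae_comp_neg hupper, hrefl] with p hpos hneg heq hp
  rcases lt_or_gt_of_ne (abs_pos.1 (hk₁.trans_le hp.1)) with hlt | hgt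
  · rw [heq, hneg (neg_pos.2 hlt) (neg_mem_bands.2 hp), neg_sq]
  · exact hpos hgt hp

end BandJacobiWeight

section RestSolution

variable {k₁ k₂ γ : ℝ}

theorem bandSignOperator_bandSignOperator_of_ae_eq_zero (hk₁ : 0 < k₁)
    {f : Lp ℝ 2 (volume : Measure ℝ)} (hf : ∀ᵐ p, p ∉ bands k₁ k₂ → f p = 0) :
    bandSignOperator k₁ k₂ (bandSignOperator k₁ k₂ f) = f := by
  refine Lp.ext ?_
  filter_upwards [bandSignOperator_ae_eq (k₁ := k₁) (k₂ := k₂) (bandSignOperator k₁ k₂ f),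
    bandSignOperator_ae_eq (k₁ := k₁) (k₂ := k₂) f, hf] with p h₁ h₂ h₀
  rw [h₁, h₂, ← mul_assoc]
  by_cases hp : p ∈ bands k₁ k₂
  · rw [bandSign_mul_self_of_mem hk₁ hp, one_mul]
  · rw [h₀ hp, mul_zero]

theorem bandPencil_zero_apply (R : ℝ) (f : Lp ℝ 2 (volume : Measure ℝ)) :
    bandPencil k₁ k₂ R 0 f = R⁻¹ • f + bandKernelOperator k₁ k₂ f := by
  simp [bandPencil, NormedSpace.exp_zero]

theorem bandPencil_zero_bandJacobiWeight (hk₁ : 0 < k₁) (hk₂ : 0 < k₂) (h0 : 0 < γ)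
    (h2 : γ < 1 / 2) :
    bandPencil k₁ k₂ (Real.tan (Real.pi * γ)) 0
        (memLp_bandJacobiWeight (γ := γ) hk₁ hk₂ (by linarith) h2).toLp =
      (Real.sin (Real.pi * γ))⁻¹ • bandSignVector k₁ k₂ := by
  have h1 : -(1 / 2) < γ := by linarith
  have hcoe := (memLp_bandJacobiWeight hk₁ hk₂ h1 h2).coeFn_toLp
  have hhilbert := ae_comp_neg (hilbertTransform_bandJacobiWeight hk₁ hk₂ h1 h2 h0.ne')
  set w := (memLp_bandJacobiWeight hk₁ hk₂ h1 h2).toLp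
  have hsupport : bandSignOperator k₁ k₂ (bandSignOperator k₁ k₂ w) = w := by
    refine bandSignOperator_bandSignOperator_of_ae_eq_zero hk₁ ?_
    filter_upwards [hcoe] with p hp hmem
    simp [hp, bandJacobiWeight, bandSign, hmem]
  rw [bandPencil_zero_apply]
  refine Lp.ext ?_
  filter_upwards [Lp.coeFn_add ((Real.tan (Real.pi * γ))⁻¹ • w) (bandKernelOperator k₁ k₂ w),
    Lp.coeFn_smul (Real.tan (Real.pi * γ))⁻¹ w, bandKernelOperator_ae_eq (k₁ := k₁) (k₂ := k₂) w,
    Lp.coeFn_smul (Real.sin (Real.pi * γ))⁻¹ (bandSignVector k₁ k₂), hcoe,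
    (memLp_bandSign (k₁ := k₁) (k₂ := k₂) 2).coeFn_toLp, hhilbert]
    with p hadd hsmul hkernel hrhs hwp hsign hlimit
  rw [← bandSignVector] at hsign
  rw [hadd, Pi.add_apply, hsmul, Pi.smul_apply, hkernel, hrhs, Pi.smul_apply, hsign, hwp, hsupport,
    smul_eq_mul, smul_eq_mul, bandJacobiWeight]
  by_cases hp : p ∈ bands k₁ k₂
  · rw [hlimit (neg_mem_bands.2 hp), neg_sq, Real.cot_eq_cos_div_sin, Real.tan_eq_sin_div_cos]
    field_simp
    ring
  · simp [bandSign, hp]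

theorem bandExponentOperator_pow_bandSignVector_ae_eq (m : ℕ) :
    (bandExponentOperator k₁ k₂ ^ m) (bandSignVector k₁ k₂) =ᵐ[volume]
      fun p => (-2 * p) ^ m * bandSign k₁ k₂ p := by
  induction m with
  | zero => simpa [bandSignVector] using (memLp_bandSign (k₁ := k₁) (k₂ := k₂) 2).coeFn_toLp
  | succ m ih =>
    filter_upwards [ih, bandExponentOperator_ae_eq
      ((bandExponentOperator k₁ k₂ ^ m) (bandSignVector k₁ k₂))] with p hm hQ
    rw [pow_succ', mul_apply_eq_comp, hQ, hm]
    linear_combination (-2 * p) ^ m * bandExponent_mul_bandSign (k₁ := k₁) (k₂ := k₂) p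

theorem bandForm_bandExponentOperator_pow_bandJacobiWeight (hk₁ : 0 < k₁) (hk₂ : 0 < k₂)
    (h1 : -(1 / 2) < γ) (h2 : γ < 1 / 2) (n : ℕ) :
    bandForm k₁ k₂ ((bandExponentOperator k₁ k₂ ^ (2 * n + 1)) (bandSignVector k₁ k₂))
        (memLp_bandJacobiWeight hk₁ hk₂ h1 h2).toLp =
      (-2) ^ (2 * n + 1) *
        ∫ t in Set.Ioo (k₁ ^ 2) (k₂ ^ 2), t ^ n * jacobiWeight (k₁ ^ 2) (k₂ ^ 2) γ t := by
  have hint : IntegrableOn (fun t => t ^ n * jacobiWeight (k₁ ^ 2) (k₂ ^ 2) γ t)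
      (Set.Ioo (k₁ ^ 2) (k₂ ^ 2)) := by
    simpa only [smul_eq_mul, mul_comm] using integrableOn_jacobiWeight_smul (a := k₁ ^ 2)
      (b := k₂ ^ 2) (γ := γ) (by linarith) (by linarith) (continuous_pow n)
  rw [← integral_bandSign_mul_comp_sq hk₁ hk₂ hint, ← integral_const_mul, bandForm_apply,
    L2.inner_def]
  refine integral_congr_ae ?_
  filter_upwards [bandSignOperator_ae_eq
      ((bandExponentOperator k₁ k₂ ^ (2 * n + 1)) (bandSignVector k₁ k₂)),
    bandExponentOperator_pow_bandSignVector_ae_eq (k₁ := k₁) (k₂ := k₂) (2 * n + 1),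
    (memLp_bandJacobiWeight hk₁ hk₂ h1 h2).coeFn_toLp] with p hsign hpow hw
  rw [RCLike.inner_apply, conj_trivial, hsign, hpow, hw, bandJacobiWeight]
  by_cases hp : p ∈ bands k₁ k₂
  · linear_combination (-2 * p) ^ (2 * n + 1) * bandSign k₁ k₂ p *
      jacobiWeight (k₁ ^ 2) (k₂ ^ 2) γ (p ^ 2) * bandSign_mul_self_of_mem hk₁ hp
  · simp [bandSign, hp]

/-- The moments `B(Qᵐ b, M(x)⁻¹ Qⁿ b)` of the dressing equations on the bands. -/
noncomputable def bandMoment (k₁ k₂ R : ℝ) (m n : ℕ) : ℝ → ℝ :=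
  pencilMoment (bandForm k₁ k₂) (bandExponentOperator k₁ k₂) (bandSignVector k₁ k₂)
    (bandPencil k₁ k₂ R) m n

theorem sin_pi_mul_pos (h0 : 0 < γ) (h1 : γ < 1) : 0 < Real.sin (Real.pi * γ) :=
  Real.sin_pos_of_pos_of_lt_pi (mul_pos Real.pi_pos h0) (mul_lt_of_lt_one_right Real.pi_pos h1)

theorem bandMoment_zero_odd_zero (hk₁ : 0 < k₁) (hk₂ : 0 < k₂) (h0 : 0 < γ) (h2 : γ < 1 / 2)
    (n : ℕ) :
    bandMoment k₁ k₂ (Real.tan (Real.pi * γ)) 0 (2 * n + 1) 0 =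
      Real.sin (Real.pi * γ) * ((-2) ^ (2 * n + 1) *
        ∫ t in Set.Ioo (k₁ ^ 2) (k₂ ^ 2), t ^ n * jacobiWeight (k₁ ^ 2) (k₂ ^ 2) γ t) := by
  have h1 : -(1 / 2) < γ := by linarith
  have hangle : Real.pi * γ < Real.pi / 2 := by nlinarith [Real.pi_pos]
  have hpencil := isDressingPencil_bandPencil (k₂ := k₂) hk₁
    (Real.tan_pos_of_pos_of_lt_pi_div_two (mul_pos Real.pi_pos h0) hangle)
  have hsin : Real.sin (Real.pi * γ) ≠ 0 := (sin_pi_mul_pos h0 (by linarith)).ne'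
  have hsolution : Ring.inverse (bandPencil k₁ k₂ (Real.tan (Real.pi * γ)) 0)
      (bandSignVector k₁ k₂) =
        Real.sin (Real.pi * γ) • (memLp_bandJacobiWeight hk₁ hk₂ h1 h2).toLp := by
    rw [← hpencil.inverse_apply 0 ((memLp_bandJacobiWeight hk₁ hk₂ h1 h2).toLp),
      bandPencil_zero_bandJacobiWeight hk₁ hk₂ h0 h2, map_smul, smul_smul, mul_inv_cancel₀ hsin,
      one_smul]
  rw [bandMoment, hpencil.pencilMoment_symm, pencilMoment, pow_zero, one_apply_eq_self, hsolution,
    map_smul, smul_eq_mul, bandForm_bandExponentOperator_pow_bandJacobiWeight hk₁ hk₂ h1 h2]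

theorem bandMoment_zero_one_zero (hk₁ : 0 < k₁) (hk : k₁ < k₂) (h0 : 0 < γ) (h2 : γ < 1 / 2) :
    bandMoment k₁ k₂ (Real.tan (Real.pi * γ)) 0 1 0 =
      -2 * Real.pi * γ * (k₂ ^ 2 - k₁ ^ 2) := by
  have hmoment := bandMoment_zero_odd_zero hk₁ (hk₁.trans hk) h0 h2 0
  simp only [mul_zero, zero_add, pow_zero, pow_one, one_mul] at hmoment
  have hsin := (sin_pi_mul_pos h0 (by linarith)).ne'
  rw [hmoment, integral_jacobiWeight (pow_lt_pow_left₀ hk hk₁.le two_ne_zero) (by linarith)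
    (by linarith) h0.ne']
  field_simp

theorem bandMoment_zero_three_zero (hk₁ : 0 < k₁) (hk : k₁ < k₂) (h0 : 0 < γ) (h2 : γ < 1 / 2) :
    bandMoment k₁ k₂ (Real.tan (Real.pi * γ)) 0 3 0 =
      -4 * Real.pi * γ * (k₂ ^ 2 - k₁ ^ 2) * (γ * (k₂ ^ 2 - k₁ ^ 2) + k₁ ^ 2 + k₂ ^ 2) := by
  have hmoment := bandMoment_zero_odd_zero hk₁ (hk₁.trans hk) h0 h2 1
  simp only [mul_one, Nat.reduceAdd, pow_one] at hmoment
  have hsin := (sin_pi_mul_pos h0 (by linarith)).ne'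
  have hsq : k₁ ^ 2 < k₂ ^ 2 := pow_lt_pow_left₀ hk hk₁.le two_ne_zero
  rw [hmoment, integral_mul_jacobiWeight hsq.le (by linarith) (by linarith),
    integral_jacobiWeight hsq (by linarith) (by linarith) h0.ne']
  field_simp
  ring

end RestSolution

section BandPotential

variable {k₁ k₂ R α : ℝ}

/-- The potential attached to the dressing equations on the bands. -/
noncomputable def bandPotential (k₁ k₂ R x : ℝ) : ℝ :=
  -2 / Real.pi * deriv (bandMoment k₁ k₂ R 0 0) x

theorem analyticAt_bandPotential (hk₁ : 0 < k₁) (hR : 0 < R) (x : ℝ) :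
    AnalyticAt ℝ (bandPotential k₁ k₂ R) x :=
  analyticAt_const.mul
    ((isDressingPencil_bandPencil hk₁ hR).analyticAt_pencilMoment 0 0 x).deriv

theorem isBigO_bandPotential (hk₁ : 0 < k₁) (hk : k₁ < k₂) (hR : 0 < R)
    (hα : α = Real.arctan R / Real.pi) :
    (fun x => bandPotential k₁ k₂ R x - (-4 * α * (k₂ ^ 2 - k₁ ^ 2) + 4 * α * (k₂ ^ 2 - k₁ ^ 2) *
      (4 * α * (k₂ ^ 2 - k₁ ^ 2) - (k₂ ^ 2 + k₁ ^ 2)) * x ^ 2)) =O[𝓝 0] fun x => x ^ 4 := by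
  have hπα : Real.pi * α = Real.arctan R := by rw [hα, mul_div_cancel₀ _ Real.pi_ne_zero]
  have hα0 : 0 < α := hα ▸ div_pos (Real.arctan_pos.2 hR) Real.pi_pos
  have hα2 : α < 1 / 2 := by
    rw [hα, div_lt_iff₀ Real.pi_pos]
    linarith [Real.arctan_lt_pi_div_two R]
  have hpencil := isDressingPencil_bandPencil (k₂ := k₂) hk₁ hR
  have hodd := hpencil.pencilMoment_zero_zero_neg (J := reflection)
    bandForm_reflection reflection_bandSignVector (reflection_bandPencil R)
  have h₁ := bandMoment_zero_one_zero hk₁ hk hα0 hα2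
  have h₃ := bandMoment_zero_three_zero hk₁ hk hα0 hα2
  rw [hπα, Real.tan_arctan] at h₁ h₃
  refine ((hpencil.isBigO_deriv_pencilMoment hodd).const_mul_left (-2 / Real.pi)).congr_left
    fun x => ?_
  rw [bandPotential, ← bandMoment, ← bandMoment, ← bandMoment, h₁, h₃]
  field_simp
  ring

end BandPotential

section DressingEquations

variable {k₁ k₂ R x : ℝ} {f g : ℝ → ℝ} {v : Lp ℝ 2 (volume : Measure ℝ)}

theorem HasPVIntegral.exists_and_iff {a b p I : ℝ} {φ : ℝ → ℝ} {P : ℝ → Prop}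
    (h : HasPVIntegral a b φ p I) : (∃ J, HasPVIntegral a b φ p J ∧ P J) ↔ P I :=
  ⟨fun ⟨_, hJ, hP⟩ => tendsto_nhds_unique hJ h ▸ hP, fun hP => ⟨I, h, hP⟩⟩

/-- The function on the bands that encodes the pair of densities `(f, g)`: it is `g(p)` at `p` and
`f(p)` at `-p`, for `p` in `[k₁, k₂]`. -/
noncomputable def bandLift (k₁ k₂ : ℝ) (f g : ℝ → ℝ) (p : ℝ) : ℝ :=
  (Set.Icc k₁ k₂).indicator g p + (Set.Icc k₁ k₂).indicator f (-p)

theorem bandLift_neg (f g : ℝ → ℝ) (p : ℝ) :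
    bandLift k₁ k₂ f g (-p) = bandLift k₁ k₂ g f p := by
  rw [bandLift, bandLift, neg_neg, add_comm]

theorem bandLift_of_mem (hk₁ : 0 < k₁) {p : ℝ} (hp : p ∈ Set.Icc k₁ k₂) :
    bandLift k₁ k₂ f g p = g p := by
  have hneg : -p ∉ Set.Icc k₁ k₂ := Set.disjoint_left.1 (disjoint_Icc_preimage_neg hk₁) hp
  rw [bandLift, Set.indicator_of_mem hp, Set.indicator_of_notMem hneg, add_zero]

theorem bandLift_of_notMem (hk₁ : 0 < k₁) {p : ℝ} (hp : p ∉ bands k₁ k₂) :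
    bandLift k₁ k₂ f g p = 0 := by
  rw [bands_eq_union hk₁, Set.mem_union, not_or] at hp
  rw [bandLift, Set.indicator_of_notMem hp.1,
    Set.indicator_of_notMem (show -p ∉ Set.Icc k₁ k₂ from hp.2), add_zero]

theorem memLp_bandLift (hf : MemLp f 2 (volume.restrict (Set.Icc k₁ k₂)))
    (hg : MemLp g 2 (volume.restrict (Set.Icc k₁ k₂))) : MemLp (bandLift k₁ k₂ f g) 2 volume :=
  ((memLp_indicator_iff_restrict measurableSet_Icc).2 hg).add
    (((memLp_indicator_iff_restrict measurableSet_Icc).2 hf).comp_measurePreserving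
      (Measure.measurePreserving_neg volume))

theorem integral_bandLift_mul (hk₁ : 0 < k₁) {K : ℝ → ℝ}
    (hint : Integrable fun q => bandLift k₁ k₂ f g q * K q) :
    ∫ q, bandLift k₁ k₂ f g q * K q =
      (∫ q in Set.Icc k₁ k₂, g q * K q) + ∫ q in Set.Icc k₁ k₂, f q * K (-q) := by
  rw [← setIntegral_eq_integral_of_forall_compl_eq_zero (s := bands k₁ k₂)
      (fun q hq => by rw [bandLift_of_notMem hk₁ hq, zero_mul]),
    setIntegral_bands hk₁ hint.integrableOn]
  congr 1 <;> refine setIntegral_congr_fun measurableSet_Icc fun q hq => ?_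
  · simp only [bandLift_of_mem hk₁ hq]
  · simp only [bandLift_neg, bandLift_of_mem hk₁ hq]

theorem setIntegral_mul_truncKer (s : Set ℝ) (g : ℝ → ℝ) (p ε : ℝ) :
    ∫ q in s, g q * truncKer ε (p - q) = ∫ q in s \ Metric.ball p ε, g q / (p - q) := by
  rw [Set.sdiff_eq, ← setIntegral_indicator measurableSet_ball.compl]
  refine integral_congr_ae (Eventually.of_forall fun q => ?_)
  classical
  simp only [truncKer, Set.indicator_apply, Set.mem_compl_iff, Metric.mem_ball, not_lt,
    Real.dist_eq, abs_sub_comm q p, mul_ite, mul_zero, div_eq_mul_inv]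

theorem hasPVIntegral_of_ae_eq_bandLift (hk₁ : 0 < k₁) (hk : k₁ ≤ k₂)
    (hv : v =ᵐ[volume] bandLift k₁ k₂ f g) :
    ∀ᵐ p ∂(volume.restrict (Set.Icc k₁ k₂)), HasPVIntegral k₁ k₂ (fun q => g q / (p - q)) p
      (hilbertTransform v p - ∫ q in k₁..k₂, f q / (p + q)) := by
  filter_upwards [ae_restrict_of_ae (ae_tendsto_integral_mul_truncKer v),
    ae_restrict_mem measurableSet_Icc] with p hlim hp
  refine (hlim.sub_const _).congr' ?_
  filter_upwards [self_mem_nhdsWithin, Ioc_mem_nhdsGT hk₁] with ε hε hεk₁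
  have hint : Integrable fun q => bandLift k₁ k₂ f g q * truncKer ε (p - q) :=
    ((Lp.memLp v).integrable_mul (memLp_comp_sub_left (memLp_truncKer hε) p)).congr
      (hv.mul (ae_eq_refl _))
  have hlower : ∫ q in Set.Icc k₁ k₂, f q * truncKer ε (p - -q) = ∫ q in k₁..k₂, f q / (p + q) := by
    rw [intervalIntegral.integral_of_le hk, ← integral_Icc_eq_integral_Ioc]
    refine setIntegral_congr_fun measurableSet_Icc fun q hq => ?_
    have hfar : ε ≤ |p + q| :=
      (by linarith [hp.1, hq.1, hεk₁.2] : ε ≤ p + q).trans (le_abs_self _)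
    simp only [truncKer, sub_neg_eq_add, if_pos hfar, div_eq_mul_inv]
  have hcongr : ∫ q, v q * truncKer ε (p - q) =
      ∫ q, bandLift k₁ k₂ f g q * truncKer ε (p - q) := integral_congr_ae (hv.mul (ae_eq_refl _))
  rw [hcongr]
  exact sub_eq_of_eq_add ((integral_bandLift_mul hk₁ hint).trans
    (by rw [setIntegral_mul_truncKer, hlower]))

theorem ae_eq_bandLift_reflection (hv : v =ᵐ[volume] bandLift k₁ k₂ f g) :
    reflection v =ᵐ[volume] bandLift k₁ k₂ g f := by
  filter_upwards [reflection_ae_eq v, ae_comp_neg hv] with p hrefl hp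
  rw [hrefl, hp, bandLift_neg]

theorem hasPVIntegral_of_ae_eq_bandLift_neg (hk₁ : 0 < k₁) (hk : k₁ ≤ k₂)
    (hv : v =ᵐ[volume] bandLift k₁ k₂ f g) :
    ∀ᵐ p ∂(volume.restrict (Set.Icc k₁ k₂)), HasPVIntegral k₁ k₂ (fun q => f q / (p - q)) p
      (-hilbertTransform v (-p) - ∫ q in k₁..k₂, g q / (p + q)) := by
  filter_upwards [hasPVIntegral_of_ae_eq_bandLift hk₁ hk (ae_eq_bandLift_reflection hv),
    ae_restrict_of_ae (Lp.coeFn_neg (reflection (hilbertTransform v))),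
    ae_restrict_of_ae (reflection_ae_eq (hilbertTransform v))] with p hpv hneg hrefl
  rwa [hilbertTransform_reflection, hneg, Pi.neg_apply, hrefl] at hpv

theorem isDressingSolution_iff_hilbertTransform (hk₁ : 0 < k₁) (hk : k₁ ≤ k₂)
    (hf : MemLp f 2 (volume.restrict (Set.Icc k₁ k₂)))
    (hg : MemLp g 2 (volume.restrict (Set.Icc k₁ k₂))) (hv : v =ᵐ[volume] bandLift k₁ k₂ f g) :
    IsDressingSolution k₁ k₂ (fun _ => R) (fun _ => R) x f g ↔
      ∀ᵐ p ∂(volume.restrict (Set.Icc k₁ k₂)),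
        g p - R / Real.pi * Real.exp (2 * p * x) * hilbertTransform v (-p) =
            -(R * Real.exp (2 * p * x)) ∧
          f p + R / Real.pi * Real.exp (-2 * p * x) * hilbertTransform v p =
            R * Real.exp (-2 * p * x) := by
  have hpair : IsDressingSolution k₁ k₂ (fun _ => R) (fun _ => R) x f g ↔ _ ∧ _ :=
    ⟨fun h => ⟨h.eq_g, h.eq_f⟩, fun h => ⟨hf, hg, h.2, h.1⟩⟩
  rw [hpair, ← eventually_and]
  refine eventually_congr ?_
  filter_upwards [hasPVIntegral_of_ae_eq_bandLift hk₁ hk hv,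
    hasPVIntegral_of_ae_eq_bandLift_neg hk₁ hk hv] with p hpv hpv_neg
  rw [hpv.exists_and_iff, hpv_neg.exists_and_iff]
  simp only [sub_add_cancel, add_sub_cancel, mul_neg, ← sub_eq_add_neg]

end DressingEquations

section DressingVector

variable {k₁ k₂ R x : ℝ} {f g : ℝ → ℝ} {v : Lp ℝ 2 (volume : Measure ℝ)}

theorem bandPencil_ae_eq (v : Lp ℝ 2 (volume : Measure ℝ)) :
    bandPencil k₁ k₂ R x v =ᵐ[volume] fun p =>
      R⁻¹ * (Real.exp (x * bandExponent k₁ k₂ p) * v p) - Real.pi⁻¹ * (bandSign k₁ k₂ p *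
        hilbertTransform (bandSignOperator k₁ k₂ (bandSignOperator k₁ k₂ v)) (-p)) := by
  filter_upwards [Lp.coeFn_add (R⁻¹ • NormedSpace.exp (x • bandExponentOperator k₁ k₂) v)
      (bandKernelOperator k₁ k₂ v), bandKernelOperator_ae_eq (k₁ := k₁) (k₂ := k₂) v,
    Lp.coeFn_smul R⁻¹ (NormedSpace.exp (x • bandExponentOperator k₁ k₂) v),
    exp_bandExponentOperator_ae_eq (k₁ := k₁) (k₂ := k₂) x v] with p hadd hT hsmul hexp
  rw [bandPencil, add_apply, smul_apply, hadd, Pi.add_apply, hsmul, Pi.smul_apply, hexp, hT,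
    smul_eq_mul, neg_mul, ← sub_eq_add_neg]

theorem bandPencil_eq_neg_bandSignVector_iff_ae :
    bandPencil k₁ k₂ R x v = -bandSignVector k₁ k₂ ↔
      ∀ᵐ p, R⁻¹ * (Real.exp (x * bandExponent k₁ k₂ p) * v p) - Real.pi⁻¹ * (bandSign k₁ k₂ p *
        hilbertTransform (bandSignOperator k₁ k₂ (bandSignOperator k₁ k₂ v)) (-p)) =
          -bandSign k₁ k₂ p := by
  rw [Lp.ext_iff]
  refine eventually_congr ?_
  filter_upwards [bandPencil_ae_eq (k₁ := k₁) (k₂ := k₂) (R := R) (x := x) v,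
    Lp.coeFn_neg (bandSignVector k₁ k₂),
    (memLp_bandSign (k₁ := k₁) (k₂ := k₂) 2).coeFn_toLp] with p hpencil hneg hsign
  rw [← bandSignVector] at hsign
  rw [hpencil, hneg, Pi.neg_apply, hsign]

theorem ae_eq_zero_of_bandPencil_eq (hR : R ≠ 0)
    (h : bandPencil k₁ k₂ R x v = -bandSignVector k₁ k₂) :
    ∀ᵐ p, p ∉ bands k₁ k₂ → v p = 0 := by
  filter_upwards [bandPencil_eq_neg_bandSignVector_iff_ae.1 h] with p hp hmem
  simpa [bandSign, bandExponent, hmem, hR] using hp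

theorem bandPencil_eq_neg_bandSignVector_iff (hk₁ : 0 < k₁)
    (hv : ∀ᵐ p, p ∉ bands k₁ k₂ → v p = 0) :
    bandPencil k₁ k₂ R x v = -bandSignVector k₁ k₂ ↔
      ∀ᵐ p ∂(volume.restrict (Set.Icc k₁ k₂)),
        R⁻¹ * (Real.exp (-(2 * p * x)) * v p) + -(Real.pi⁻¹ * hilbertTransform v (-p)) = -1 ∧
          R⁻¹ * (Real.exp (-(-2 * p * x)) * v (-p)) + Real.pi⁻¹ * hilbertTransform v p = 1 := by
  rw [bandPencil_eq_neg_bandSignVector_iff_ae,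
    bandSignOperator_bandSignOperator_of_ae_eq_zero hk₁ hv,
    ae_iff_of_notMem_bands (k₂ := k₂) hk₁ ?off]
  case off =>
    filter_upwards [hv] with p hp hmem
    simp [bandSign, hmem, hp hmem]
  refine eventually_congr ?_
  filter_upwards [ae_restrict_mem measurableSet_Icc] with p hp
  have hexponent : bandExponent k₁ k₂ p = -2 * p := by
    simpa [bandSign_of_mem hk₁ hp] using bandExponent_mul_bandSign (k₁ := k₁) (k₂ := k₂) p
  rw [bandExponent_neg, hexponent, bandSign_neg, bandSign_of_mem hk₁ hp, neg_neg]
  ring_nf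

theorem inv_mul_exp_neg_mul_add_eq_iff (hR : R ≠ 0) (θ a s r : ℝ) :
    R⁻¹ * (Real.exp (-θ) * a) + s = r ↔ a + R * Real.exp θ * s = R * Real.exp θ * r := by
  have hexp := Real.exp_ne_zero θ
  rw [Real.exp_neg]
  field_simp

variable (k₁ k₂ R x) in
/-- The solution `-M(x)⁻¹ b` of the dressing equations, as a function on the bands. -/
noncomputable def dressingVector : Lp ℝ 2 (volume : Measure ℝ) :=
  -Ring.inverse (bandPencil k₁ k₂ R x) (bandSignVector k₁ k₂)

theorem bandPencil_eq_neg_bandSignVector_iff_eq_dressingVector (hk₁ : 0 < k₁) (hR : 0 < R) :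
    bandPencil k₁ k₂ R x v = -bandSignVector k₁ k₂ ↔ v = dressingVector k₁ k₂ R x := by
  have hpencil := isDressingPencil_bandPencil (k₂ := k₂) hk₁ hR
  rw [dressingVector, ← map_neg]
  refine ⟨fun h => ?_, fun h => ?_⟩
  · rw [← h, hpencil.inverse_apply]
  · rw [h, hpencil.apply_inverse]

theorem isDressingSolution_iff (hk₁ : 0 < k₁) (hk : k₁ ≤ k₂) (hR : 0 < R)
    (hf : MemLp f 2 (volume.restrict (Set.Icc k₁ k₂)))
    (hg : MemLp g 2 (volume.restrict (Set.Icc k₁ k₂))) (hv : v =ᵐ[volume] bandLift k₁ k₂ f g) :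
    IsDressingSolution k₁ k₂ (fun _ => R) (fun _ => R) x f g ↔ v = dressingVector k₁ k₂ R x := by
  have hsupport : ∀ᵐ p, p ∉ bands k₁ k₂ → v p = 0 := by
    filter_upwards [hv] with p hp hmem
    rw [hp, bandLift_of_notMem hk₁ hmem]
  rw [← bandPencil_eq_neg_bandSignVector_iff_eq_dressingVector hk₁ hR,
    isDressingSolution_iff_hilbertTransform hk₁ hk hf hg hv,
    bandPencil_eq_neg_bandSignVector_iff hk₁ hsupport]
  refine eventually_congr ?_
  filter_upwards [ae_restrict_of_ae hv, ae_restrict_of_ae (ae_comp_neg hv),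
    ae_restrict_mem measurableSet_Icc] with p hp hnp hmem
  rw [bandLift_of_mem hk₁ hmem] at hp
  rw [bandLift_neg, bandLift_of_mem hk₁ hmem] at hnp
  rw [hp, hnp, inv_mul_exp_neg_mul_add_eq_iff hR.ne', inv_mul_exp_neg_mul_add_eq_iff hR.ne']
  ring_nf

theorem dressingVector_ae_eq_zero (hk₁ : 0 < k₁) (hR : 0 < R) :
    ∀ᵐ p, p ∉ bands k₁ k₂ → dressingVector k₁ k₂ R x p = 0 :=
  ae_eq_zero_of_bandPencil_eq hR.ne'
    ((bandPencil_eq_neg_bandSignVector_iff_eq_dressingVector hk₁ hR).2 rfl)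

theorem ae_eq_bandLift_self (hk₁ : 0 < k₁) (hv : ∀ᵐ p, p ∉ bands k₁ k₂ → v p = 0) :
    v =ᵐ[volume] bandLift k₁ k₂ (fun q => v (-q)) v := by
  filter_upwards [hv] with p hp
  by_cases hmem : p ∈ bands k₁ k₂
  · rcases bands_eq_union hk₁ ▸ hmem with hupper | hlower
    · rw [bandLift_of_mem hk₁ hupper]
    · rw [← neg_neg p, bandLift_neg, bandLift_of_mem hk₁ hlower]
  · rw [hp hmem, bandLift_of_notMem hk₁ hmem]

theorem isDressingSolution_dressingVector (hk₁ : 0 < k₁) (hk : k₁ ≤ k₂) (hR : 0 < R) (x : ℝ) :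
    IsDressingSolution k₁ k₂ (fun _ => R) (fun _ => R) x
      (fun q => dressingVector k₁ k₂ R x (-q)) (dressingVector k₁ k₂ R x) :=
  (isDressingSolution_iff hk₁ hk hR
    (((Lp.memLp _).comp_measurePreserving (Measure.measurePreserving_neg volume)).restrict _)
    ((Lp.memLp _).restrict _) (ae_eq_bandLift_self hk₁ (dressingVector_ae_eq_zero hk₁ hR))).2 rfl

theorem bandForm_bandSignVector_of_ae_eq_bandLift (hk₁ : 0 < k₁)
    (hv : v =ᵐ[volume] bandLift k₁ k₂ f g) :
    bandForm k₁ k₂ (bandSignVector k₁ k₂) v =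
      (∫ q in Set.Icc k₁ k₂, g q) + ∫ q in Set.Icc k₁ k₂, f q := by
  have hsupport : ∀ᵐ p, p ∉ bands k₁ k₂ → v p = 0 := by
    filter_upwards [hv] with p hp hmem
    rw [hp, bandLift_of_notMem hk₁ hmem]
  have hsign := bandSignOperator_bandSignOperator_of_ae_eq_zero hk₁ hsupport
  have hint : Integrable (bandLift k₁ k₂ f g) :=
    (hsign ▸ integrable_bandSignOperator (bandSignOperator k₁ k₂ v)).congr hv
  rw [bandForm_bandSignVector, hsign, integral_congr_ae hv]
  simpa only [mul_one] using
    integral_bandLift_mul hk₁ (K := fun _ => 1) (by simpa only [mul_one] using hint)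

theorem IsDressingSolution.integral_densities (hk₁ : 0 < k₁) (hk : k₁ ≤ k₂) (hR : 0 < R)
    (h : IsDressingSolution k₁ k₂ (fun _ => R) (fun _ => R) x f g) :
    ∫ q in k₁..k₂, (f q + g q) = -bandMoment k₁ k₂ R 0 0 x := by
  have hv := (memLp_bandLift h.memLp_f h.memLp_g).coeFn_toLp
  have hvector := (isDressingSolution_iff hk₁ hk hR h.memLp_f h.memLp_g hv).1 h
  have hform := bandForm_bandSignVector_of_ae_eq_bandLift hk₁ hv
  rw [hvector, dressingVector, map_neg] at hform
  rw [intervalIntegral.integral_of_le hk, ← integral_Icc_eq_integral_Ioc,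
    integral_add (h.memLp_f.integrable one_le_two) (h.memLp_g.integrable one_le_two), add_comm,
    ← hform, bandMoment, pencilMoment, pow_zero, one_apply_eq_self]

theorem isSymmetricPrimitivePotential_iff (hk₁ : 0 < k₁) (hk : k₁ ≤ k₂) (hR : 0 < R)
    {u : ℝ → ℝ} :
    IsSymmetricPrimitivePotential k₁ k₂ (fun _ => R) u ↔ u = bandPotential k₁ k₂ R := by
  have hderiv {f g : ℝ → ℝ → ℝ} (h : ∀ x, IsDressingSolution k₁ k₂ (fun _ => R) (fun _ => R) x
      (fun q => f q x) (fun q => g q x)) (x : ℝ) :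
      HasDerivAt (fun y => 2 / Real.pi * ∫ q in k₁..k₂, (f q y + g q y))
        (bandPotential k₁ k₂ R x) x := by
    simp only [fun y => (h y).integral_densities hk₁ hk hR, mul_neg, ← neg_mul, ← neg_div]
    exact ((isDressingPencil_bandPencil hk₁ hR).analyticAt_pencilMoment 0 0
      x).differentiableAt.hasDerivAt.const_mul _
  constructor
  · rintro ⟨f, g, hsol, hu⟩
    exact funext fun x => (hu x).unique (hderiv hsol x)
  · rintro rfl
    have hsol := isDressingSolution_dressingVector hk₁ hk hR
    exact ⟨_, _, hsol, hderiv hsol⟩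

end DressingVector

theorem mainTheorem4 (k₁ k₂ R α : ℝ) (hk₁ : 0 < k₁) (hk : k₁ < k₂) (hR : 0 < R)
    (hα : α = Real.arctan R / Real.pi) :
    (∃! u : ℝ → ℝ, IsSymmetricPrimitivePotential k₁ k₂ (fun _ => R) u) ∧
    ∀ u : ℝ → ℝ, IsSymmetricPrimitivePotential k₁ k₂ (fun _ => R) u →
      AnalyticAt ℝ u 0 ∧
      (fun x => u x - (-4 * α * (k₂ ^ 2 - k₁ ^ 2) +
          4 * α * (k₂ ^ 2 - k₁ ^ 2) *
            (4 * α * (k₂ ^ 2 - k₁ ^ 2) - (k₂ ^ 2 + k₁ ^ 2)) * x ^ 2))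
        =O[𝓝 0] (fun x => x ^ 4) := by
  simp only [isSymmetricPrimitivePotential_iff hk₁ hk.le hR]
  refine ⟨existsUnique_eq, ?_⟩
  rintro u rfl
  exact ⟨analyticAt_bandPotential hk₁ hR 0, isBigO_bandPotential hk₁ hk hR hα⟩
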